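/- All digraphs are finite, without loops and multiple arcs. Write $xy$ for the arc from $x$ to $y$ ("$x$ dominates $y$"); distinct vertices $x,y$ are adjacent if at least one of $xy,yx$ is an arc. For a vertex $x$ and a vertex set $S$ let $d(x,S)$ be the number of arcs from $x$ to $S$ plus the number of arcs from $S$ to $x$, and $d(x)=d(x,V(D))$. For vertex sets $S,T$, $S\to T$ means that every vertex of $S$ dominates every vertex of $T$, and $E(S\to T)$ is the set of arcs from $S$ to $T$. A digraph is complete if any two distinct vertices are joined by arcs in both directions. $G^*$ is obtained from an undirected graph $G$ by replacing each edge by two opposite arcs; $\cup$ is disjoint union, $+$ is join, and $K^*_{s,t}$ is the complete bipartite digraph. $D\langle S\rangle$ is the subdigraph induced by $S$. $D$ is 2-strong if it has at least three vertices and stays strongly connected after deleting any set of at most one vertex. **Theorem D.** Let $D$ be a strongly connected non-Hamiltonian digraph of order $p\ge 3$ such that $d(x)+d(y)\ge 2p-2$ for every pair of distinct non-adjacent vertices $x,y$. Let $C_m=x_1x_2\ldots x_mx_1$ be any longest cycle of $D$ ($m$ is its length, indices are modulo $m$), let $A=V(D)\setminus V(C_m)$, and let $D_1,\dots,D_h$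 be the strong components of $D\langle A\rangle$, labelled so that no vertex of $D_i$ dominates a vertex of $D_j$ whenever $i>j$. Then: (I) Any two distinct vertices of $A$ are adjacent; $d(z)\le p-1$ for every $z\in A$; every $D_i$ is complete. (II) If $D\not\cong[(K_{p-m}\cup K_{m-1})+K_1]^*$, then for every $l\in\{1,\dots,h\}$ there are two distinct vertices $x_a,x_b$ of $C_m$ and vertices $u,v\in V(D_l)$ (possibly $u=v$) such that $x_au$ and $vx_b$ are arcs and, with $B_l:=\{x_{a+1},x_{a+2},\dots,x_{b-1}\}$ (the vertices of $C_m$ strictly between $x_a$ and $x_b$, following the cycle from $x_a$ to $x_b$), all of the following hold: $B_l\ne\emptyset$; $$E\bigl(B_l\to V(D_1)\cup\dots\cup V(D_l)\bigr)=E\bigl(V(D_l)\cup\dots\cup V(D_h)\to B_l\bigr)=\emptyset,$$ in particular there is no arc between $V(D_l)$ and $B_l$; $D\langle B_l\rangle$ is complete; $$V(D_1)\cup\dots\cup V(D_{l-1})\to B_l\cup V(D_l)\to V(D_{l+1})\cup\dots\cup V(D_h);$$ $d(z,V(C_m))=m-|B_l|+1$ for all $z\in V(D_l)$ and $d(y,V(C_m))=m+|B_l|-1$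 for all $y\in B_l$; $|B_l|\ge|V(D_l)|$; no vertex $w\in V(D_l)\cup B_l$ can be inserted into the subpath $C_m[x_b,x_a]=x_bx_{b+1}\ldots x_a$ of $C_m$, that is, there are no consecutive vertices $x_i,x_{i+1}$ of this path such that $x_iw$ and $wx_{i+1}$ are arcs; in particular $\{x_a\}\to B_l\cup V(D_l)\to\{x_b\}$. (III) If $D$ is 2-strong, then $D\langle A\rangle$ is a transitive tournament. (IV) $D$ contains a cycle of length $r$ for every integer $r$ with $2\le r\le m$, unless $p$ is odd and $D\cong K^*_{\lfloor p/2\rfloor,\lfloor p/2\rfloor+1}$. -/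

import Mathlib

namespace Digraph

variable {V W : Type*}

/-- Two digraphs are isomorphic. -/
def Isomorphic (G : Digraph V) (H : Digraph W) : Prop :=
  Nonempty (G.Adj ≃r H.Adj)

/-- The subdigraph induced by a set of vertices. -/
def inducedOn (G : Digraph V) (S : Set V) : Digraph S where
  Adj u v := G.Adj u v

/-- No vertex dominates itself. -/
def Loopless (G : Digraph V) : Prop := ∀ v, ¬ G.Adj v v

/-- `u` and `v` are adjacent: at least one of the arcs `uv`, `vu` is present. -/
def Adjacent (G : Digraph V) (u v : V) : Prop := G.Adj u v ∨ G.Adj v u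

/-- Every vertex of `S` dominates every vertex of `T`. -/
def Dominates (G : Digraph V) (S T : Set V) : Prop :=
  ∀ u ∈ S, ∀ v ∈ T, G.Adj u v

/-- There is no arc from a vertex of `S` to a vertex of `T`. -/
def NoArcs (G : Digraph V) (S T : Set V) : Prop :=
  ∀ u ∈ S, ∀ v ∈ T, ¬ G.Adj u v

/-- The number of arcs from `v` to vertices of `S` plus the number of arcs from vertices of `S`
to `v`. -/
noncomputable def degOn (G : Digraph V) (v : V) (S : Set V) : ℕ :=
  {w | w ∈ S ∧ G.Adj v w}.ncard + {w | w ∈ S ∧ G.Adj w v}.ncard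

/-- The degree (out-degree plus in-degree) of a vertex. -/
noncomputable def deg (G : Digraph V) (v : V) : ℕ := G.degOn v Set.univ

/-- Condition `M_k`: `d(x) + d(y) ≥ 2p - 2 + k` for all pairs of distinct non-adjacent vertices
`x, y`, where `p` is the order of the digraph. -/
def ConditionM [Fintype V] (G : Digraph V) (k : ℤ) : Prop :=
  ∀ x y : V, x ≠ y → ¬ G.Adjacent x y →
    2 * (Fintype.card V : ℤ) - 2 + k ≤ (G.deg x : ℤ) + (G.deg y : ℤ)

/-- There is a directed path from every vertex to every other one. -/
def IsStrong (G : Digraph V) : Prop :=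
  ∀ u v : V, Relation.ReflTransGen G.Adj u v

/-- `k`-strong connectivity: there are at least `k + 1` vertices, and deleting any set of fewer than
`k` vertices leaves a strong digraph. -/
def IsKStrong [Fintype V] (G : Digraph V) (k : ℕ) : Prop :=
  k + 1 ≤ Fintype.card V ∧ ∀ S : Set V, S.ncard < k → (G.inducedOn Sᶜ).IsStrong

/-- Any two distinct vertices are joined by arcs in both directions. -/
def IsComplete (G : Digraph V) : Prop := ∀ u v : V, u ≠ v → G.Adj u v

/-- A loopless digraph with exactly one arc between any two distinct vertices, whose arc relation
is transitive. -/
def IsTransitiveTournament (G : Digraph V) : Prop :=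
  G.Loopless ∧ (∀ u v : V, u ≠ v → Xor (G.Adj u v) (G.Adj v u)) ∧
    ∀ u v w : V, G.Adj u v → G.Adj v w → G.Adj u w

/-- `x 0, x 1, …, x (m - 1), x 0` is a directed cycle of length `m ≥ 2`; indices are taken
modulo `m`. -/
def IsCycle (G : Digraph V) {m : ℕ} (x : ZMod m → V) : Prop :=
  2 ≤ m ∧ Function.Injective x ∧ ∀ i, G.Adj (x i) (x (i + 1))

/-- The digraph contains a cycle of length `r`. -/
def HasCycle (G : Digraph V) (r : ℕ) : Prop := ∃ y : ZMod r → V, G.IsCycle y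

/-- A cycle of maximum length. -/
def IsLongestCycle (G : Digraph V) {m : ℕ} (x : ZMod m → V) : Prop :=
  G.IsCycle x ∧ ∀ r, G.HasCycle r → r ≤ m

/-- There is a cycle through all the vertices. -/
def IsHamiltonian (G : Digraph V) : Prop :=
  ∃ (m : ℕ) (y : ZMod m → V), G.IsCycle y ∧ Function.Surjective y

/-- For a cycle `x` and `a ≠ b`, the set `{x (a + 1), x (a + 2), …, x (b - 1)}` of the vertices
strictly between `x a` and `x b` when the cycle is followed from `x a` to `x b`. -/
def between {m : ℕ} (x : ZMod m → V) (a b : ZMod m) : Set V :=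
  x '' {i | 0 < (i - a).val ∧ (i - a).val < (b - a).val}

/-- The vertex `w` can be inserted into the subpath `x b, x (b + 1), …, x a` of the cycle `x`:
for two consecutive vertices `x i`, `x (i + 1)` of this path, both arcs from `x i` to `w` and from
`w` to `x (i + 1)` are present. -/
def CanInsert (G : Digraph V) {m : ℕ} (x : ZMod m → V) (b a : ZMod m) (w : V) : Prop :=
  ∃ i, (i - b).val < (a - b).val ∧ G.Adj (x i) w ∧ G.Adj w (x (i + 1))

/-- `S` is the vertex set of a strong component of the subdigraph induced by `A`: a maximal
nonempty subset of `A` inducing a strong digraph. -/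
def IsStrongComponentOn (G : Digraph V) (A S : Set V) : Prop :=
  Maximal (fun T : Set V => T ⊆ A ∧ T.Nonempty ∧ (G.inducedOn T).IsStrong) S

/-- `D 0, …, D (h - 1)` lists (the vertex sets of) all the strong components of the subdigraph
induced by `A`, each once, and no vertex of `D i` dominates a vertex of `D j` when `i > j`. -/
structure IsComponentLabelling (G : Digraph V) (A : Set V) {h : ℕ} (D : Fin h → Set V) :
    Prop where
  injective : Function.Injective D
  range_eq : Set.range D = {S | G.IsStrongComponentOn A S}
  noArcs : ∀ i j : Fin h, j < i → G.NoArcs (D i) (D j)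

/-- The symmetric digraph `G^*` of an undirected graph `G`. -/
def ofSimpleGraph (G : SimpleGraph V) : Digraph V where
  Adj := G.Adj

/-- The join `G + H` of two undirected graphs: their disjoint union together with all edges
between them. -/
def graphJoin (G : SimpleGraph V) (H : SimpleGraph W) : SimpleGraph (V ⊕ W) :=
  SimpleGraph.sum G H ⊔ _root_.completeBipartiteGraph V W

/-- The digraph `[(K_s ∪ K_t) + K_1]^*`. -/
def twoCliques (s t : ℕ) : Digraph ((Fin s ⊕ Fin t) ⊕ Fin 1) :=
  ofSimpleGraph (graphJoin
    (SimpleGraph.sum (⊤ : SimpleGraph (Fin s)) (⊤ : SimpleGraph (Fin t)))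
    (⊤ : SimpleGraph (Fin 1)))

/-- The complete bipartite digraph `K^*_{s,t}`. -/
def completeBipartite (s t : ℕ) : Digraph (Fin s ⊕ Fin t) :=
  ofSimpleGraph (_root_.completeBipartiteGraph (Fin s) (Fin t))

end Digraph

/-!
The heart of the proof is one degree count. Let `S` be a strong component of the subdigraph induced
by the set `A` of the vertices outside the longest cycle, and suppose that some walk leaves the
cycle at `x_a`, runs through `A` meeting `S`, and returns at `x_b ≠ x_a` (a bypass). Choose `a` and
`b` such that the set `B` of the cycle vertices between them is as small as possible; then there are
no arcs between `S` and `B`. Take a path from `x_b` to `x_a` that contains `C[x_b, x_a]`, lies in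
the cycle and has as many vertices as possible. It misses some `y ∈ B`, as the bypass would
otherwise close it to a longer cycle. For `s ∈ S`, the vertex `s` cannot be inserted into `C[x_b,
x_a]`, nor `y` into the chosen path, as the cycle and the path are longest; this bounds `d(s) +
d(y)` on the cycle by `2m`, and minimality of `B` lets every vertex of `A \ {s}` contribute at most
two arcs. So `d(s) + d(y) ≤ 2p - 2`, and by hypothesis equality holds everywhere
(`LongestSeq.equality`). The equalities say that `B` and `S` are complete, that both have the
extremal pattern of arcs to and from `C[x_b, x_a]` (`Tight`), and that every other vertex of `A`
dominates `S ∪ B` or is dominated by it: this is the structure `Block`, obtained in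
`LongestSeq.block_of_minimal`, from which the adjacency and degree statements and the structure of
`B` are read off.

If one component has a bypass then all have (`LongestSeq.allBlocks`). If none has, a degree count of
the same kind forces two complete digraphs that share one vertex (`LongestSeq.twoComplete`).

In the 2-strong case suppose `|S| ≥ 2`. Then all vertices of `S` have the same neighbours on the
path `C[x_b, x_a]`, likewise for `B`, and each of the two sets dominates an initial segment of the
path and is dominated by a final one, the two segments sharing one vertex
(`Twins.exists_threshold`). Deleting the shared vertex of the set whose initial segment is shorter
leaves no way from this set to the other, because any link that could be used would give a cycle
through the path, `S` and `B` (`Twins.not_isStrong_of_le`).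

As to the cycle lengths, the pattern of arcs from the cycle to a tight vertex `w` is a cyclic word;
if `w` closes no path of `q` consecutive vertices, the word has period `q`
(`CycTight.closes_or_periodic`). When `|B| ≥ 2` the word would have two consecutive periods and be
constant (`Block.hasCycle_of_two_le`). When `B = {b}`, both `z ∈ S` and `b` have periodic words;
unless the word of `z` alternates, a cycle with two jumps, through `z` and `b`, or one through two
vertices of the cycle like `b`, has the missing length (`LongestSeq.alternating`). The alternating
case yields the complete bipartite digraph.
-/

namespace Digraph

open scoped Classical

variable {V : Type*} {G : Digraph V}

/-! ### Paths and cycles given by their vertex sets; reachability inside a vertex set -/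

/-- `G.PathOn u v X`: there is a directed path from `u` to `v` whose vertex set is exactly `X`. -/
inductive PathOn (G : Digraph V) : V → V → Finset V → Prop
  | single (v : V) : PathOn G v v {v}
  | cons {u v w : V} {X : Finset V} : G.Adj u v → PathOn G v w X → u ∉ X →
      PathOn G u w (insert u X)

theorem PathOn.start_mem {u v : V} {X : Finset V} (h : G.PathOn u v X) : u ∈ X := by
  cases h <;> simp

theorem PathOn.append {u v v' w : V} {X Y : Finset V} (h : G.PathOn u v X) (hvv : G.Adj v v')
    (h' : G.PathOn v' w Y) (hd : Disjoint X Y) : G.PathOn u w (X ∪ Y) := by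
  induction h with
  | single v =>
    rw [← Finset.insert_eq]
    exact .cons hvv h' (by simpa using hd)
  | cons hadj hp hn ih =>
    rw [Finset.disjoint_insert_left] at hd
    rw [Finset.insert_union]
    refine .cons hadj (ih hvv hd.2) ?_
    simp [hn, hd.1]

/-- Every vertex of a path starts a path to the same end inside its vertex set. -/
theorem PathOn.suffix {v w : V} {X : Finset V} (h : G.PathOn v w X) {u : V} (hu : u ∈ X) :
    ∃ Y ⊆ X, G.PathOn u w Y := by
  induction h with
  | single v =>
    obtain rfl : u = v := by simpa using hu
    exact ⟨_, subset_rfl, .single _⟩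
  | cons hadj hp hn ih =>
    rcases Finset.mem_insert.1 hu with rfl | h
    · exact ⟨_, subset_rfl, .cons hadj hp hn⟩
    · obtain ⟨Y, hY, hp'⟩ := ih h
      exact ⟨Y, hY.trans (Finset.subset_insert _ _), hp'⟩

/-- A path enumerated by the natural numbers below the size of its vertex set. -/
theorem PathOn.exists_enum {u v : V} {X : Finset V} (h : G.PathOn u v X) :
    ∃ f : ℕ → V, f 0 = u ∧ f (X.card - 1) = v ∧ (∀ i < X.card, f i ∈ X) ∧
      (∀ i < X.card, ∀ j < X.card, f i = f j → i = j) ∧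
      ∀ i, i + 1 < X.card → G.Adj (f i) (f (i + 1)) := by
  induction h with
  | single v => exact ⟨fun _ => v, by simp⟩
  | @cons u v w X hadj hp hn ih =>
    obtain ⟨f, h0, h1, hm, hinj, hs⟩ := ih
    have hpos : 0 < X.card := Finset.card_pos.2 ⟨_, hp.start_mem⟩
    refine ⟨fun i => if i = 0 then u else f (i - 1), by simp, ?_, ?_, ?_, ?_⟩
    · rw [Finset.card_insert_of_notMem hn]
      simp [hpos.ne', h1]
    · intro i hi
      rw [Finset.card_insert_of_notMem hn] at hi
      rcases i with _ | i
      · simp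
      · simp [hm i (by omega)]
    · intro i hi j hj hij
      rw [Finset.card_insert_of_notMem hn] at hi hj
      rcases i with _ | i <;> rcases j with _ | j
      · rfl
      · simp only [↓reduceIte, Nat.add_eq_zero_iff, one_ne_zero, and_false,
          Nat.add_sub_cancel] at hij
        exact absurd (hm j (by omega)) (hij ▸ hn)
      · simp only [↓reduceIte, Nat.add_eq_zero_iff, one_ne_zero, and_false,
          Nat.add_sub_cancel] at hij
        exact absurd (hm i (by omega)) (hij ▸ hn)
      · simp only [Nat.add_eq_zero_iff, one_ne_zero, and_false, ↓reduceIte,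
          Nat.add_sub_cancel] at hij
        rw [hinj i (by omega) j (by omega) hij]
    · intro i hi
      rw [Finset.card_insert_of_notMem hn] at hi
      rcases i with _ | i
      · simpa [h0] using hadj
      · simpa using hs i (by omega)

theorem PathOn.hasCycle {u v : V} {X : Finset V} (h : G.PathOn u v X) (hvu : G.Adj v u)
    (hX : 2 ≤ X.card) : G.HasCycle X.card := by
  obtain ⟨f, h0, h1, hm, hinj, hs⟩ := h.exists_enum
  set n := X.card with hn
  have : NeZero n := ⟨by omega⟩
  refine ⟨fun i => f i.val, hX, ?_, ?_⟩
  · intro i j hij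
    exact ZMod.val_injective _ (hinj _ (ZMod.val_lt i) _ (ZMod.val_lt j) hij)
  · intro i
    have hlt := ZMod.val_lt i
    have h1v : (1 : ZMod n).val = 1 := by
      rw [ZMod.val_one_eq_one_mod, Nat.mod_eq_of_lt (by omega)]
    by_cases hi : i.val + 1 < n
    · have : (i + 1).val = i.val + 1 := by
        rw [ZMod.val_add_of_lt] <;> rw [h1v]
        exact hi
      simp only [this]
      exact hs _ hi
    · have e : i.val = n - 1 := by omega
      have : (i + 1).val = 0 := by
        rw [ZMod.val_add, h1v, e, Nat.sub_add_cancel (by omega), Nat.mod_self]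
      simp only [this, e, h0, h1]
      exact hvu

/-- A set in which all arcs are present has a spanning path between any two distinct vertices. -/
theorem PathOn.of_complete {U : Finset V} (hU : ∀ u ∈ U, ∀ v ∈ U, u ≠ v → G.Adj u v)
    {u v : V} (hu : u ∈ U) (hv : v ∈ U) (huv : u ≠ v) : G.PathOn u v U := by
  induction hn : U.card generalizing U u with
  | zero => simp_all
  | succ n ih =>
    by_cases hw : ∃ w ∈ U, w ≠ u ∧ w ≠ v
    · obtain ⟨w, hwU, hwu, hwv⟩ := hw
      have := ih (U := U.erase u) (u := w)
        (fun a ha b hb => hU a (Finset.mem_of_mem_erase ha) b (Finset.mem_of_mem_erase hb))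
        (by simp [hwU, hwu]) (by simp [hv, huv.symm]) hwv
        (by rw [Finset.card_erase_of_mem hu, hn]; rfl)
      have h2 := PathOn.cons (hU u hu w hwU hwu.symm) this (by simp)
      rwa [Finset.insert_erase hu] at h2
    · push Not at hw
      have : U = insert u {v} := by
        ext a
        simp only [Finset.mem_insert, Finset.mem_singleton]
        constructor
        · intro ha
          by_contra h
          push Not at h
          exact h.2 (hw a ha h.1)
        · rintro (rfl | rfl) <;> assumption
      rw [this]
      exact .cons (hU u hu v hv huv) (.single v) (by simpa using huv)

theorem PathOn.exists_of_complete {U : Finset V} (hU : ∀ u ∈ U, ∀ v ∈ U, u ≠ v → G.Adj u v)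
    {u : V} (hu : u ∈ U) : (∃ v ∈ U, G.PathOn u v U) ∧ ∃ v ∈ U, G.PathOn v u U := by
  by_cases h : ∃ v ∈ U, v ≠ u
  · obtain ⟨v, hv, hvu⟩ := h
    exact ⟨⟨v, hv, .of_complete hU hu hv hvu.symm⟩, ⟨v, hv, .of_complete hU hv hu hvu⟩⟩
  · push Not at h
    obtain rfl : U = {u} := Finset.eq_singleton_iff_unique_mem.2 ⟨hu, h⟩
    exact ⟨⟨u, hu, .single u⟩, ⟨u, hu, .single u⟩⟩

/-- Reachability inside a set `A` of vertices. -/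
def Reach (G : Digraph V) (A : Set V) : V → V → Prop :=
  Relation.ReflTransGen fun u v => G.Adj u v ∧ u ∈ A ∧ v ∈ A

theorem Reach.exists_pathOn {A : Set V} {u v : V} (h : G.Reach A u v) (hv : v ∈ A) :
    ∃ Y : Finset V, (↑Y : Set V) ⊆ A ∧ G.PathOn u v Y := by
  induction h using Relation.ReflTransGen.head_induction_on with
  | refl => exact ⟨{v}, by simpa using hv, .single v⟩
  | @head a c hac _ ih =>
    obtain ⟨Y, hY, hp⟩ := ih
    by_cases ha : a ∈ Y
    · obtain ⟨Z, hZ, hp'⟩ := hp.suffix ha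
      exact ⟨Z, (Finset.coe_subset.2 hZ).trans hY, hp'⟩
    · refine ⟨insert a Y, ?_, .cons hac.1 hp ha⟩
      simp only [Finset.coe_insert]
      exact Set.insert_subset hac.2.1 hY

/-- The strong component of `z` in the subdigraph induced by `A`. -/
def comp (G : Digraph V) (A : Set V) (z : V) : Set V :=
  {w | G.Reach A z w ∧ G.Reach A w z}

theorem mem_comp_self (A : Set V) (z : V) : z ∈ G.comp A z := ⟨.refl, .refl⟩

theorem Reach.mem_iff {A : Set V} {u v : V} (h : G.Reach A u v) : u ∈ A ↔ v ∈ A := by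
  induction h with
  | refl => rfl
  | tail _ h ih => simp [ih, h.2.1, h.2.2]

theorem comp_subset {A : Set V} {z : V} (hz : z ∈ A) : G.comp A z ⊆ A :=
  fun _ hw => hw.1.mem_iff.1 hz

theorem comp_eq_of_mem {A : Set V} {z w : V} (hw : w ∈ G.comp A z) :
    G.comp A w = G.comp A z := by
  ext v
  exact ⟨fun h => ⟨hw.1.trans h.1, h.2.trans hw.2⟩, fun h => ⟨hw.2.trans h.1, h.2.trans hw.1⟩⟩

theorem reach_of_inducedOn {A T : Set V} (hT : T ⊆ A) {u v : T}
    (h : Relation.ReflTransGen (G.inducedOn T).Adj u v) : G.Reach A u v := by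
  induction h with
  | refl => exact .refl
  | tail _ h ih => exact ih.tail ⟨h, hT (Subtype.prop _), hT (Subtype.prop _)⟩

theorem isStrongComponentOn_comp {A : Set V} {z : V} (hz : z ∈ A) :
    G.IsStrongComponentOn A (G.comp A z) := by
  refine ⟨⟨comp_subset hz, ⟨z, mem_comp_self A z⟩, ?_⟩, ?_⟩
  · -- a walk from `z` inside `A` to a vertex of the component stays in the component
    have key : ∀ {u v : V} (hu : u ∈ G.comp A z) (hv : v ∈ G.comp A z), G.Reach A u v →
        Relation.ReflTransGen (G.inducedOn (G.comp A z)).Adj ⟨u, hu⟩ ⟨v, hv⟩ := by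
      intro u v hu hv h
      induction h using Relation.ReflTransGen.head_induction_on with
      | refl => exact .refl
      | @head a c hac hcv ih =>
        have hc : c ∈ G.comp A z := ⟨hu.1.tail hac, Relation.ReflTransGen.trans hcv hv.2⟩
        exact .head (show (G.inducedOn (G.comp A z)).Adj ⟨a, hu⟩ ⟨c, hc⟩ from hac.1) (ih hc)
    rintro ⟨u, hu⟩ ⟨v, hv⟩
    exact key hu hv (hu.2.trans hv.1)
  · rintro T ⟨hTA, -, hT⟩ hsub w hw
    have hzT : z ∈ T := hsub (mem_comp_self A z)
    exact ⟨reach_of_inducedOn hTA (hT ⟨z, hzT⟩ ⟨w, hw⟩),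
      reach_of_inducedOn hTA (hT ⟨w, hw⟩ ⟨z, hzT⟩)⟩

theorem IsStrongComponentOn.eq_comp {A S : Set V} (hS : G.IsStrongComponentOn A S) {z : V}
    (hz : z ∈ S) : S = G.comp A z := by
  obtain ⟨⟨hSA, -, hst⟩, hmax⟩ := hS
  have hsub : S ⊆ G.comp A z := fun w hw =>
    ⟨reach_of_inducedOn hSA (hst ⟨z, hz⟩ ⟨w, hw⟩), reach_of_inducedOn hSA (hst ⟨w, hw⟩ ⟨z, hz⟩)⟩
  exact subset_antisymm hsub (hmax (isStrongComponentOn_comp (hSA hz)).prop hsub)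

/-! ### Counting arcs, insertion into paths, enumerated cycles -/

/-- The number of arcs, in either direction, between `u` and `v`. -/
noncomputable def mult (G : Digraph V) (u v : V) : ℕ :=
  (if G.Adj u v then 1 else 0) + (if G.Adj v u then 1 else 0)

/-- The number of arcs between `v` and the vertices of the finite set `X`; see
`degOn_coe_eq` for the comparison with `degOn`. -/
noncomputable def dg (G : Digraph V) (v : V) (X : Finset V) : ℕ := ∑ w ∈ X, G.mult v w

theorem degOn_coe_eq (v : V) (X : Finset V) : G.degOn v (X : Set V) = G.dg v X := by
  have h1 : {w | w ∈ (X : Set V) ∧ G.Adj v w} = (X.filter fun w => G.Adj v w : Finset V) := by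
    ext; simp
  have h2 : {w | w ∈ (X : Set V) ∧ G.Adj w v} = (X.filter fun w => G.Adj w v : Finset V) := by
    ext; simp
  rw [degOn, h1, h2, Set.ncard_coe_finset, Set.ncard_coe_finset, dg]
  simp only [mult, Finset.sum_add_distrib, Finset.card_filter]

theorem deg_eq [Fintype V] (v : V) : G.deg v = G.dg v Finset.univ := by
  rw [deg, ← degOn_coe_eq, Finset.coe_univ]

theorem mult_comm (u v : V) : G.mult u v = G.mult v u := by
  rw [mult, mult, add_comm]

theorem mult_le_two (u v : V) : G.mult u v ≤ 2 := by
  unfold mult; split_ifs <;> omega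

theorem mult_eq_two_iff {u v : V} : G.mult u v = 2 ↔ G.Adj u v ∧ G.Adj v u := by
  unfold mult; split_ifs <;> simp_all

theorem mult_eq_zero_iff {u v : V} : G.mult u v = 0 ↔ ¬ G.Adj u v ∧ ¬ G.Adj v u := by
  unfold mult; split_ifs <;> simp_all

/-- If neither `u → w → v` nor `v → w → u`, then `w` sends and receives at most two arcs in all to
and from `u` and `v`. -/
theorem mult_add_mult_le {u v w : V} (h1 : ¬ (G.Adj u w ∧ G.Adj w v))
    (h2 : ¬ (G.Adj v w ∧ G.Adj w u)) : G.mult u w + G.mult v w ≤ 2 := by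
  unfold mult; split_ifs <;> simp_all

theorem mult_self (hl : G.Loopless) (v : V) : G.mult v v = 0 :=
  mult_eq_zero_iff.2 ⟨hl v, hl v⟩

theorem dg_union {X Y : Finset V} (h : Disjoint X Y) (v : V) :
    G.dg v (X ∪ Y) = G.dg v X + G.dg v Y := Finset.sum_union h

theorem dg_insert {X : Finset V} {w : V} (h : w ∉ X) (v : V) :
    G.dg v (insert w X) = G.mult v w + G.dg v X := Finset.sum_insert h

theorem dg_le (v : V) (X : Finset V) : G.dg v X ≤ 2 * X.card := by
  unfold dg
  calc _ ≤ ∑ _w ∈ X, 2 := Finset.sum_le_sum fun w _ => mult_le_two v w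
    _ = 2 * X.card := by simp [mul_comm]

theorem dg_erase_self (hl : G.Loopless) (v : V) (X : Finset V) : G.dg v (X.erase v) = G.dg v X :=
  Finset.sum_erase _ (mult_self hl v)

theorem dg_eq_zero {v : V} {X : Finset V} (h : ∀ w ∈ X, ¬ G.Adj v w ∧ ¬ G.Adj w v) :
    G.dg v X = 0 := Finset.sum_eq_zero fun w hw => mult_eq_zero_iff.2 (h w hw)

theorem dg_eq_two_mul {v : V} {X : Finset V} (h : ∀ w ∈ X, G.Adj v w ∧ G.Adj w v) :
    G.dg v X = 2 * X.card := by
  rw [dg, Finset.sum_congr rfl fun w hw => mult_eq_two_iff.2 (h w hw), Finset.sum_const,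
    smul_eq_mul, mul_comm]

theorem eq_two_of_dg_ge {v : V} {X : Finset V} (h : 2 * X.card ≤ G.dg v X) {w : V} (hw : w ∈ X) :
    G.Adj v w ∧ G.Adj w v := by
  rw [← mult_eq_two_iff]
  have : ∑ w ∈ X, G.mult v w = ∑ _w ∈ X, 2 := le_antisymm
    (Finset.sum_le_sum fun w _ => mult_le_two v w) (by simpa [dg, mul_comm] using h)
  exact (Finset.sum_eq_sum_iff_of_le fun w _ => mult_le_two v w).1 this w hw

/-- A vertex outside a path can be inserted into it, or sends and receives few arcs to and from
it. -/
theorem PathOn.insert_or {u w y : V} {X : Finset V} (h : G.PathOn u w X) (hy : y ∉ X) :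
    G.PathOn u w (insert y X) ∨ G.dg y X + 1 ≤
      X.card + (if G.Adj y u then 1 else 0) + (if G.Adj w y then 1 else 0) := by
  induction h with
  | single v => right; simp [dg, mult]
  | @cons u v w X hadj hp hn ih =>
    rw [Finset.mem_insert, not_or] at hy
    rcases ih hy.2 with h | h
    · left
      rw [Finset.insert_comm]
      exact .cons hadj h (by simp [hn, Ne.symm hy.1])
    · by_cases hins : G.Adj u y ∧ G.Adj y v
      · left
        rw [Finset.insert_comm]
        exact .cons hins.1 (.cons hins.2 hp hy.2) (by simp [hn, Ne.symm hy.1])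
      · right
        rw [Finset.card_insert_of_notMem hn, dg_insert hn, mult]
        split_ifs at * <;> first | omega | simp_all

/-- `f 0, f 1, …, f (n - 1), f 0` is a cycle and `f` has period `n`. -/
structure CyclicSeq (G : Digraph V) (n : ℕ) (f : ℕ → V) : Prop where
  two_le : 2 ≤ n
  per : ∀ i, f (i + n) = f i
  inj : ∀ i < n, ∀ j < n, f i = f j → i = j
  adj : ∀ i, G.Adj (f i) (f (i + 1))

/-- The set of the `n` vertices `f a, f (a + 1), …, f (a + n - 1)`. -/
noncomputable def seg (f : ℕ → V) (a n : ℕ) : Finset V :=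
  (Finset.range n).image fun t => f (a + t)

theorem mem_seg {f : ℕ → V} {a n : ℕ} {v : V} :
    v ∈ seg f a n ↔ ∃ i, a ≤ i ∧ i < a + n ∧ f i = v := by
  simp only [seg, Finset.mem_image, Finset.mem_range]
  constructor
  · rintro ⟨t, ht, rfl⟩; exact ⟨a + t, by omega, by omega, rfl⟩
  · rintro ⟨i, h1, h2, rfl⟩; exact ⟨i - a, by omega, by congr 1; omega⟩

theorem mem_seg_of {f : ℕ → V} {a n i : ℕ} (h1 : a ≤ i) (h2 : i < a + n) : f i ∈ seg f a n :=
  mem_seg.2 ⟨i, h1, h2, rfl⟩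

theorem seg_succ (f : ℕ → V) (a n : ℕ) : seg f a (n + 1) = insert (f (a + n)) (seg f a n) := by
  rw [seg, Finset.range_add_one, Finset.image_insert, seg]

namespace CyclicSeq

variable {n : ℕ} {f : ℕ → V} (hf : G.CyclicSeq n f)
include hf

theorem per_mul (i c : ℕ) : f (i + n * c) = f i := by
  induction c with
  | zero => simp
  | succ c ih => rw [Nat.mul_succ, ← add_assoc, hf.per, ih]

theorem apply_mod (i : ℕ) : f (i % n) = f i := by
  conv_rhs => rw [← Nat.mod_add_div i n, hf.per_mul]

theorem pos : 0 < n := by have := hf.two_le; omega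

theorem modEq_of_eq {i j : ℕ} (h : f i = f j) : i ≡ j [MOD n] := by
  rw [← hf.apply_mod i, ← hf.apply_mod j] at h
  exact hf.inj _ (Nat.mod_lt _ hf.pos) _ (Nat.mod_lt _ hf.pos) h

/-- Injectivity on windows of length `n`. -/
theorem eq_of_lt {i j : ℕ} (h : f i = f j) (h1 : i < j + n) (h2 : j < i + n) : i = j := by
  have h3 := hf.modEq_of_eq h
  rcases le_total i j with hle | hle
  · have := (Nat.modEq_iff_dvd' hle).1 h3
    have := Nat.eq_zero_of_dvd_of_lt this (by omega)
    omega
  · have := (Nat.modEq_iff_dvd' hle).1 h3.symm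
    have := Nat.eq_zero_of_dvd_of_lt this (by omega)
    omega

theorem exists_window (a i : ℕ) : ∃ j, a ≤ j ∧ j < a + n ∧ f j = f i := by
  have hp := hf.pos
  refine ⟨a + (i + n * a - a) % n, by omega, by have := Nat.mod_lt (i + n * a - a) hp; omega, ?_⟩
  have : a ≤ i + n * a := le_add_left (Nat.le_mul_of_pos_left a hp)
  have h2 : a + (i + n * a - a) % n + n * ((i + n * a - a) / n) = i + n * a := by
    have := Nat.mod_add_div (i + n * a - a) n
    omega
  rw [← hf.per_mul _ ((i + n * a - a) / n), h2, hf.per_mul]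

theorem mem_seg_full {a : ℕ} {v : V} : v ∈ seg f a n ↔ ∃ i, f i = v := by
  rw [mem_seg]
  constructor
  · rintro ⟨i, _, _, h⟩; exact ⟨i, h⟩
  · rintro ⟨i, rfl⟩; exact hf.exists_window a i

theorem injOn_seg (a : ℕ) {l : ℕ} (hl : l ≤ n) :
    Set.InjOn (fun t => f (a + t)) (Finset.range l : Set ℕ) := by
  intro i hi j hj h
  simp only [Finset.coe_range, Set.mem_Iio] at hi hj
  have := hf.eq_of_lt h (by omega) (by omega)
  omega

theorem card_seg (a : ℕ) {l : ℕ} (hl : l ≤ n) : (seg f a l).card = l := by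
  rw [seg, Finset.card_image_of_injOn (hf.injOn_seg a hl), Finset.card_range]

theorem disjoint_seg {a b k l : ℕ} (h1 : a + k ≤ b) (h2 : b + l ≤ a + n) :
    Disjoint (seg f a k) (seg f b l) := by
  rw [Finset.disjoint_left]
  intro v hv hv'
  obtain ⟨i, hi1, hi2, rfl⟩ := mem_seg.1 hv
  obtain ⟨j, hj1, hj2, h⟩ := mem_seg.1 hv'
  have := hf.eq_of_lt h (by omega) (by omega)
  omega

theorem notMem_seg {a l i : ℕ} (h1 : i < a) (h2 : a + l ≤ i + n) : f i ∉ seg f a l := by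
  intro hv
  obtain ⟨j, hj1, hj2, h⟩ := mem_seg.1 hv
  have := hf.eq_of_lt h (by omega) (by omega)
  omega

theorem notMem_seg' {a l i : ℕ} (h1 : a + l ≤ i) (h2 : i < a + n) : f i ∉ seg f a l := by
  intro hv
  obtain ⟨j, hj1, hj2, h⟩ := mem_seg.1 hv
  have := hf.eq_of_lt h (by omega) (by omega)
  omega

theorem pathOn_seg (a : ℕ) {l : ℕ} (hl : l < n) :
    G.PathOn (f a) (f (a + l)) (seg f a (l + 1)) := by
  induction l with
  | zero => simpa [seg] using PathOn.single (G := G) (f a)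
  | succ l ih =>
    have h := (ih (by omega)).append (hf.adj (a + l)) (PathOn.single _) (by
      rw [Finset.disjoint_singleton_right]
      exact hf.notMem_seg' (by omega) (by omega))
    rwa [Finset.union_comm, ← Finset.insert_eq, add_assoc a l 1, ← seg_succ] at h

/-- `pathOn_seg`, with both ends given. -/
theorem pathOn_seg' {a b l : ℕ} (hb : b + 1 = a + l) (h1 : 1 ≤ l) (hl : l ≤ n) :
    G.PathOn (f a) (f b) (seg f a l) := by
  have h := hf.pathOn_seg a (l := l - 1) (by omega)
  rwa [show a + (l - 1) = b by omega, show l - 1 + 1 = l by omega] at h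

theorem rotate (t : ℕ) : G.CyclicSeq n fun i => f (i + t) where
  two_le := hf.two_le
  per i := by rw [show i + n + t = i + t + n by omega, hf.per]
  inj i hi j hj h := by
    have := hf.eq_of_lt h (by omega) (by omega)
    omega
  adj i := by
    have := hf.adj (i + t)
    rwa [show i + t + 1 = i + 1 + t by omega] at this

theorem range_rotate (t : ℕ) : (Set.range fun i => f (i + t)) = Set.range f := by
  ext v
  constructor
  · rintro ⟨i, rfl⟩; exact ⟨_, rfl⟩
  · rintro ⟨i, rfl⟩
    obtain ⟨j, h1, -, h3⟩ := hf.exists_window t i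
    refine ⟨j - t, ?_⟩
    simp only [Nat.sub_add_cancel h1, h3]

theorem coe_seg (a : ℕ) : (seg f a n : Set V) = Set.range f := by
  ext v
  simp [hf.mem_seg_full]

end CyclicSeq

theorem IsCycle.cyclicSeq {m : ℕ} {x : ZMod m → V} (hx : G.IsCycle x) :
    G.CyclicSeq m fun i => x i where
  two_le := hx.1
  per i := by simp
  inj i hi j hj h := by
    have := hx.2.1 h
    rw [ZMod.natCast_eq_natCast_iff'] at this
    rwa [Nat.mod_eq_of_lt hi, Nat.mod_eq_of_lt hj] at this
  adj i := by simpa using hx.2.2 i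

theorem range_natCast {m : ℕ} [NeZero m] (x : ZMod m → V) :
    (Set.range fun i : ℕ => x i) = Set.range x := by
  ext v
  constructor
  · rintro ⟨i, rfl⟩; exact ⟨_, rfl⟩
  · rintro ⟨i, rfl⟩; exact ⟨i.val, by simp⟩

theorem dg_seg {f : ℕ → V} {k : ℕ} (hinj : ∀ i < k, ∀ j < k, f i = f j → i = j) (w : V) :
    G.dg w (seg f 0 k) = ∑ i ∈ Finset.range k, G.mult w (f i) := by
  rw [dg, seg, Finset.sum_image]
  · simp
  · intro i hi j hj h
    simp only [Finset.coe_range, Set.mem_Iio, zero_add] at hi hj h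
    exact hinj i hi j hj h

theorem sum_mult_succ (f : ℕ → V) (w : V) (k : ℕ) :
    ∑ i ∈ Finset.range (k + 1), G.mult w (f i) =
      (if G.Adj w (f 0) then 1 else 0) + (if G.Adj (f k) w then 1 else 0) +
      ∑ i ∈ Finset.range k,
        ((if G.Adj (f i) w then 1 else 0) + (if G.Adj w (f (i + 1)) then 1 else 0)) := by
  induction k with
  | zero => simp [mult]
  | succ k ih =>
    rw [Finset.sum_range_succ, ih, Finset.sum_range_succ _ k, mult]
    omega

/-- A vertex that cannot be inserted into the path `f 0, …, f k` but sends and receives `k + 2`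
arcs to and from it dominates the first vertex, is dominated by the last one, and for any two
consecutive vertices exactly one of the two arcs needed for an insertion is present. -/
theorem pattern_of_le_sum {f : ℕ → V} {w : V} {k : ℕ}
    (hins : ∀ i < k, ¬ (G.Adj (f i) w ∧ G.Adj w (f (i + 1))))
    (hdeg : k + 2 ≤ ∑ i ∈ Finset.range (k + 1), G.mult w (f i)) :
    G.Adj w (f 0) ∧ G.Adj (f k) w ∧ ∀ i < k, (G.Adj (f i) w ↔ ¬ G.Adj w (f (i + 1))) := by
  rw [sum_mult_succ] at hdeg
  have hle : ∀ i ∈ Finset.range k,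
      ((if G.Adj (f i) w then 1 else 0) + (if G.Adj w (f (i + 1)) then 1 else 0) : ℕ) ≤ 1 := by
    intro i hi
    have := hins i (Finset.mem_range.1 hi)
    split_ifs <;> simp_all
  have hs := Finset.sum_le_sum hle
  simp only [Finset.sum_const, Finset.card_range, smul_eq_mul, mul_one] at hs
  have h0 : G.Adj w (f 0) := by
    by_contra h
    simp only [h, if_false] at hdeg
    split_ifs at hdeg
    all_goals omega
  have hk : G.Adj (f k) w := by
    by_contra h
    simp only [h, if_false] at hdeg
    split_ifs at hdeg
    all_goals omega
  refine ⟨h0, hk, fun i hi => ?_⟩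
  simp only [h0, hk, if_true] at hdeg
  have heq := (Finset.sum_eq_sum_iff_of_le hle).1 (by
    simp only [Finset.sum_const, Finset.card_range, smul_eq_mul, mul_one]; omega) i
      (Finset.mem_range.2 hi)
  split_ifs at heq <;> simp_all

theorem sum_of_pattern {f : ℕ → V} {w : V} {k : ℕ} (h0 : G.Adj w (f 0)) (hk : G.Adj (f k) w)
    (h : ∀ i < k, (G.Adj (f i) w ↔ ¬ G.Adj w (f (i + 1)))) :
    ∑ i ∈ Finset.range (k + 1), G.mult w (f i) = k + 2 := by
  rw [sum_mult_succ]
  simp only [h0, hk, if_true]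
  rw [Finset.sum_congr rfl (g := fun _ => 1)]
  · simp; omega
  · intro i hi
    have := h i (Finset.mem_range.1 hi)
    split_ifs <;> simp_all

/-- A vertex that cannot be inserted into a cycle of length `n` sends and receives at most `n` arcs
to and from it. -/
theorem CyclicSeq.dg_le {n : ℕ} {f : ℕ → V} (hf : G.CyclicSeq n f) {w : V}
    (hins : ∀ i, ¬ (G.Adj (f i) w ∧ G.Adj w (f (i + 1)))) : G.dg w (seg f 0 n) ≤ n := by
  rw [dg_seg hf.inj]
  obtain ⟨k, rfl⟩ : ∃ k, n = k + 1 := ⟨n - 1, by have := hf.pos; omega⟩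
  rw [sum_mult_succ]
  have hk := hins k
  have h0 := hf.per 0
  rw [zero_add] at h0
  rw [h0] at hk
  have hle : ∀ i ∈ Finset.range k,
      ((if G.Adj (f i) w then 1 else 0) + (if G.Adj w (f (i + 1)) then 1 else 0) : ℕ) ≤ 1 := by
    intro i _
    have := hins i
    split_ifs <;> simp_all
  have hs := Finset.sum_le_sum hle
  simp only [Finset.sum_const, Finset.card_range, smul_eq_mul, mul_one] at hs
  split_ifs <;> first | omega | simp_all

/-! ### The degree count at a shortest bypass -/

/-- A walk leads from `u` to `z` all of whose vertices after `u` lie in `A`. -/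
def Enters (G : Digraph V) (A : Set V) (u z : V) : Prop := ∃ w ∈ A, G.Adj u w ∧ G.Reach A w z

/-- A walk leads from `z` to `u` all of whose vertices before `u` lie in `A`. -/
def Leaves (G : Digraph V) (A : Set V) (z u : V) : Prop := ∃ w ∈ A, G.Reach A z w ∧ G.Adj w u

theorem Enters.trans {A : Set V} {u z w : V} (h : G.Enters A u z) (h' : G.Reach A z w) :
    G.Enters A u w := by
  obtain ⟨v, hv, h1, h2⟩ := h
  exact ⟨v, hv, h1, Relation.ReflTransGen.trans h2 h'⟩

theorem Leaves.trans {A : Set V} {u z w : V} (h' : G.Reach A w z) (h : G.Leaves A z u) :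
    G.Leaves A w u := by
  obtain ⟨v, hv, h1, h2⟩ := h
  exact ⟨v, hv, Relation.ReflTransGen.trans h' h1, h2⟩

theorem Reach.single {A : Set V} {u v : V} (hu : u ∈ A) (hv : v ∈ A) (h : G.Adj u v) :
    G.Reach A u v :=
  Relation.ReflTransGen.single ⟨h, hu, hv⟩

/-- `f` enumerates a longest cycle, `m` is its length and `A` the set of the vertices outside; the
digraph has no loops and satisfies the degree condition `M_0`. -/
structure LongestSeq [Fintype V] (G : Digraph V) (m : ℕ) (f : ℕ → V) (A : Set V) : Prop where
  loopless : G.Loopless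
  cyc : G.CyclicSeq m f
  max : ∀ r, G.HasCycle r → r ≤ m
  compl : A = (Set.range f)ᶜ
  ore : ∀ x y, x ≠ y → ¬ G.Adj x y → ¬ G.Adj y x →
    2 * Fintype.card V ≤ G.dg x Finset.univ + G.dg y Finset.univ + 2

namespace LongestSeq

variable [Fintype V] {m : ℕ} {f : ℕ → V} {A : Set V} (h : G.LongestSeq m f A)
include h

theorem rotate (t : ℕ) : G.LongestSeq m (fun i => f (i + t)) A where
  loopless := h.loopless
  cyc := h.cyc.rotate t
  max := h.max
  compl := by rw [h.cyc.range_rotate, h.compl]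
  ore := h.ore

theorem notMem_of_mem {z : V} (hz : z ∈ A) (i : ℕ) : f i ≠ z := by
  rintro rfl
  rw [h.compl] at hz
  exact hz ⟨i, rfl⟩

theorem notMem (i : ℕ) : f i ∉ A := fun hi => h.notMem_of_mem hi i rfl

theorem disjoint_seg {Y : Finset V} (hY : (Y : Set V) ⊆ A) (a n : ℕ) : Disjoint (seg f a n) Y := by
  rw [Finset.disjoint_left]
  intro v hv hvY
  obtain ⟨i, -, -, rfl⟩ := mem_seg.1 hv
  exact h.notMem i (hY hvY)

theorem toFinset_eq : A.toFinset = (seg f 0 m)ᶜ := by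
  ext v
  simp only [Set.mem_toFinset, Finset.mem_compl, h.cyc.mem_seg_full, h.compl, Set.mem_compl_iff,
    Set.mem_range]

theorem card_add : m + A.toFinset.card = Fintype.card V := by
  have := Finset.card_add_card_compl (seg f 0 m)
  rwa [← h.toFinset_eq, h.cyc.card_seg 0 le_rfl] at this

theorem dg_univ (v : V) : G.dg v Finset.univ = G.dg v (seg f 0 m) + G.dg v A.toFinset := by
  rw [h.toFinset_eq, ← dg_union disjoint_compl_right, Finset.union_compl]

theorem card_le {u v : V} {X : Finset V} (hp : G.PathOn u v X) (hvu : G.Adj v u) :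
    X.card ≤ m := by
  by_cases h2 : 2 ≤ X.card
  · exact h.max _ (hp.hasCycle hvu h2)
  · have := h.cyc.two_le; omega

/-- No walk through `A` joins consecutive vertices of a longest cycle. -/
theorem not_enters_leaves {z : V} {i : ℕ} (h1 : G.Enters A (f i) z)
    (h2 : G.Leaves A z (f (i + 1))) : False := by
  obtain ⟨w, hw, hiw, hwz⟩ := h1
  obtain ⟨w', hw', hzw, hwi⟩ := h2
  obtain ⟨Y, hY, hp⟩ := Reach.exists_pathOn (Relation.ReflTransGen.trans hwz hzw) hw'
  have hm := h.cyc.two_le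
  have hseg := h.cyc.pathOn_seg' (a := i + 1) (b := i + m) (l := m) (by omega) (by omega) le_rfl
  have hd := h.disjoint_seg hY (i + 1) m
  have := h.card_le (hseg.append (by rwa [h.cyc.per]) hp hd) hwi
  rw [Finset.card_union_of_disjoint hd, h.cyc.card_seg _ le_rfl] at this
  have := Finset.card_pos.2 ⟨_, hp.start_mem⟩
  omega

theorem not_insert {z : V} (hz : z ∈ A) (i : ℕ) : ¬ (G.Adj (f i) z ∧ G.Adj z (f (i + 1))) :=
  fun hi => h.not_enters_leaves (i := i) (z := z) ⟨z, hz, hi.1, .refl⟩ ⟨z, hz, .refl, hi.2⟩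

end LongestSeq

/-- The pattern of arcs between `w` and the path `f 0, …, f (k - 1)` for a vertex `w` that cannot be
inserted into the path and has the largest possible degree under this restriction. -/
def Tight (G : Digraph V) (k : ℕ) (f : ℕ → V) (w : V) : Prop :=
  G.Adj w (f 0) ∧ G.Adj (f (k - 1)) w ∧ ∀ i, i + 1 < k → (G.Adj (f i) w ↔ ¬ G.Adj w (f (i + 1)))

theorem tight_of_le_dg {f : ℕ → V} {k : ℕ} {w : V} (hk : 1 ≤ k)
    (hinj : ∀ i < k, ∀ j < k, f i = f j → i = j)
    (hins : ∀ i, i + 1 < k → ¬ (G.Adj (f i) w ∧ G.Adj w (f (i + 1))))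
    (hdeg : k + 1 ≤ G.dg w (seg f 0 k)) : G.Tight k f w := by
  obtain ⟨k, rfl⟩ : ∃ l, k = l + 1 := ⟨k - 1, by omega⟩
  rw [dg_seg hinj] at hdeg
  obtain ⟨h1, h2, h3⟩ := pattern_of_le_sum (fun i hi => hins i (by omega)) hdeg
  exact ⟨h1, h2, fun i hi => h3 i (by omega)⟩

theorem Tight.dg_eq {f : ℕ → V} {k : ℕ} {w : V} (hw : G.Tight k f w) (hk : 1 ≤ k)
    (hinj : ∀ i < k, ∀ j < k, f i = f j → i = j) : G.dg w (seg f 0 k) = k + 1 := by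
  obtain ⟨k, rfl⟩ : ∃ l, k = l + 1 := ⟨k - 1, by omega⟩
  rw [dg_seg hinj]
  exact sum_of_pattern hw.1 hw.2.1 fun i hi => hw.2.2 i (by omega)

/-- The structure around a strong component `S` of the subdigraph induced by the set `A` of the
vertices outside the cycle `f`: there is a segment `f k, …, f (m - 1)` of the cycle, not adjacent
to `S`, complete like `S` and with the same relations to the outer vertices and tight, like `S`,
with respect to the rest `f 0, …, f (k - 1)` of the cycle. -/
structure Block (G : Digraph V) (m k : ℕ) (f : ℕ → V) (A S : Set V) : Prop where
  two_le : 2 ≤ k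
  lt : k < m
  subset : S ⊆ A
  nonempty : S.Nonempty
  nonadj : ∀ s ∈ S, ∀ y ∈ seg f k (m - k), ¬ G.Adj s y ∧ ¬ G.Adj y s
  complete_seg : ∀ y ∈ seg f k (m - k), ∀ y' ∈ seg f k (m - k), y ≠ y' → G.Adj y y'
  complete : ∀ s ∈ S, ∀ s' ∈ S, s ≠ s' → G.Adj s s'
  tight : ∀ s ∈ S, G.Tight k f s
  tight_seg : ∀ y ∈ seg f k (m - k), G.Tight k f y
  outer : ∀ w ∈ A, w ∉ S →
    ((∀ s ∈ S, G.Adj w s ∧ ¬ G.Adj s w) ∧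
      ∀ y ∈ seg f k (m - k), G.Adj w y ∧ ¬ G.Adj y w) ∨
    ((∀ s ∈ S, G.Adj s w ∧ ¬ G.Adj w s) ∧
      ∀ y ∈ seg f k (m - k), G.Adj y w ∧ ¬ G.Adj w y)

/-- The degree count for a vertex `s` outside the cycle and a vertex `y` of the bypassed segment:
all the estimates that it uses are equalities. -/
theorem LongestSeq.equality [Fintype V] {m : ℕ} {f : ℕ → V} {A : Set V} (h : G.LongestSeq m f A)
    {k : ℕ} (hkm : k ≤ m) {s y : V} {X : Finset V} (hs : s ∈ A)
    (hQX : seg f 0 k ⊆ X) (hXC : X ⊆ seg f 0 m) (hyC : y ∈ seg f 0 m) (hyX : y ∉ X)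
    (hnon : ∀ y ∈ seg f k (m - k), ¬ G.Adj s y ∧ ¬ G.Adj y s)
    (hdsQ : G.dg s (seg f 0 k) ≤ k + 1) (hdyX : G.dg y X ≤ X.card + 1)
    (hsy : ∀ w ∈ A, ¬ (G.Adj s w ∧ G.Adj w y)) (hys : ∀ w ∈ A, ¬ (G.Adj y w ∧ G.Adj w s)) :
    X = seg f 0 k ∧ G.dg s (seg f 0 k) = k + 1 ∧ G.dg y (seg f 0 k) = k + 1 ∧
      (∀ y' ∈ seg f k (m - k), y' ≠ y → G.Adj y y' ∧ G.Adj y' y) ∧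
      ∀ w ∈ A, w ≠ s → G.mult s w + G.mult y w = 2 := by
  have hsplit : seg f 0 m = seg f 0 k ∪ seg f k (m - k) := by
    ext v
    simp only [Finset.mem_union, mem_seg]
    constructor
    · rintro ⟨i, h1, h2, rfl⟩
      by_cases hik : i < k
      · exact .inl ⟨i, by omega, by omega, rfl⟩
      · exact .inr ⟨i, by omega, by omega, rfl⟩
    · rintro (⟨i, h1, h2, rfl⟩ | ⟨i, h1, h2, rfl⟩) <;> exact ⟨i, by omega, by omega, rfl⟩
  have hdisj : Disjoint (seg f 0 k) (seg f k (m - k)) :=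
    h.cyc.disjoint_seg (by omega) (by omega)
  have hcQ := h.cyc.card_seg 0 hkm
  have hcC := h.cyc.card_seg 0 le_rfl
  have hsC : G.dg s (seg f 0 m) = G.dg s (seg f 0 k) := by
    rw [hsplit, dg_union hdisj, dg_eq_zero hnon, add_zero]
  have hne : s ≠ y := by
    rintro rfl
    obtain ⟨i, -, -, h'⟩ := mem_seg.1 hyC
    exact h.notMem_of_mem hs i h'
  have hyB : y ∈ seg f k (m - k) := by
    rw [hsplit, Finset.mem_union] at hyC
    exact hyC.resolve_left fun h' => hyX (hQX h')
  have hyY : y ∈ seg f 0 m \ X := Finset.mem_sdiff.2 ⟨hyC, hyX⟩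
  have hyCsplit : G.dg y (seg f 0 m) = G.dg y X + G.dg y ((seg f 0 m \ X).erase y) := by
    rw [dg_erase_self h.loopless, ← dg_union Finset.disjoint_sdiff, Finset.union_sdiff_of_subset hXC]
  have hcY : ((seg f 0 m \ X).erase y).card + 1 + X.card = m := by
    rw [Finset.card_erase_add_one hyY, Finset.card_sdiff_add_card_eq_card hXC, hcC]
  have hdY := dg_le (G := G) y ((seg f 0 m \ X).erase y)
  have hA : G.dg s A.toFinset + G.dg y A.toFinset =
      ∑ w ∈ A.toFinset.erase s, (G.mult s w + G.mult y w) := by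
    rw [Finset.sum_add_distrib, ← dg, ← dg, dg_erase_self h.loopless]
    congr 1
    refine (Finset.sum_erase _ ?_).symm
    rw [mult_comm, mult_eq_zero_iff]
    exact hnon y hyB
  have hterm : ∀ w ∈ A.toFinset.erase s, G.mult s w + G.mult y w ≤ 2 := fun w hw =>
    have hwA : w ∈ A := Set.mem_toFinset.1 (Finset.mem_of_mem_erase hw)
    mult_add_mult_le (hsy w hwA) (hys w hwA)
  have hcA : (A.toFinset.erase s).card + 1 = A.toFinset.card :=
    Finset.card_erase_add_one (Set.mem_toFinset.2 hs)
  have hsum := Finset.sum_le_sum hterm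
  simp only [Finset.sum_const, smul_eq_mul] at hsum
  have hore := h.ore s y hne (hnon y hyB).1 (hnon y hyB).2
  rw [h.dg_univ s, h.dg_univ y, hsC, hyCsplit] at hore
  have hcard := h.card_add
  have hXk : k ≤ X.card := hcQ ▸ Finset.card_le_card hQX
  have hX : X = seg f 0 k := (Finset.eq_of_subset_of_card_le hQX (by omega)).symm
  have hsum2 : ∑ w ∈ A.toFinset.erase s, (G.mult s w + G.mult y w) =
      ∑ w ∈ A.toFinset.erase s, 2 := by
    simp only [Finset.sum_const, smul_eq_mul]
    omega
  subst hX
  refine ⟨rfl, by omega, by omega, ?_, ?_⟩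
  · intro y' hy' hne'
    refine eq_two_of_dg_ge (X := (seg f 0 m \ seg f 0 k).erase y) (by omega) ?_
    rw [Finset.mem_erase, Finset.mem_sdiff, hsplit, Finset.mem_union]
    exact ⟨hne', .inr hy', Finset.disjoint_right.1 hdisj hy'⟩
  · intro w hw hws
    exact (Finset.sum_eq_sum_iff_of_le hterm).1 hsum2 w (by simp [hw, hws])

/-! ### The block of a strong component outside the cycle -/

section

variable {m : ℕ} {f : ℕ → V} {A : Set V}

theorem seg_split {k : ℕ} (hkm : k ≤ m) : seg f 0 m = seg f 0 k ∪ seg f k (m - k) := by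
  ext v
  simp only [Finset.mem_union, mem_seg]
  constructor
  · rintro ⟨i, h1, h2, rfl⟩
    by_cases hik : i < k
    · exact .inl ⟨i, by omega, by omega, rfl⟩
    · exact .inr ⟨i, by omega, by omega, rfl⟩
  · rintro (⟨i, h1, h2, rfl⟩ | ⟨i, h1, h2, rfl⟩) <;> exact ⟨i, by omega, by omega, rfl⟩

theorem same_direction {u v w : V} (h1 : ¬ (G.Adj u w ∧ G.Adj w v))
    (h2 : ¬ (G.Adj v w ∧ G.Adj w u)) (h3 : ¬ (G.Adj u w ∧ G.Adj w u)) (h0 : G.mult u w ≠ 0)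
    (hm : G.mult u w + G.mult v w = 2) :
    ((G.Adj w u ∧ ¬ G.Adj u w) ∧ (G.Adj w v ∧ ¬ G.Adj v w)) ∨
      ((G.Adj u w ∧ ¬ G.Adj w u) ∧ (G.Adj v w ∧ ¬ G.Adj w v)) := by
  unfold mult at hm h0
  by_cases a1 : G.Adj u w <;> by_cases a2 : G.Adj w u <;> by_cases a3 : G.Adj v w <;>
    by_cases a4 : G.Adj w v <;> simp [a1, a2, a3, a4] at *

variable [Fintype V]

namespace LongestSeq

theorem card_le_of_pathOn (h : G.LongestSeq m f A) {k : ℕ} (h1 : 1 ≤ k) (hkm : k ≤ m)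
    {X : Finset V} (hp : G.PathOn (f 0) (f (k - 1)) X) (hd : Disjoint X (seg f k (m - k))) :
    X.card ≤ k := by
  rcases hkm.eq_or_lt with rfl | hlt
  · refine h.card_le hp ?_
    have := h.cyc.adj (k - 1)
    rwa [Nat.sub_add_cancel h1, ← zero_add k, h.cyc.per, zero_add] at this
  · have ha := h.cyc.adj (k - 1)
    rw [Nat.sub_add_cancel h1] at ha
    have hp2 := hp.append ha
      (h.cyc.pathOn_seg' (a := k) (b := m - 1) (l := m - k) (by omega) (by omega) (by omega)) hd
    have hc := h.cyc.adj (m - 1)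
    rw [Nat.sub_add_cancel (by omega), ← zero_add m, h.cyc.per, zero_add] at hc
    have := h.card_le hp2 hc
    rw [Finset.card_union_of_disjoint hd, h.cyc.card_seg _ (by omega)] at this
    omega

theorem disjoint_init_seg (h : G.LongestSeq m f A) {k : ℕ} (hkm : k ≤ m) :
    Disjoint (seg f 0 k) (seg f k (m - k)) := h.cyc.disjoint_seg (by omega) (by omega)

/-- The equalities of `LongestSeq.equality` hold for every vertex of the component of `z` and every
vertex of the segment that is bypassed by a shortest bypass through this component. -/
theorem equality_of_minimal (h : G.LongestSeq m f A) {z : V} (hz : z ∈ A) {k : ℕ} (hk : 2 ≤ k)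
    (hkm : k ≤ m) (hE : G.Enters A (f (k - 1)) z) (hL : G.Leaves A z (f 0))
    (hminE : ∀ y ∈ seg f k (m - k), ¬ G.Enters A y z)
    (hminL : ∀ y ∈ seg f k (m - k), ¬ G.Leaves A z y) :
    k < m ∧ ∀ s ∈ G.comp A z, ∀ y ∈ seg f k (m - k),
      (¬ G.Adj s y ∧ ¬ G.Adj y s) ∧
      (∀ w ∈ A, ¬ (G.Adj s w ∧ G.Adj w y)) ∧ (∀ w ∈ A, ¬ (G.Adj y w ∧ G.Adj w s)) ∧
      G.dg s (seg f 0 k) = k + 1 ∧ G.Tight k f y ∧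
      (∀ y' ∈ seg f k (m - k), y' ≠ y → G.Adj y y' ∧ G.Adj y' y) ∧
      ∀ w ∈ A, w ≠ s → G.mult s w + G.mult y w = 2 := by
  obtain ⟨u, hu, hku, huz⟩ := hE
  obtain ⟨u', hu', hzu, hu0⟩ := hL
  obtain ⟨Y, hYA, hY⟩ := Reach.exists_pathOn (Relation.ReflTransGen.trans huz hzu) hu'
  have hYpos := Finset.card_pos.2 ⟨_, hY.start_mem⟩
  have hcC := h.cyc.card_seg 0 le_rfl
  have hcQ := h.cyc.card_seg 0 hkm
  -- a path from `f 0` to `f (k - 1)` cannot contain the whole cycle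
  have hproper : ∀ X : Finset V, G.PathOn (f 0) (f (k - 1)) X → X ≠ seg f 0 m := by
    rintro _ hp rfl
    have hd := h.disjoint_seg hYA 0 m
    have := h.card_le (hp.append hku hY hd) hu0
    rw [Finset.card_union_of_disjoint hd] at this
    omega
  have hQ : G.PathOn (f 0) (f (k - 1)) (seg f 0 k) :=
    h.cyc.pathOn_seg' (by omega) (by omega) hkm
  obtain ⟨X, hXmem, hXmax⟩ := ((seg f 0 m).powerset.filter fun X =>
      seg f 0 k ⊆ X ∧ G.PathOn (f 0) (f (k - 1)) X).exists_max_image Finset.card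
    ⟨seg f 0 k, by
      simp only [Finset.mem_filter, Finset.mem_powerset, subset_rfl, hQ, and_true]
      rw [seg_split hkm]
      exact Finset.subset_union_left⟩
  simp only [Finset.mem_filter, Finset.mem_powerset] at hXmem hXmax
  obtain ⟨hXC, hQX, hX⟩ := hXmem
  have hcX : ∀ y ∈ seg f 0 m, y ∉ X → ¬ G.PathOn (f 0) (f (k - 1)) (insert y X) := by
    intro y hy hyX hp
    have := hXmax _ ⟨Finset.insert_subset hy hXC, hQX.trans (Finset.subset_insert _ _), hp⟩
    rw [Finset.card_insert_of_notMem hyX] at this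
    omega
  have hsub : seg f k (m - k) ⊆ seg f 0 m := by
    rw [seg_split hkm]; exact Finset.subset_union_right
  have hS : ∀ s ∈ G.comp A z, ∀ y ∈ seg f k (m - k),
      (¬ G.Adj s y ∧ ¬ G.Adj y s) ∧
      (∀ w ∈ A, ¬ (G.Adj s w ∧ G.Adj w y)) ∧ (∀ w ∈ A, ¬ (G.Adj y w ∧ G.Adj w s)) := by
    intro s hs y hy
    have hsA := comp_subset hz hs
    exact ⟨⟨fun h' => hminL y hy ⟨s, hsA, hs.1, h'⟩, fun h' => hminE y hy ⟨s, hsA, h', hs.2⟩⟩,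
      fun w hw h' => hminL y hy ⟨w, hw, hs.1.tail ⟨h'.1, hsA, hw⟩, h'.2⟩,
      fun w hw h' => hminE y hy ⟨w, hw, h'.1, Relation.ReflTransGen.head ⟨h'.2, hw, hsA⟩ hs.2⟩⟩
  have key : ∀ s ∈ G.comp A z, ∀ y ∈ seg f 0 m, y ∉ X → X = seg f 0 k ∧
      G.dg s (seg f 0 k) = k + 1 ∧ G.dg y (seg f 0 k) = k + 1 ∧
      (∀ y' ∈ seg f k (m - k), y' ≠ y → G.Adj y y' ∧ G.Adj y' y) ∧
      ∀ w ∈ A, w ≠ s → G.mult s w + G.mult y w = 2 := by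
    intro s hs y hyC hyX
    have hsA := comp_subset hz hs
    have hyB : y ∈ seg f k (m - k) := by
      rw [seg_split hkm, Finset.mem_union] at hyC
      exact hyC.resolve_left fun h' => hyX (hQX h')
    have hsQ : ∀ a n, s ∉ seg f a n := by
      intro a n h'
      obtain ⟨i, -, -, hi⟩ := mem_seg.1 h'
      exact h.notMem_of_mem hsA i hi
    refine h.equality hkm hsA hQX hXC hyC hyX (fun y hy => (hS s hs y hy).1) ?_ ?_
      (hS s hs y hyB).2.1 (hS s hs y hyB).2.2
    · rcases hQ.insert_or (hsQ 0 k) with hins | hle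
      · have := h.card_le_of_pathOn (by omega) hkm hins
          (Finset.disjoint_insert_left.2 ⟨hsQ _ _, h.disjoint_init_seg hkm⟩)
        rw [Finset.card_insert_of_notMem (hsQ _ _)] at this
        omega
      · split_ifs at hle <;> omega
    · rcases hX.insert_or hyX with hins | hle
      · exact absurd hins (hcX y hyC hyX)
      · split_ifs at hle <;> omega
  obtain ⟨y₀, hy₀, hy₀X⟩ : ∃ y ∈ seg f 0 m, y ∉ X := by
    by_contra hcon
    push Not at hcon
    exact hproper X hX (subset_antisymm hXC hcon)
  obtain rfl : X = seg f 0 k := (key z (mem_comp_self A z) y₀ hy₀ hy₀X).1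
  refine ⟨lt_of_le_of_ne hkm ?_, ?_⟩
  · rintro rfl
    exact hy₀X hy₀
  intro s hs y hy
  have hyX : y ∉ seg f 0 k := Finset.disjoint_right.1 (h.disjoint_init_seg hkm) hy
  obtain ⟨-, e1, e2, e3, e4⟩ := key s hs y (hsub hy) hyX
  obtain ⟨e5, e6, e7⟩ := hS s hs y hy
  refine ⟨e5, e6, e7, e1, ?_, e3, e4⟩
  refine tight_of_le_dg (by omega) (fun i hi j hj => h.cyc.inj i (by omega) j (by omega)) ?_ e2.ge
  rintro i hi ⟨ha, hb⟩
  -- inserting `y` between `f i` and `f (i + 1)` contradicts the maximality of the path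
  refine hcX y (hsub hy) hyX ?_
  have p1 := h.cyc.pathOn_seg' (a := 0) (b := i) (l := i + 1) (by omega) (by omega) (by omega)
  have p2 := h.cyc.pathOn_seg' (a := i + 1) (b := k - 1) (l := k - (i + 1)) (by omega) (by omega)
    (by omega)
  have hsp := seg_split (f := f) (k := i + 1) (m := k) (by omega)
  rw [hsp, Finset.mem_union, not_or] at hyX
  have p3 := p1.append ha (PathOn.cons hb p2 hyX.2)
    (Finset.disjoint_insert_right.2 ⟨hyX.1, h.cyc.disjoint_seg (by omega) (by omega)⟩)
  rwa [Finset.union_insert, ← hsp] at p3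

/-- A shortest bypass through the component of `z` yields a block. -/
theorem block_of_minimal (h : G.LongestSeq m f A) {z : V} (hz : z ∈ A) {k : ℕ} (hk : 2 ≤ k)
    (hkm : k ≤ m) (hE : G.Enters A (f (k - 1)) z) (hL : G.Leaves A z (f 0))
    (hminE : ∀ y ∈ seg f k (m - k), ¬ G.Enters A y z)
    (hminL : ∀ y ∈ seg f k (m - k), ¬ G.Leaves A z y) :
    G.Block m k f A (G.comp A z) := by
  obtain ⟨hlt, key⟩ := h.equality_of_minimal hz hk hkm hE hL hminE hminL
  have hB : f k ∈ seg f k (m - k) := mem_seg_of le_rfl (by omega)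
  have hinj : ∀ i < k, ∀ j < k, f i = f j → i = j :=
    fun i hi j hj => h.cyc.inj i (by omega) j (by omega)
  have htight : ∀ s ∈ G.comp A z, G.Tight k f s := fun s hs =>
    tight_of_le_dg (by omega) hinj
      (fun i _ => h.not_insert (comp_subset hz hs) i) (key s hs _ hB).2.2.2.1.ge
  -- no outer vertex can be joined to the segment by arcs in both directions
  have hbad : ∀ w ∈ A, ∀ s ∈ G.comp A z, w ≠ s → G.mult s w ≠ 0 := by
    intro w hw s hs hws hsw
    have hsA := comp_subset hz hs
    have hall : ∀ y ∈ seg f k (m - k), G.Adj y w ∧ G.Adj w y := by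
      intro y hy
      have := (key s hs y hy).2.2.2.2.2.2 w hw hws
      exact mult_eq_two_iff.1 (by omega)
    by_cases hk1 : k + 1 < m
    · exact h.not_insert hw k ⟨(hall _ hB).1, (hall _ (mem_seg_of (by omega) (by omega))).2⟩
    · have hsw' := mult_eq_zero_iff.1 hsw
      have hore := h.ore s w hws.symm hsw'.1 hsw'.2
      rw [h.dg_univ, h.dg_univ] at hore
      have hs1 := h.cyc.dg_le fun i => h.not_insert hsA i
      have hw1 := h.cyc.dg_le fun i => h.not_insert hw i
      have hsum : G.dg s A.toFinset + G.dg w A.toFinset =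
          ∑ v ∈ (A.toFinset.erase s).erase w, (G.mult s v + G.mult w v) := by
        rw [Finset.sum_add_distrib, Finset.sum_erase _ hsw,
          Finset.sum_erase _ (mult_self h.loopless s),
          Finset.sum_erase _ (mult_self h.loopless w), Finset.sum_erase _ (by rwa [mult_comm]),
          dg, dg]
      have hle : ∀ v ∈ (A.toFinset.erase s).erase w, G.mult s v + G.mult w v ≤ 2 := by
        intro v hv
        have hvA : v ∈ A := by simp at hv; exact hv.2.2
        refine mult_add_mult_le ?_ ?_
        · rintro ⟨h1, h2⟩
          exact hminL _ hB ⟨w, hw, (hs.1.tail ⟨h1, hsA, hvA⟩).tail ⟨h2, hvA, hw⟩, (hall _ hB).2⟩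
        · rintro ⟨h1, h2⟩
          exact hminE _ hB ⟨w, hw, (hall _ hB).1, Relation.ReflTransGen.head ⟨h1, hw, hvA⟩
            (Relation.ReflTransGen.head ⟨h2, hvA, hsA⟩ hs.2)⟩
      have hsum2 := Finset.sum_le_sum hle
      simp only [Finset.sum_const, smul_eq_mul] at hsum2
      have hc1 : (A.toFinset.erase s).card + 1 = A.toFinset.card :=
        Finset.card_erase_add_one (Set.mem_toFinset.2 hsA)
      have hc2 : ((A.toFinset.erase s).erase w).card + 1 = (A.toFinset.erase s).card :=
        Finset.card_erase_add_one (by simp [hw, hws])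
      have hcard := h.card_add
      omega
  have htype : ∀ w ∈ A, w ∉ G.comp A z → ∀ s ∈ G.comp A z, ∀ y ∈ seg f k (m - k),
      ((G.Adj w s ∧ ¬ G.Adj s w) ∧ (G.Adj w y ∧ ¬ G.Adj y w)) ∨
      ((G.Adj s w ∧ ¬ G.Adj w s) ∧ (G.Adj y w ∧ ¬ G.Adj w y)) := by
    intro w hw hwS s hs y hy
    have hsA := comp_subset hz hs
    have hws : w ≠ s := fun h' => hwS (h' ▸ hs)
    obtain ⟨-, e1, e2, -, -, -, e3⟩ := key s hs y hy
    have hm := e3 w hw hws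
    have h0 := hbad w hw s hs hws
    have h1 : ¬ (G.Adj s w ∧ G.Adj w s) := fun h' =>
      hwS ⟨hs.1.tail ⟨h'.1, hsA, hw⟩, Relation.ReflTransGen.head ⟨h'.2, hw, hsA⟩ hs.2⟩
    exact same_direction (e1 w hw) (e2 w hw) h1 h0 hm
  refine ⟨hk, hlt, comp_subset hz, ⟨z, mem_comp_self A z⟩, fun s hs y hy => (key s hs y hy).1,
    fun y hy y' hy' hne => ((key z (mem_comp_self A z) y hy).2.2.2.2.2.1 y' hy' hne.symm).1, ?_,
    htight, fun y hy => (key z (mem_comp_self A z) y hy).2.2.2.2.1, ?_⟩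
  · intro s hs s' hs' hne
    have hs'A := comp_subset hz hs'
    have e1 := (key s hs _ hB).2.2.2.2.2.2 s' hs'A hne.symm
    have e2 : G.mult (f k) s' = 0 := by
      rw [mult_comm]
      exact mult_eq_zero_iff.2 (key s' hs' _ hB).1
    exact (mult_eq_two_iff.1 (by omega)).1
  · intro w hw hwS
    rcases htype w hw hwS z (mem_comp_self A z) _ hB with ⟨t1, t2⟩ | ⟨t1, t2⟩
    · left
      refine ⟨fun s hs => ?_, fun y hy => ?_⟩
      · rcases htype w hw hwS s hs _ hB with t | t
        · exact t.1
        · exact absurd t.2.1 t2.2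
      · rcases htype w hw hwS z (mem_comp_self A z) y hy with t | t
        · exact t.2
        · exact absurd t.1.1 t1.2
    · right
      refine ⟨fun s hs => ?_, fun y hy => ?_⟩
      · rcases htype w hw hwS s hs _ hB with t | t
        · exact absurd t.2.1 t2.2
        · exact t.1
      · rcases htype w hw hwS z (mem_comp_self A z) y hy with t | t
        · exact absurd t.1.1 t1.2
        · exact t.2

/-- A bypass through the component of `z` yields, after a rotation of the cycle, a block. -/
theorem exists_block (h : G.LongestSeq m f A) {z : V} (hz : z ∈ A) {i j : ℕ} (hij : f i ≠ f j)
    (hE : G.Enters A (f i) z) (hL : G.Leaves A z (f j)) :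
    ∃ t k, G.Block m k (fun i => f (i + t)) A (G.comp A z) := by
  have hex : ∃ g, 1 ≤ g ∧ g < m ∧ ∃ i, G.Enters A (f i) z ∧ G.Leaves A z (f (i + g)) := by
    obtain ⟨j', h1, h2, h3⟩ := h.cyc.exists_window i j
    refine ⟨j' - i, ?_, by omega, i, hE, ?_⟩
    · by_contra hcon
      exact hij (by rw [← h3]; congr 1; omega)
    · rwa [show i + (j' - i) = j' by omega, h3]
  have hspec := Nat.find_spec hex
  have hmin := fun g => Nat.find_min hex (m := g)
  set g := Nat.find hex
  obtain ⟨hg1, hgm, i, hi, hig⟩ := hspec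
  refine ⟨i + g, m - g + 1, (h.rotate (i + g)).block_of_minimal hz (by omega) (by omega) ?_ ?_ ?_ ?_⟩
  · rw [show m - g + 1 - 1 + (i + g) = i + m by omega, h.cyc.per]
    exact hi
  · simpa using hig
  · rintro y hy hEy
    obtain ⟨j, h1, h2, rfl⟩ := mem_seg.1 hy
    refine hmin (m - j) (by omega) ⟨by omega, by omega, j + (i + g), hEy, ?_⟩
    rwa [show j + (i + g) + (m - j) = i + g + m by omega, h.cyc.per]
  · rintro y hy hLy
    obtain ⟨j, h1, h2, rfl⟩ := mem_seg.1 hy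
    refine hmin (g + j - m) (by omega) ⟨by omega, by omega, i, hi, ?_⟩
    rw [← h.cyc.per]
    rwa [show i + (g + j - m) + m = j + (i + g) by omega]

end LongestSeq

end

/-! ### Digraphs without bypasses -/

section

theorem exists_enters_of_reflTransGen {A : Set V} {u z : V} (hz : z ∈ A)
    (h : Relation.ReflTransGen G.Adj u z) : G.Reach A u z ∨ ∃ v ∉ A, G.Enters A v z := by
  induction h using Relation.ReflTransGen.head_induction_on with
  | refl => exact .inl .refl
  | @head a c hac _ ih =>
    refine ih.elim (fun hc => ?_) .inr
    have hcA := hc.mem_iff.2 hz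
    by_cases ha : a ∈ A
    · exact .inl (.head ⟨hac, ha, hcA⟩ hc)
    · exact .inr ⟨a, ha, c, hcA, hac, hc⟩

theorem exists_leaves_of_reflTransGen {A : Set V} {u z : V} (hz : z ∈ A)
    (h : Relation.ReflTransGen G.Adj z u) : G.Reach A z u ∨ ∃ v ∉ A, G.Leaves A z v := by
  induction h with
  | refl => exact .inl .refl
  | @tail a c _ hac ih =>
    refine ih.elim (fun ha => ?_) .inr
    have haA := ha.mem_iff.1 hz
    by_cases hc : c ∈ A
    · exact .inl (.tail ha ⟨hac, haA, hc⟩)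
    · exact .inr ⟨c, hc, a, haA, ha, hac⟩

/-- Two finite digraphs in which the arcs are determined in the same way by a colouring of the
vertices are isomorphic as soon as their colour classes have the same sizes. -/
theorem isomorphic_of_coloring {W C : Type*} [Fintype V] [Fintype W] [DecidableEq C] {H : Digraph W}
    (κ : V → C) (κ' : W → C) (hcard : ∀ c, Fintype.card {v // κ v = c} = Fintype.card {w // κ' w = c})
    (R : C → C → Prop) (hG : ∀ u v, G.Adj u v ↔ u ≠ v ∧ R (κ u) (κ v))
    (hH : ∀ u v, H.Adj u v ↔ u ≠ v ∧ R (κ' u) (κ' v)) : G.Isomorphic H := by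
  let φ : ∀ c, {v // κ v = c} ≃ {w // κ' w = c} := fun c => Fintype.equivOfCardEq (hcard c)
  let e : V ≃ W := ((Equiv.sigmaFiberEquiv κ).symm.trans (Equiv.sigmaCongrRight φ)).trans
    (Equiv.sigmaFiberEquiv κ')
  have he : ∀ v, κ' (e v) = κ v := fun v => (φ (κ v) ⟨v, rfl⟩).2
  refine ⟨⟨e, ?_⟩⟩
  intro u v
  rw [hH, hG, he, he, Ne, e.injective.eq_iff]

variable [Fintype V] {m : ℕ} {f : ℕ → V} {A : Set V}

namespace LongestSeq

theorem exists_of_notMem (h : G.LongestSeq m f A) {v : V} (hv : v ∉ A) : ∃ i, f i = v := by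
  rw [h.compl] at hv
  simpa using hv

theorem exists_enters (h : G.LongestSeq m f A) (hst : G.IsStrong) {z : V} (hz : z ∈ A) :
    ∃ i, G.Enters A (f i) z := by
  rcases exists_enters_of_reflTransGen hz (hst (f 0) z) with hr | ⟨v, hv, hE⟩
  · exact absurd (hr.mem_iff.2 hz) (h.notMem 0)
  · obtain ⟨i, rfl⟩ := h.exists_of_notMem hv
    exact ⟨i, hE⟩

theorem exists_leaves (h : G.LongestSeq m f A) (hst : G.IsStrong) {z : V} (hz : z ∈ A) :
    ∃ i, G.Leaves A z (f i) := by
  rcases exists_leaves_of_reflTransGen hz (hst z (f 0)) with hr | ⟨v, hv, hE⟩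
  · exact absurd (hr.mem_iff.1 hz) (h.notMem 0)
  · obtain ⟨i, rfl⟩ := h.exists_of_notMem hv
    exact ⟨i, hE⟩

end LongestSeq

/-- Every strong component of the subdigraph induced by `A` belongs to a block. -/
def AllBlocks (G : Digraph V) (m : ℕ) (f : ℕ → V) (A : Set V) : Prop :=
  ∀ z ∈ A, ∃ t k, G.Block m k (fun i => f (i + t)) A (G.comp A z)

/-- The digraph consists of two complete digraphs, on the cycle `f` and on `A ∪ {f c}`, that share
only the vertex `f c`. -/
structure TwoComplete (G : Digraph V) (f : ℕ → V) (A : Set V) (c : ℕ) : Prop where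
  center : ∀ z ∈ A, G.Adj (f c) z ∧ G.Adj z (f c)
  outer : ∀ z ∈ A, ∀ w ∈ A, z ≠ w → G.Adj z w
  cycle : ∀ i j, f i ≠ f j → G.Adj (f i) (f j)
  nonadj : ∀ z ∈ A, ∀ i, f i ≠ f c → ¬ G.Adj (f i) z ∧ ¬ G.Adj z (f i)

/-- If some component has a bypass then all of them have. -/
theorem LongestSeq.allBlocks (h : G.LongestSeq m f A) (hst : G.IsStrong) {z : V} (hz : z ∈ A)
    {i j : ℕ} (hij : f i ≠ f j) (hE : G.Enters A (f i) z) (hL : G.Leaves A z (f j)) :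
    G.AllBlocks m f A := by
  intro w hw
  by_cases hwS : w ∈ G.comp A z
  · rw [comp_eq_of_mem hwS]
    exact h.exists_block hz hij hE hL
  obtain ⟨t, k, hb⟩ := h.exists_block hz hij hE hL
  have hlt := hb.lt
  have hk := hb.two_le
  have hB : f (k + t) ∈ seg (fun i => f (i + t)) k (m - k) :=
    mem_seg_of (f := fun i => f (i + t)) le_rfl (by omega)
  have hzt := hb.tight z (mem_comp_self A z)
  rcases hb.outer w hw hwS with ⟨h1, h2⟩ | ⟨h1, h2⟩
  · obtain ⟨a, ha⟩ := h.exists_enters hst hw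
    have l1 : G.Leaves A w (f (0 + t)) :=
      ⟨z, hz, .single hw hz (h1 z (mem_comp_self A z)).1, hzt.1⟩
    have l2 : G.Leaves A w (f (k + t)) := ⟨w, hw, .refl, (h2 _ hB).1⟩
    by_cases hne : f a = f (0 + t)
    · refine h.exists_block hw (fun h' => ?_) ha l2
      have := h.cyc.eq_of_lt (hne.symm.trans h') (by omega) (by omega)
      omega
    · exact h.exists_block hw hne ha l1
  · obtain ⟨a, ha⟩ := h.exists_leaves hst hw
    have l1 : G.Enters A (f (k - 1 + t)) w :=
      ⟨z, hz, hzt.2.1, .single hz hw (h1 z (mem_comp_self A z)).1⟩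
    have l2 : G.Enters A (f (k + t)) w := ⟨w, hw, (h2 _ hB).1, .refl⟩
    by_cases hne : f (k - 1 + t) = f a
    · refine h.exists_block hw (fun h' => ?_) l2 ha
      have := h.cyc.eq_of_lt (hne.trans h'.symm) (by omega) (by omega)
      omega
    · exact h.exists_block hw hne l1 ha

/-- If no component has a bypass then the digraph is a union of two complete digraphs that share one
vertex. -/
theorem LongestSeq.twoComplete (h : G.LongestSeq m f A) (hst : G.IsStrong) {z₀ : V} (hz₀ : z₀ ∈ A)
    (hno : ∀ z ∈ A, ∀ i j, G.Enters A (f i) z → G.Leaves A z (f j) → f i = f j) :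
    ∃ c, G.TwoComplete f A c := by
  have hm := h.cyc.two_le
  have hcC := h.cyc.card_seg 0 le_rfl
  have hcard := h.card_add
  have hatt : ∀ z ∈ A, ∃ c, ∀ i, (G.Enters A (f i) z → f i = f c) ∧
      (G.Leaves A z (f i) → f i = f c) := by
    intro z hz
    obtain ⟨a, ha⟩ := h.exists_enters hst hz
    obtain ⟨b, hb⟩ := h.exists_leaves hst hz
    have hab := hno z hz a b ha hb
    exact ⟨b, fun i => ⟨fun hi => hno z hz i b hi hb, fun hi => (hno z hz a i ha hi).symm.trans hab⟩⟩
  choose! c hc using hatt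
  have hmem : ∀ i, f i ∈ seg f 0 m := fun i => h.cyc.mem_seg_full.2 ⟨i, rfl⟩
  have hnon : ∀ z ∈ A, ∀ i, f i ≠ f (c z) → ¬ G.Adj (f i) z ∧ ¬ G.Adj z (f i) :=
    fun z hz i hi => ⟨fun h' => hi ((hc z hz i).1 ⟨z, hz, h', .refl⟩),
      fun h' => hi ((hc z hz i).2 ⟨z, hz, .refl, h'⟩)⟩
  have hzC : ∀ z ∈ A, G.dg z (seg f 0 m) = G.mult z (f (c z)) := by
    intro z hz
    refine Finset.sum_eq_single _ (fun v hv hne => ?_) (fun h' => absurd (hmem _) h')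
    obtain ⟨i, -, -, rfl⟩ := mem_seg.1 hv
    exact mult_eq_zero_iff.2 (hnon z hz i hne).symm
  -- all the vertices of `A` are attached to the cycle at the same vertex
  have hsame : ∀ z ∈ A, ∀ w ∈ A, f (c z) = f (c w) := by
    intro z hz w hw
    by_contra hne
    have hwz : ∀ {z w : V}, z ∈ A → w ∈ A → f (c z) ≠ f (c w) → ¬ G.Reach A z w := by
      intro z w hz hw hne hr
      obtain ⟨b, hb⟩ := h.exists_leaves hst hw
      exact hne (((hc z hz b).2 (hb.trans hr)).symm.trans ((hc w hw b).2 hb))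
    have hzw := hwz hz hw hne
    have hwz := hwz hw hz (Ne.symm hne)
    have hzw' : z ≠ w := fun h' => hne (by rw [h'])
    have h1 : ¬ G.Adj z w := fun h' => hzw (.single hz hw h')
    have h2 : ¬ G.Adj w z := fun h' => hwz (.single hw hz h')
    have hore := h.ore z w hzw' h1 h2
    rw [h.dg_univ, h.dg_univ, hzC z hz, hzC w hw] at hore
    have hsum : G.dg z A.toFinset + G.dg w A.toFinset =
        ∑ v ∈ (A.toFinset.erase z).erase w, (G.mult z v + G.mult w v) := by
      rw [Finset.sum_add_distrib, Finset.sum_erase _ (mult_eq_zero_iff.2 ⟨h1, h2⟩),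
        Finset.sum_erase _ (mult_self h.loopless z),
        Finset.sum_erase _ (mult_self h.loopless w),
        Finset.sum_erase _ (mult_eq_zero_iff.2 ⟨h2, h1⟩), dg, dg]
    have hle : ∀ v ∈ (A.toFinset.erase z).erase w, G.mult z v + G.mult w v ≤ 2 := by
      intro v hv
      have hvA : v ∈ A := by simp at hv; exact hv.2.2
      refine mult_add_mult_le ?_ ?_
      · rintro ⟨h1, h2⟩
        exact hzw ((Reach.single hz hvA h1).tail ⟨h2, hvA, hw⟩)
      · rintro ⟨h1, h2⟩
        exact hwz ((Reach.single hw hvA h1).tail ⟨h2, hvA, hz⟩)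
    have hsum2 := Finset.sum_le_sum hle
    simp only [Finset.sum_const, smul_eq_mul] at hsum2
    have hc1 : (A.toFinset.erase z).card + 1 = A.toFinset.card :=
      Finset.card_erase_add_one (Set.mem_toFinset.2 hz)
    have hc2 : ((A.toFinset.erase z).erase w).card + 1 = (A.toFinset.erase z).card :=
      Finset.card_erase_add_one (by simp [hw, hzw'.symm])
    have := mult_le_two (G := G) z (f (c z))
    have := mult_le_two (G := G) w (f (c w))
    omega
  have key : ∀ z ∈ A, ∀ j, f j ≠ f (c z) → G.mult z (f (c z)) = 2 ∧
      (∀ i, f i ≠ f j → G.Adj (f j) (f i) ∧ G.Adj (f i) (f j)) ∧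
      ∀ w ∈ A, w ≠ z → G.mult z w + G.mult (f j) w = 2 := by
    intro z hz j hj
    have hn := hnon z hz j hj
    have hore := h.ore z (f j) (h.notMem_of_mem hz j).symm hn.2 hn.1
    rw [h.dg_univ, h.dg_univ, hzC z hz, ← dg_erase_self h.loopless (f j) (seg f 0 m)] at hore
    have hterm : ∀ w ∈ A.toFinset.erase z, G.mult z w + G.mult (f j) w ≤ 2 := by
      intro w hw
      have hwA : w ∈ A := Set.mem_toFinset.1 (Finset.mem_of_mem_erase hw)
      refine mult_add_mult_le ?_ ?_
      · rintro ⟨h1, h2⟩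
        exact hj ((hc z hz j).2 ⟨w, hwA, .single hz hwA h1, h2⟩)
      · rintro ⟨h1, h2⟩
        exact hj ((hc z hz j).1 ⟨w, hwA, h1, .single hwA hz h2⟩)
    have hA : G.dg z A.toFinset + G.dg (f j) A.toFinset =
        ∑ w ∈ A.toFinset.erase z, (G.mult z w + G.mult (f j) w) := by
      rw [Finset.sum_add_distrib, ← dg, ← dg, dg_erase_self h.loopless]
      congr 1
      exact (Finset.sum_erase _ (mult_eq_zero_iff.2 hn)).symm
    have hsum := Finset.sum_le_sum hterm
    simp only [Finset.sum_const, smul_eq_mul] at hsum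
    have hcA : (A.toFinset.erase z).card + 1 = A.toFinset.card :=
      Finset.card_erase_add_one (Set.mem_toFinset.2 hz)
    have hcj := Finset.card_erase_add_one (hmem j)
    have hdj := dg_le (G := G) (f j) ((seg f 0 m).erase (f j))
    have := mult_le_two (G := G) z (f (c z))
    refine ⟨by omega, fun i hi => ?_, fun w hw hne => ?_⟩
    · exact eq_two_of_dg_ge (X := (seg f 0 m).erase (f j)) (by omega) (by simp [hi, hmem])
    · refine (Finset.sum_eq_sum_iff_of_le hterm).1 ?_ w (by simp [hw, hne])
      simp only [Finset.sum_const, smul_eq_mul]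
      omega
  have hother : f (c z₀ + 1) ≠ f (c z₀) := fun h' => by
    have := h.cyc.eq_of_lt h' (by omega) (by omega)
    omega
  refine ⟨c z₀, fun z hz => ?_, fun z hz w hw hne => ?_, fun i j hij => ?_, fun z hz i hi => ?_⟩
  · rw [hsame z₀ hz₀ z hz] at hother ⊢
    exact (mult_eq_two_iff.1 (key z hz _ hother).1).symm
  · have h1 := (key z hz (c z₀ + 1) (by rwa [← hsame z₀ hz₀ z hz])).2.2 w hw hne.symm
    have h2 : G.mult (f (c z₀ + 1)) w = 0 :=
      mult_eq_zero_iff.2 (hnon w hw _ (by rwa [← hsame z₀ hz₀ w hw]))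
    exact (mult_eq_two_iff.1 (by omega)).1
  · by_cases hi : f i = f (c z₀)
    · exact ((key z₀ hz₀ j fun h' => hij (hi.trans h'.symm)).2.1 i hij).2
    · exact ((key z₀ hz₀ i hi).2.1 j hij.symm).1
  · exact hnon z hz i (by rwa [← hsame z₀ hz₀ z hz])

theorem LongestSeq.allBlocks_or_twoComplete (h : G.LongestSeq m f A) (hst : G.IsStrong)
    (hne : A.Nonempty) : G.AllBlocks m f A ∨ ∃ c, G.TwoComplete f A c := by
  by_cases hno : ∀ z ∈ A, ∀ i j, G.Enters A (f i) z → G.Leaves A z (f j) → f i = f j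
  · exact .inr (h.twoComplete hst hne.some_mem hno)
  · push Not at hno
    obtain ⟨z, hz, i, j, hE, hL, hij⟩ := hno
    exact .inl (h.allBlocks hst hz hij hE hL)

theorem TwoComplete.isomorphic (h : G.LongestSeq m f A) {c : ℕ} (hG : G.TwoComplete f A c) :
    G.Isomorphic (twoCliques (Fintype.card V - m) (m - 1)) := by
  have hcard := h.card_add
  have hcC := h.cyc.card_seg 0 le_rfl
  let κ : V → Fin 3 := fun v => if v ∈ A then 0 else if v = f c then 2 else 1
  let κ' : (Fin (Fintype.card V - m) ⊕ Fin (m - 1)) ⊕ Fin 1 → Fin 3 :=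
    Sum.elim (Sum.elim (fun _ => 0) (fun _ => 1)) (fun _ => 2)
  refine isomorphic_of_coloring κ κ' ?_ (fun a b => a = b ∨ a = 2 ∨ b = 2) ?_ ?_
  · have e0 : Fintype.card {v // κ v = 0} = Fintype.card V - m := by
      rw [Fintype.card_subtype, show (Finset.univ.filter fun v => κ v = 0) = A.toFinset by
        ext v; simp only [κ, Finset.mem_filter, Finset.mem_univ, true_and, Set.mem_toFinset]
        split_ifs <;> simp_all]
      omega
    have e1 : Fintype.card {v // κ v = 1} = m - 1 := by
      rw [Fintype.card_subtype,
        show (Finset.univ.filter fun v => κ v = 1) = (seg f 0 m).erase (f c) by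
        ext v
        simp only [κ, Finset.mem_filter, Finset.mem_univ, true_and, Finset.mem_erase,
          h.cyc.mem_seg_full]
        have hv : (∃ i, f i = v) ↔ v ∉ A := by rw [h.compl]; simp
        rw [hv]
        split_ifs <;> simp_all, Finset.card_erase_of_mem (h.cyc.mem_seg_full.2 ⟨c, rfl⟩), hcC]
    have e2 : Fintype.card {v // κ v = 2} = 1 := by
      rw [Fintype.card_subtype,
        show (Finset.univ.filter fun v => κ v = 2) = {f c} by
        ext v
        have := h.notMem c
        simp only [κ, Finset.mem_filter, Finset.mem_univ, true_and, Finset.mem_singleton]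
        split_ifs <;> simp_all
        rintro rfl; contradiction, Finset.card_singleton]
    have e' : ∀ d, Fintype.card {w // κ' w = d} = ∑ w, if κ' w = d then 1 else 0 := by
      intro d; rw [Fintype.card_subtype, Finset.card_filter]
    intro d
    fin_cases d
    · exact e0.trans ((e' 0).trans
        (by simp only [Fintype.sum_sum_type, κ', Sum.elim_inl, Sum.elim_inr]; simp)).symm
    · exact e1.trans ((e' 1).trans
        (by simp only [Fintype.sum_sum_type, κ', Sum.elim_inl, Sum.elim_inr]; simp)).symm
    · exact e2.trans ((e' 2).trans
        (by simp only [Fintype.sum_sum_type, κ', Sum.elim_inl, Sum.elim_inr]; simp)).symm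
  · have hl := h.loopless
    have hcases : ∀ v, v ∈ A ∨ ∃ i, f i = v := fun v => by
      by_cases hv : v ∈ A
      · exact .inl hv
      · exact .inr (h.exists_of_notMem hv)
    intro u v
    by_cases huv : u = v
    · subst huv; simp [hl u]
    simp only [huv, ne_eq, not_false_eq_true, true_and]
    rcases hcases u with hu | ⟨i, rfl⟩ <;> rcases hcases v with hv | ⟨j, rfl⟩
    · simp [κ, hu, hv, hG.outer u hu v hv huv]
    · by_cases hj : f j = f c
      · simp [κ, hu, h.notMem, hj, (hG.center u hu).2]
      · simp [κ, hu, h.notMem, hj, (hG.nonadj u hu j hj).2]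
    · by_cases hj : f i = f c
      · simp [κ, hv, h.notMem, hj, (hG.center v hv).1]
      · simp [κ, hv, h.notMem, hj, (hG.nonadj v hv i hj).1]
    · simp only [hG.cycle i j huv, true_iff, κ, h.notMem, if_false]
      split_ifs <;> simp
  · rintro ((a | a) | a) ((b | b) | b) <;>
      simp [κ', twoCliques, ofSimpleGraph, graphJoin]

theorem TwoComplete.deg_le (h : G.LongestSeq m f A) {c : ℕ} (hG : G.TwoComplete f A c) {z : V}
    (hz : z ∈ A) : G.deg z + 1 ≤ Fintype.card V := by
  have hcard := h.card_add
  obtain ⟨⟨w, hw, hp⟩, -⟩ := PathOn.exists_of_complete (G := G) (U := A.toFinset)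
    (fun u hu v hv huv => hG.outer u (by simpa using hu) v (by simpa using hv) huv)
    (Set.mem_toFinset.2 hz)
  have hc : f c ∉ A.toFinset := by simpa using h.notMem c
  have := h.card_le (PathOn.cons (hG.center z hz).1 hp hc)
    (hG.center w (Set.mem_toFinset.1 hw)).2
  rw [Finset.card_insert_of_notMem hc] at this
  have hcA : (A.toFinset.erase z).card + 1 = A.toFinset.card :=
    Finset.card_erase_add_one (Set.mem_toFinset.2 hz)
  have h1 := dg_le (G := G) z (A.toFinset.erase z)
  have h2 : G.dg z (seg f 0 m) = G.mult z (f c) := by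
    refine Finset.sum_eq_single _ (fun v hv hne => ?_)
      (fun h' => absurd (h.cyc.mem_seg_full.2 ⟨_, rfl⟩) h')
    obtain ⟨i, -, -, rfl⟩ := mem_seg.1 hv
    exact mult_eq_zero_iff.2 (hG.nonadj z hz i hne).symm
  have h3 := mult_le_two (G := G) z (f c)
  rw [deg_eq, h.dg_univ, h2, ← dg_erase_self h.loopless z A.toFinset]
  omega

theorem TwoComplete.not_isKStrong (h : G.LongestSeq m f A) {c : ℕ} (hG : G.TwoComplete f A c)
    (hne : A.Nonempty) : ¬ G.IsKStrong 2 := by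
  rintro ⟨-, hst⟩
  obtain ⟨z, hz⟩ := hne
  have hm := h.cyc.two_le
  have hother : f (c + 1) ≠ f c := fun h' => by
    have := h.cyc.eq_of_lt h' (by omega) (by omega)
    omega
  have hr := hst {f c} (by simp) ⟨z, (h.notMem_of_mem hz c).symm⟩ ⟨f (c + 1), hother⟩
  -- a walk that starts in `A` and avoids `f c` cannot leave `A`
  have key : ∀ w, Relation.ReflTransGen (G.inducedOn {f c}ᶜ).Adj
      ⟨z, (h.notMem_of_mem hz c).symm⟩ w → w.1 ∈ A := by
    intro w hw
    induction hw with
    | refl => exact hz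
    | @tail a b _ hab ih =>
      by_contra hb
      obtain ⟨i, hi⟩ := h.exists_of_notMem hb
      have hic : f i ≠ f c := fun h' => b.2 (by simp [← hi, h'])
      have hab' : G.Adj a.1 b.1 := hab
      rw [← hi] at hab'
      exact (hG.nonadj a ih i hic).2 hab'
  exact h.notMem _ (key _ hr)

theorem TwoComplete.hasCycle (h : G.LongestSeq m f A) {c : ℕ} (hG : G.TwoComplete f A c) {r : ℕ}
    (h2 : 2 ≤ r) (hr : r ≤ m) : G.HasCycle r := by
  have hp := h.cyc.pathOn_seg' (a := 0) (b := r - 1) (l := r) (by omega) (by omega) hr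
  have := hp.hasCycle (hG.cycle _ _ fun h' => by
    have := h.cyc.eq_of_lt h' (by omega) (by omega)
    omega) (by rwa [h.cyc.card_seg _ hr])
  rwa [h.cyc.card_seg _ hr] at this

end

/-! ### Degrees and the segment that belongs to a component -/

section

variable {m : ℕ} {f : ℕ → V} {A : Set V}

/-- The indices strictly between `t + (k - 1)` and `t` on a cycle of length `m` are
`t + k, …, t + (m - 1)`. -/
theorem between_eq_seg {x : ZMod m → V} {k t : ℕ} (hk : 2 ≤ k) (hkm : k < m) :
    between x ((k - 1 + t : ℕ) : ZMod m) (t : ZMod m) =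
      (seg (fun i => x ((i + t : ℕ) : ZMod m)) k (m - k) : Set V) := by
  have : NeZero m := ⟨by omega⟩
  have hba : ((t : ZMod m) - ((k - 1 + t : ℕ) : ZMod m)) = ((m - k + 1 : ℕ) : ZMod m) := by
    rw [sub_eq_iff_eq_add, ← Nat.cast_add, show m - k + 1 + (k - 1 + t) = t + m by omega]
    simp
  ext v
  simp only [between, Set.mem_image, Set.mem_ofPred_eq, Finset.mem_coe, mem_seg, hba,
    ZMod.val_cast_of_lt (show m - k + 1 < m by omega)]
  constructor
  · rintro ⟨i, ⟨h1, h2⟩, rfl⟩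
    refine ⟨k - 1 + (i - ((k - 1 + t : ℕ) : ZMod m)).val, by omega, by omega, ?_⟩
    rw [add_right_comm, Nat.cast_add, ZMod.natCast_zmod_val, add_sub_cancel]
  · rintro ⟨j, h1, h2, rfl⟩
    refine ⟨((j + t : ℕ) : ZMod m), ?_, rfl⟩
    have : (((j + t : ℕ) : ZMod m) - ((k - 1 + t : ℕ) : ZMod m)) = ((j + 1 - k : ℕ) : ZMod m) := by
      rw [sub_eq_iff_eq_add, ← Nat.cast_add, show j + 1 - k + (k - 1 + t) = j + t by omega]
    rw [this, ZMod.val_cast_of_lt (by omega)]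
    omega

theorem Tight.not_canInsert {x : ZMod m → V} {k t : ℕ} (hkm : k < m) {w : V}
    (hw : G.Tight k (fun i => x ((i + t : ℕ) : ZMod m)) w) :
    ¬ G.CanInsert x (t : ZMod m) ((k - 1 + t : ℕ) : ZMod m) w := by
  have : NeZero m := ⟨by omega⟩
  rintro ⟨i, h1, h2, h3⟩
  have hab : (((k - 1 + t : ℕ) : ZMod m) - (t : ZMod m)) = ((k - 1 : ℕ) : ZMod m) := by
    rw [Nat.cast_add, add_sub_cancel_right]
  rw [hab, ZMod.val_cast_of_lt (by omega)] at h1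
  have hi : i = (((i - (t : ZMod m)).val + t : ℕ) : ZMod m) := by
    rw [Nat.cast_add, ZMod.natCast_zmod_val, sub_add_cancel]
  have hp := hw.2.2 (i - (t : ZMod m)).val (by omega)
  simp only [add_right_comm _ 1 t, Nat.cast_add_one, ← hi] at hp
  exact hp.1 h2 h3

theorem Block.adjacent {k : ℕ} {S : Set V} (hb : G.Block m k f A S) {s w : V}
    (hs : s ∈ S) (hw : w ∈ A) (hne : s ≠ w) :
    G.Adjacent s w := by
  by_cases hwS : w ∈ S
  · exact .inl (hb.complete s hs w hwS hne)
  · rcases hb.outer w hw hwS with h' | h'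
    · exact .inr (h'.1 s hs).1
    · exact .inl (h'.1 s hs).1

variable [Fintype V]

theorem LongestSeq.card_seg_sub (h : G.LongestSeq m f A) {k : ℕ} :
    (seg f k (m - k)).card = m - k := h.cyc.card_seg _ (by omega)

namespace Block

variable {k : ℕ} {S : Set V}

theorem inj_lt (hb : G.Block m k f A S) (h : G.LongestSeq m f A) :
    ∀ i < k, ∀ j < k, f i = f j → i = j := fun i hi j hj =>
  h.cyc.inj i (hi.trans hb.lt) j (hj.trans hb.lt)

theorem pathOn_init (hb : G.Block m k f A S) (h : G.LongestSeq m f A) :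
    G.PathOn (f 0) (f (k - 1)) (seg f 0 k) :=
  have := hb.two_le
  h.cyc.pathOn_seg' (by omega) (by omega) hb.lt.le

theorem disjoint_toFinset (hb : G.Block m k f A S) (h : G.LongestSeq m f A) (a n : ℕ) :
    Disjoint (seg f a n) S.toFinset :=
  h.disjoint_seg (by simpa using hb.subset) a n

/-- The component can take the place of the segment, so it is not larger. -/
theorem card_le (hb : G.Block m k f A S) (h : G.LongestSeq m f A) : S.toFinset.card ≤ m - k := by
  obtain ⟨s, hs⟩ := hb.nonempty
  obtain ⟨⟨s', hs', hp⟩, -⟩ := PathOn.exists_of_complete (G := G) (U := S.toFinset)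
    (fun u hu v hv huv => hb.complete u (by simpa using hu) v (by simpa using hv) huv)
    (Set.mem_toFinset.2 hs)
  have hd := hb.disjoint_toFinset h 0 k
  have := h.card_le ((hb.pathOn_init h).append (hb.tight s hs).2.1 hp hd)
    (hb.tight s' (Set.mem_toFinset.1 hs')).1
  rw [Finset.card_union_of_disjoint hd, h.cyc.card_seg _ hb.lt.le] at this
  omega

theorem dg_cycle (hb : G.Block m k f A S) (h : G.LongestSeq m f A) {s : V} (hs : s ∈ S) :
    G.dg s (seg f 0 m) = k + 1 := by
  have := hb.two_le
  rw [seg_split hb.lt.le, dg_union (h.disjoint_init_seg hb.lt.le), dg_eq_zero (hb.nonadj s hs),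
    (hb.tight s hs).dg_eq (by omega) (hb.inj_lt h), add_zero]

theorem dg_cycle_seg (hb : G.Block m k f A S) (h : G.LongestSeq m f A) {y : V}
    (hy : y ∈ seg f k (m - k)) : G.dg y (seg f 0 m) = k + 1 + 2 * (m - k - 1) := by
  have := hb.two_le
  rw [seg_split hb.lt.le, dg_union (h.disjoint_init_seg hb.lt.le),
    (hb.tight_seg y hy).dg_eq (by omega) (hb.inj_lt h), ← dg_erase_self h.loopless,
    dg_eq_two_mul, Finset.card_erase_of_mem hy, h.card_seg_sub]
  intro w hw
  rw [Finset.mem_erase] at hw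
  exact ⟨hb.complete_seg y hy w hw.2 hw.1.symm, hb.complete_seg w hw.2 y hy hw.1⟩

theorem deg_le (hb : G.Block m k f A S) (h : G.LongestSeq m f A) {s : V} (hs : s ∈ S) :
    G.deg s + 1 ≤ Fintype.card V := by
  have hcS := hb.card_le h
  have hcard := h.card_add
  have hsub : S.toFinset ⊆ A.toFinset := Set.toFinset_subset_toFinset.2 hb.subset
  have hsplit : G.dg s A.toFinset =
      G.dg s (A.toFinset \ S.toFinset) + G.dg s (S.toFinset.erase s) := by
    rw [dg_erase_self h.loopless, ← dg_union Finset.sdiff_disjoint,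
      Finset.sdiff_union_of_subset hsub]
  have h1 : G.dg s (A.toFinset \ S.toFinset) ≤ (A.toFinset \ S.toFinset).card := by
    rw [dg, Finset.card_eq_sum_ones]
    refine Finset.sum_le_sum fun w hw => ?_
    simp only [Finset.mem_sdiff, Set.mem_toFinset] at hw
    rcases hb.outer w hw.1 hw.2 with h' | h' <;> simp [mult, h'.1 s hs]
  have h2 := dg_le (G := G) s (S.toFinset.erase s)
  have h3 : (S.toFinset.erase s).card + 1 = S.toFinset.card :=
    Finset.card_erase_add_one (Set.mem_toFinset.2 hs)
  have h4 := Finset.card_sdiff_add_card_eq_card hsub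
  have := hb.lt
  rw [deg_eq, h.dg_univ, hb.dg_cycle h hs, hsplit]
  omega

end Block

theorem Block.segment_properties {x : ZMod m → V}
    (h : G.LongestSeq m (fun i => x (i : ZMod m)) A) {n : ℕ} {D : Fin n → Set V}
    (hD : G.IsComponentLabelling A D) (l : Fin n) {t k : ℕ}
    (hb : G.Block m k (fun i => x ((i + t : ℕ) : ZMod m)) A (D l)) :
    ∃ (a b : ZMod m) (B : Set V), a ≠ b ∧ B = Digraph.between x a b ∧ B.Nonempty ∧
      (∃ u ∈ D l, ∃ v ∈ D l, G.Adj (x a) u ∧ G.Adj v (x b)) ∧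
      G.NoArcs B (⋃ i ≤ l, D i) ∧
      G.NoArcs (⋃ i ≥ l, D i) B ∧
      G.NoArcs (D l) B ∧ G.NoArcs B (D l) ∧
      (G.inducedOn B).IsComplete ∧
      G.Dominates (⋃ i < l, D i) (B ∪ D l) ∧
      G.Dominates (B ∪ D l) (⋃ i > l, D i) ∧
      (∀ z ∈ D l, (G.degOn z (Set.range x) : ℤ) = m - B.ncard + 1) ∧
      (∀ y ∈ B, (G.degOn y (Set.range x) : ℤ) = m + B.ncard - 1) ∧
      (D l).ncard ≤ B.ncard ∧
      (∀ w ∈ D l ∪ B, ¬ G.CanInsert x b a w) ∧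
      G.Dominates {x a} (B ∪ D l) ∧ G.Dominates (B ∪ D l) {x b} := by
  have hk := hb.two_le
  have hkm := hb.lt
  have : NeZero m := ⟨by omega⟩
  have h' := h.rotate t
  set f : ℕ → V := fun i => x ((i + t : ℕ) : ZMod m) with hf
  have hxb : x (t : ZMod m) = f 0 := by simp [hf]
  have hxa : x ((k - 1 + t : ℕ) : ZMod m) = f (k - 1) := rfl
  have hrange : Set.range x = (seg f 0 m : Set V) := by
    rw [h'.cyc.coe_seg, h.cyc.range_rotate, range_natCast]
  have hncard : ((seg f k (m - k) : Finset V) : Set V).ncard = m - k := by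
    rw [Set.ncard_coe_finset, h'.card_seg_sub]
  obtain ⟨z, hz⟩ := hb.nonempty
  have hcomp : ∀ i, G.IsStrongComponentOn A (D i) := fun i => by
    have : D i ∈ {S | G.IsStrongComponentOn A S} := hD.range_eq ▸ ⟨i, rfl⟩
    exact this
  have hmemA : ∀ i, D i ⊆ A := fun i => (hcomp i).prop.1
  have hdisj : ∀ i, i ≠ l → ∀ w ∈ D i, w ∉ D l := by
    intro i hi w hw hwl
    exact hi (hD.injective (((hcomp i).eq_comp hw).trans ((hcomp l).eq_comp hwl).symm))
  have hlow : ∀ i < l, ∀ w ∈ D i, (∀ s ∈ D l, G.Adj w s ∧ ¬ G.Adj s w) ∧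
      ∀ y ∈ seg f k (m - k), G.Adj w y ∧ ¬ G.Adj y w := by
    intro i hi w hw
    rcases hb.outer w (hmemA i hw) (hdisj i hi.ne w hw) with ho | ho
    · exact ho
    · exact absurd (ho.1 z hz).1 (hD.noArcs l i hi z hz w hw)
  have hhigh : ∀ i > l, ∀ w ∈ D i, (∀ s ∈ D l, G.Adj s w ∧ ¬ G.Adj w s) ∧
      ∀ y ∈ seg f k (m - k), G.Adj y w ∧ ¬ G.Adj w y := by
    intro i hi w hw
    rcases hb.outer w (hmemA i hw) (hdisj i hi.ne' w hw) with ho | ho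
    · exact absurd (ho.1 z hz).1 (hD.noArcs i l hi w hw z hz)
    · exact ho
  refine ⟨((k - 1 + t : ℕ) : ZMod m), (t : ZMod m), _, ?_, rfl, ?_⟩
  · intro heq
    have : f (k - 1) = f 0 := by rw [← hxa, ← hxb, heq]
    have := h'.cyc.inj _ (by omega) _ (by omega) this
    omega
  rw [between_eq_seg hk hkm, hxa, hxb, hrange, hncard]
  refine ⟨⟨f k, mem_seg_of le_rfl (by omega)⟩,
    ⟨z, hz, z, hz, (hb.tight z hz).2.1, (hb.tight z hz).1⟩, ?_, ?_, ?_, ?_, ?_, ?_, ?_, ?_, ?_,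
    ?_, ?_, ?_, ?_⟩
  · intro y hy w hw
    simp only [Set.mem_iUnion] at hw
    obtain ⟨i, hi, hw⟩ := hw
    rcases hi.eq_or_lt with rfl | hi
    · exact (hb.nonadj w hw y hy).2
    · exact ((hlow i hi w hw).2 y hy).2
  · intro w hw y hy
    simp only [Set.mem_iUnion] at hw
    obtain ⟨i, hi, hw⟩ := hw
    rcases (show l ≤ i from hi).eq_or_lt with rfl | hi
    · exact (hb.nonadj w hw y hy).1
    · exact ((hhigh i hi w hw).2 y hy).2
  · exact fun s hs y hy => (hb.nonadj s hs y hy).1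
  · exact fun y hy s hs => (hb.nonadj s hs y hy).2
  · rintro ⟨y, hy⟩ ⟨y', hy'⟩ hne
    exact hb.complete_seg y hy y' hy' fun e => hne (Subtype.ext e)
  · intro w hw v hv
    simp only [Set.mem_iUnion] at hw
    obtain ⟨i, hi, hw⟩ := hw
    rcases hv with hv | hv
    · exact ((hlow i hi w hw).2 v hv).1
    · exact ((hlow i hi w hw).1 v hv).1
  · intro v hv w hw
    simp only [Set.mem_iUnion] at hw
    obtain ⟨i, hi, hw⟩ := hw
    rcases hv with hv | hv
    · exact ((hhigh i hi w hw).2 v hv).1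
    · exact ((hhigh i hi w hw).1 v hv).1
  · intro s hs
    rw [degOn_coe_eq, hb.dg_cycle h' hs]
    omega
  · intro y hy
    rw [degOn_coe_eq, hb.dg_cycle_seg h' hy]
    omega
  · rw [Set.ncard_eq_toFinset_card']
    exact hb.card_le h'
  · rintro w (hw | hw)
    · exact (hb.tight w hw).not_canInsert hkm
    · exact (hb.tight_seg w hw).not_canInsert hkm
  · rintro u rfl v (hv | hv)
    · exact (hb.tight_seg v hv).2.1
    · exact (hb.tight v hv).2.1
  · rintro v (hv | hv) u rfl
    · exact (hb.tight_seg v hv).1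
    · exact (hb.tight v hv).1

end

/-! ### Components in 2-strong digraphs -/

section

variable {m : ℕ} {f : ℕ → V} {A : Set V}

/-- Two complete sets `U` and `W` without arcs between them, tight with respect to a path
`f 0, …, f (k - 1)` such that the path, `U`, `W` and `T` cover all vertices, and such that no cycle
has more than `m` vertices, where `m < k + |U| + |W|`. -/
structure Twins (G : Digraph V) (m k : ℕ) (f : ℕ → V) (T : Set V) (U W : Finset V) : Prop where
  cyc : G.CyclicSeq m f
  two_le : 2 ≤ k
  le : k ≤ m
  nonempty : U.Nonempty ∧ W.Nonempty
  complete : ∀ u ∈ U, ∀ v ∈ U, u ≠ v → G.Adj u v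
  complete' : ∀ u ∈ W, ∀ v ∈ W, u ≠ v → G.Adj u v
  nonadj : ∀ u ∈ U, ∀ w ∈ W, ¬ G.Adj u w ∧ ¬ G.Adj w u
  disjoint : Disjoint U W
  disjoint_seg : ∀ a n, a + n ≤ k → Disjoint (seg f a n) U ∧ Disjoint (seg f a n) W
  tight : ∀ u ∈ U, G.Tight k f u
  tight' : ∀ u ∈ W, G.Tight k f u
  notMem : ∀ v ∈ T, v ∉ U ∧ v ∉ W ∧ v ∉ seg f 0 k
  cover : ∀ v, v ∈ seg f 0 k ∨ v ∈ U ∨ v ∈ W ∨ v ∈ T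
  outer : ∀ v ∈ T, ∀ u ∈ U, ∀ w ∈ W, G.Adj v u ↔ G.Adj v w
  long : ∀ p q Z, G.PathOn p q Z → G.Adj q p → Z.card ≤ m
  lt : m < k + U.card + W.card

namespace Twins

variable {k : ℕ} {T : Set V} {U W : Finset V}

theorem symm (h : G.Twins m k f T U W) : G.Twins m k f T W U where
  cyc := h.cyc
  two_le := h.two_le
  le := h.le
  nonempty := h.nonempty.symm
  complete := h.complete'
  complete' := h.complete
  nonadj u hu w hw := (h.nonadj w hw u hu).symm
  disjoint := h.disjoint.symm
  disjoint_seg a n hn := (h.disjoint_seg a n hn).symm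
  tight := h.tight'
  tight' := h.tight
  notMem v hv := ⟨(h.notMem v hv).2.1, (h.notMem v hv).1, (h.notMem v hv).2.2⟩
  cover v := by have := h.cover v; tauto
  outer v hv u hu w hw := (h.outer v hv w hw u hu).symm
  long := h.long
  lt := by have := h.lt; omega

theorem exists_path (h : G.Twins m k f T U W) : ∃ u ∈ U, ∃ v ∈ U, G.PathOn u v U := by
  obtain ⟨u, hu⟩ := h.nonempty.1
  obtain ⟨⟨v, hv, hp⟩, -⟩ := PathOn.exists_of_complete h.complete hu
  exact ⟨u, hu, v, hv, hp⟩

theorem pathOn_seg (h : G.Twins m k f T U W) {a b l : ℕ} (hb : b + 1 = a + l) (h1 : 1 ≤ l)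
    (hl : a + l ≤ k) : G.PathOn (f a) (f b) (seg f a l) :=
  h.cyc.pathOn_seg' hb h1 (by have := h.le; omega)

theorem disjoint_segs (h : G.Twins m k f T U W) {a b l n : ℕ} (h1 : a + l ≤ b) (h2 : b + n ≤ k) :
    Disjoint (seg f a l) (seg f b n) :=
  h.cyc.disjoint_seg h1 (by have := h.le; omega)

theorem card_seg (h : G.Twins m k f T U W) {a l : ℕ} (hl : a + l ≤ k) : (seg f a l).card = l :=
  h.cyc.card_seg a (by have := h.le; omega)

/-- Otherwise `U` could be inserted into the path and `W` used to close it. -/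
theorem not_insert (h : G.Twins m k f T U W) {u u' : V} (hu : u ∈ U) (hu' : u' ∈ U) {i : ℕ}
    (hi : i + 1 < k) : ¬ (G.Adj (f i) u ∧ G.Adj u' (f (i + 1))) := by
  rintro ⟨h1, h2⟩
  by_cases hne : u = u'
  · subst hne
    exact ((h.tight u hu).2.2 i hi).1 h1 h2
  obtain ⟨w, hw, w', hw', hW⟩ := h.symm.exists_path
  have hU := PathOn.of_complete h.complete hu hu' hne
  have p1 := h.pathOn_seg (a := 0) (b := i) (l := i + 1) (by omega) (by omega) (by omega)
  have p2 := h.pathOn_seg (a := i + 1) (b := k - 1) (l := k - (i + 1)) (by omega) (by omega)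
    (by omega)
  have d1 := h.disjoint_seg 0 (i + 1) (by omega)
  have d2 := h.disjoint_seg (i + 1) (k - (i + 1)) (by omega)
  have d12 := h.disjoint_segs (a := 0) (l := i + 1) (b := i + 1) (n := k - (i + 1)) (by omega)
    (by omega)
  have e1 : Disjoint (seg f 0 (i + 1) ∪ U) (seg f (i + 1) (k - (i + 1))) :=
    Finset.disjoint_union_left.2 ⟨d12, d2.1.symm⟩
  have e2 : Disjoint (seg f 0 (i + 1) ∪ U ∪ seg f (i + 1) (k - (i + 1))) W :=
    Finset.disjoint_union_left.2 ⟨Finset.disjoint_union_left.2 ⟨d1.2, h.disjoint⟩, d2.2⟩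
  have := h.long _ _ _ (((p1.append h1 hU d1.1).append h2 p2 e1).append (h.tight' w hw).2.1 hW e2)
    (h.tight' w' hw').1
  rw [Finset.card_union_of_disjoint e2, Finset.card_union_of_disjoint e1,
    Finset.card_union_of_disjoint d1.1, h.card_seg (by omega), h.card_seg (by omega)] at this
  have := h.lt
  omega

theorem adj_iff (h : G.Twins m k f T U W) {u u' : V} (hu : u ∈ U) (hu' : u' ∈ U) {i : ℕ}
    (hi : i < k) : G.Adj (f i) u ↔ G.Adj (f i) u' := by
  have key : ∀ {u u' : V}, u ∈ U → u' ∈ U → G.Adj (f i) u → G.Adj (f i) u' := by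
    intro u u' hu hu' hadj
    by_cases hik : i + 1 < k
    · exact ((h.tight u' hu').2.2 i hik).2 fun h' => h.not_insert hu hu' hik ⟨hadj, h'⟩
    · obtain rfl : i = k - 1 := by omega
      exact (h.tight u' hu').2.1
  exact ⟨key hu hu', key hu' hu⟩

/-- Otherwise `U` could replace the vertex `f (i + 1)`. -/
theorem adj_succ (h : G.Twins m k f T U W) (hlt : m + 2 ≤ k + U.card + W.card)
    {u : V} (hu : u ∈ U) {i : ℕ} (hi : i + 1 < k) (hadj : G.Adj (f i) u) : G.Adj (f (i + 1)) u := by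
  by_contra hcon
  have hi2 : i + 2 < k := by
    by_contra h'
    obtain rfl : k = i + 2 := by omega
    exact hcon (h.tight u hu).2.1
  obtain ⟨u₁, hu₁, u₂, hu₂, hU⟩ := h.exists_path
  have h1 : G.Adj (f i) u₁ := (h.adj_iff hu hu₁ (by omega)).1 hadj
  have h2 : G.Adj u₂ (f (i + 2)) := by
    by_contra h'
    exact hcon ((h.adj_iff hu hu₂ hi).2 (((h.tight u₂ hu₂).2.2 (i + 1) hi2).2 h'))
  obtain ⟨w, hw, w', hw', hW⟩ := h.symm.exists_path
  have p1 := h.pathOn_seg (a := 0) (b := i) (l := i + 1) (by omega) (by omega) (by omega)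
  have p2 := h.pathOn_seg (a := i + 2) (b := k - 1) (l := k - (i + 2)) (by omega) (by omega)
    (by omega)
  have d1 := h.disjoint_seg 0 (i + 1) (by omega)
  have d2 := h.disjoint_seg (i + 2) (k - (i + 2)) (by omega)
  have d12 := h.disjoint_segs (a := 0) (l := i + 1) (b := i + 2) (n := k - (i + 2)) (by omega)
    (by omega)
  have e1 : Disjoint (seg f 0 (i + 1) ∪ U) (seg f (i + 2) (k - (i + 2))) :=
    Finset.disjoint_union_left.2 ⟨d12, d2.1.symm⟩
  have e2 : Disjoint (seg f 0 (i + 1) ∪ U ∪ seg f (i + 2) (k - (i + 2))) W :=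
    Finset.disjoint_union_left.2 ⟨Finset.disjoint_union_left.2 ⟨d1.2, h.disjoint⟩, d2.2⟩
  have := h.long _ _ _ (((p1.append h1 hU d1.1).append h2 p2 e1).append (h.tight' w hw).2.1 hW e2)
    (h.tight' w' hw').1
  rw [Finset.card_union_of_disjoint e2, Finset.card_union_of_disjoint e1,
    Finset.card_union_of_disjoint d1.1, h.card_seg (by omega), h.card_seg (by omega)] at this
  have := h.lt
  omega

/-- `U` dominates an initial segment of the path and is dominated by a final one; the two segments
share exactly one vertex. -/
theorem exists_threshold (h : G.Twins m k f T U W) (hlt : m + 2 ≤ k + U.card + W.card) :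
    ∃ t < k, ∀ u ∈ U, ∀ i < k, (G.Adj u (f i) ↔ i ≤ t) ∧ (G.Adj (f i) u ↔ t ≤ i) := by
  have hk := h.two_le
  obtain ⟨u₀, hu₀⟩ := h.nonempty.1
  have hex : ∃ t, G.Adj (f t) u₀ := ⟨k - 1, (h.tight u₀ hu₀).2.1⟩
  have hfk : Nat.find hex < k := by
    have := Nat.find_min' hex (h.tight u₀ hu₀).2.1
    omega
  refine ⟨Nat.find hex, hfk, fun u hu => ?_⟩
  have hin : ∀ i < k, (G.Adj (f i) u ↔ Nat.find hex ≤ i) := by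
    intro i hi
    rw [h.adj_iff hu hu₀ hi]
    refine ⟨fun h' => Nat.find_min' hex h', fun hle => ?_⟩
    induction i, hle using Nat.le_induction with
    | base => exact Nat.find_spec hex
    | succ i hle ih => exact h.adj_succ hlt hu₀ hi (ih (by omega))
  intro i hi
  refine ⟨?_, hin i hi⟩
  rcases i with _ | i
  · simp [(h.tight u hu).1]
  · have h1 := (h.tight u hu).2.2 i hi
    rw [hin i (by omega)] at h1
    have : G.Adj u (f (i + 1)) ↔ ¬ Nat.find hex ≤ i := by rw [h1, not_not]
    rw [this]
    omega

/-- A path that avoids `T` and contains all the other vertices cannot be closed through `T`. -/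
theorem not_closed (h : G.Twins m k f T U W) {p q : V} {X : Finset V} (hp : G.PathOn p q X)
    (hX : ∀ v ∈ T, v ∉ X) (hcard : k + U.card + W.card ≤ X.card) :
    ¬ (G.Adj q p ∨ ∃ v ∈ T, G.Enters T q v ∧ G.Adj v p) := by
  have hlt := h.lt
  rintro (hq | ⟨v, hv, ⟨w, hw, hqw, hwv⟩, hvp⟩)
  · have := h.long _ _ _ hp hq
    omega
  · obtain ⟨Y, hY, hpY⟩ := hwv.exists_pathOn hv
    have hd : Disjoint X Y := Finset.disjoint_right.2 fun a ha => hX a (hY ha)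
    have := h.long _ _ _ (hp.append hqw hpY hd) hvp
    rw [Finset.card_union_of_disjoint hd] at this
    omega

theorem not_isStrong_of_le (h : G.Twins m k f T U W) {t t' : ℕ} (htk : t < k) (htt' : t ≤ t')
    (hU : ∀ u ∈ U, ∀ i < k, (G.Adj u (f i) ↔ i ≤ t) ∧ (G.Adj (f i) u ↔ t ≤ i))
    (hW : ∀ u ∈ W, ∀ i < k, (G.Adj u (f i) ↔ i ≤ t') ∧ (G.Adj (f i) u ↔ t' ≤ i)) :
    ¬ (G.inducedOn {f t}ᶜ).IsStrong := by
  intro hst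
  have hk := h.two_le
  -- the vertices reachable from `U` without `f t`
  let src : V → Prop := fun s => s ∈ U ∨ ∃ i < t, s = f i
  let inv : V → Prop := fun v => ∃ s, src s ∧ (v = s ∨ v ∈ T ∧ G.Enters T s v)
  obtain ⟨w₁, hw₁, w₂, hw₂, pW⟩ := h.symm.exists_path
  obtain ⟨u₁, hu₁, u₂, hu₂, pU⟩ := h.exists_path
  have hTX : ∀ X : Finset V, X ⊆ seg f 0 k ∪ U ∪ W → ∀ v ∈ T, v ∉ X := by
    intro X hX v hv hvX
    have := hX hvX
    simp only [Finset.mem_union, h.notMem v hv, or_self] at this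
  have hsub : ∀ a n, a + n ≤ k → seg f a n ⊆ seg f 0 k ∪ U ∪ W := by
    intro a n hn v hv
    obtain ⟨i, h1, h2, rfl⟩ := mem_seg.1 hv
    simp only [Finset.mem_union]
    exact .inl (.inl (mem_seg_of (by omega) (by omega)))
  have hsubU : U ⊆ seg f 0 k ∪ U ∪ W :=
    Finset.subset_union_right.trans Finset.subset_union_left
  have hsubW : W ⊆ seg f 0 k ∪ U ∪ W := Finset.subset_union_right
  have c1 : ∀ i j, i < t → t < j → j < k →
      ¬ (G.Adj (f i) (f j) ∨ ∃ v ∈ T, G.Enters T (f i) v ∧ G.Adj v (f j)) := by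
    intro i j hi hj hjk
    have p1 := h.pathOn_seg (a := j) (b := k - 1) (l := k - j) (by omega) (by omega) (by omega)
    have p2 := h.pathOn_seg (a := i + 1) (b := j - 1) (l := j - (i + 1)) (by omega) (by omega)
      (by omega)
    have p3 := h.pathOn_seg (a := 0) (b := i) (l := i + 1) (by omega) (by omega) (by omega)
    have d1 := h.disjoint_seg j (k - j) (by omega)
    have d2 := h.disjoint_seg (i + 1) (j - (i + 1)) (by omega)
    have d3 := h.disjoint_seg 0 (i + 1) (by omega)
    have d12 := h.disjoint_segs (a := i + 1) (l := j - (i + 1)) (b := j) (n := k - j) (by omega)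
      (by omega)
    have d13 := h.disjoint_segs (a := 0) (l := i + 1) (b := j) (n := k - j) (by omega) (by omega)
    have d23 := h.disjoint_segs (a := 0) (l := i + 1) (b := i + 1) (n := j - (i + 1)) (by omega)
      (by omega)
    have e2 := Finset.disjoint_union_left.2 ⟨d12.symm, d2.2.symm⟩
    have e3 := Finset.disjoint_union_left.2
      ⟨Finset.disjoint_union_left.2 ⟨d1.1, h.disjoint.symm⟩, d2.1⟩
    have e4 := Finset.disjoint_union_left.2 ⟨Finset.disjoint_union_left.2
      ⟨Finset.disjoint_union_left.2 ⟨d13.symm, d3.2.symm⟩, d23.symm⟩, d3.1.symm⟩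
    refine h.not_closed ((((p1.append (h.tight' w₁ hw₁).2.1 pW d1.2).append
      ((hW w₂ hw₂ _ (by omega)).1.2 (by omega)) p2 e2).append
      ((hU u₁ hu₁ _ (by omega)).2.2 (by omega)) pU e3).append (h.tight u₂ hu₂).1 p3 e4)
      (hTX _ ?_) ?_
    · exact Finset.union_subset (Finset.union_subset (Finset.union_subset (Finset.union_subset
        (hsub _ _ (by omega)) hsubW) (hsub _ _ (by omega))) hsubU) (hsub _ _ (by omega))
    · rw [Finset.card_union_of_disjoint e4, Finset.card_union_of_disjoint e3,
        Finset.card_union_of_disjoint e2, Finset.card_union_of_disjoint d1.2,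
        h.card_seg (by omega), h.card_seg (by omega), h.card_seg (by omega)]
      omega
  have c2 : ∀ u ∈ U, ∀ j, t < j → j < k →
      ¬ (G.Adj u (f j) ∨ ∃ v ∈ T, G.Enters T u v ∧ G.Adj v (f j)) := by
    intro u hu j hj hjk
    obtain ⟨-, u', hu', pu⟩ := PathOn.exists_of_complete h.complete hu
    have p1 := h.pathOn_seg (a := j) (b := k - 1) (l := k - j) (by omega) (by omega) (by omega)
    have p2 := h.pathOn_seg (a := 0) (b := j - 1) (l := j) (by omega) (by omega) (by omega)
    have d1 := h.disjoint_seg j (k - j) (by omega)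
    have d2 := h.disjoint_seg 0 j (by omega)
    have d12 := h.disjoint_segs (a := 0) (l := j) (b := j) (n := k - j) (by omega) (by omega)
    have e2 := Finset.disjoint_union_left.2 ⟨d12.symm, d2.2.symm⟩
    have e3 := Finset.disjoint_union_left.2
      ⟨Finset.disjoint_union_left.2 ⟨d1.1, h.disjoint.symm⟩, d2.1⟩
    refine h.not_closed (((p1.append (h.tight' w₁ hw₁).2.1 pW d1.2).append
      (h.tight' w₂ hw₂).1 p2 e2).append
      ((hU u' hu' _ (by omega)).2.2 (by omega)) pu e3) (hTX _ ?_) ?_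
    · exact Finset.union_subset (Finset.union_subset (Finset.union_subset
        (hsub _ _ (by omega)) hsubW) (hsub _ _ (by omega))) hsubU
    · rw [Finset.card_union_of_disjoint e3,
        Finset.card_union_of_disjoint e2, Finset.card_union_of_disjoint d1.2,
        h.card_seg (by omega), h.card_seg (by omega)]
      omega
  have c3 : ∀ u ∈ U, ∀ i, i < t →
      ¬ (G.Adj (f i) u ∨ ∃ v ∈ T, G.Enters T (f i) v ∧ G.Adj v u) := by
    intro u hu i hi
    obtain ⟨⟨u', hu', pu⟩, -⟩ := PathOn.exists_of_complete h.complete hu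
    have p1 := h.pathOn_seg (a := i + 1) (b := k - 1) (l := k - (i + 1)) (by omega) (by omega)
      (by omega)
    have p2 := h.pathOn_seg (a := 0) (b := i) (l := i + 1) (by omega) (by omega) (by omega)
    have d1 := h.disjoint_seg (i + 1) (k - (i + 1)) (by omega)
    have d2 := h.disjoint_seg 0 (i + 1) (by omega)
    have d12 := h.disjoint_segs (a := 0) (l := i + 1) (b := i + 1) (n := k - (i + 1)) (by omega)
      (by omega)
    have e2 := Finset.disjoint_union_left.2 ⟨h.disjoint, d1.2⟩
    have e3 := Finset.disjoint_union_left.2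
      ⟨Finset.disjoint_union_left.2 ⟨d2.1.symm, d12.symm⟩, d2.2.symm⟩
    refine h.not_closed (((pu.append ((hU u' hu' _ (by omega)).1.2 (by omega)) p1 d1.1.symm).append
      (h.tight' w₁ hw₁).2.1 pW e2).append (h.tight' w₂ hw₂).1 p2 e3) (hTX _ ?_) ?_
    · exact Finset.union_subset (Finset.union_subset (Finset.union_subset hsubU
        (hsub _ _ (by omega))) hsubW) (hsub _ _ (by omega))
    · rw [Finset.card_union_of_disjoint e3,
        Finset.card_union_of_disjoint e2, Finset.card_union_of_disjoint d1.1.symm,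
        h.card_seg (by omega), h.card_seg (by omega)]
      omega
  have c4 : ∀ u ∈ U, ∀ w ∈ W, ¬ (G.Adj u w ∨ ∃ v ∈ T, G.Enters T u v ∧ G.Adj v w) := by
    intro u hu w hw
    obtain ⟨-, u', hu', pu⟩ := PathOn.exists_of_complete h.complete hu
    obtain ⟨⟨w', hw', pw⟩, -⟩ := PathOn.exists_of_complete h.complete' hw
    have p1 := h.pathOn_seg (a := 0) (b := k - 1) (l := k) (by omega) (by omega) (by omega)
    have d1 := h.disjoint_seg 0 k (by omega)
    have e2 := Finset.disjoint_union_left.2 ⟨h.disjoint.symm, d1.1⟩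
    refine h.not_closed ((pw.append (h.tight' w' hw').1 p1 d1.2.symm).append
      (h.tight u' hu').2.1 pu e2) (hTX _ ?_) ?_
    · exact Finset.union_subset (Finset.union_subset hsubW (hsub _ _ (by omega))) hsubU
    · rw [Finset.card_union_of_disjoint e2, Finset.card_union_of_disjoint d1.2.symm,
        h.card_seg (by omega)]
      omega
  have step : ∀ a b, inv a → G.Adj a b → b ≠ f t → inv b := by
    rintro a b ⟨s, hs, ha⟩ hab hbt
    have hlink : G.Adj s b ∨ ∃ v ∈ T, G.Enters T s v ∧ G.Adj v b := by
      rcases ha with rfl | ⟨haT, hEa⟩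
      · exact .inl hab
      · exact .inr ⟨a, haT, hEa, hab⟩
    rcases h.cover b with hb | hb | hb | hb
    · obtain ⟨j, -, hj, rfl⟩ := mem_seg.1 hb
      rcases lt_trichotomy j t with hjt | rfl | hjt
      · exact ⟨f j, .inr ⟨j, hjt, rfl⟩, .inl rfl⟩
      · exact absurd rfl hbt
      · rcases hs with hs | ⟨i, hi, rfl⟩
        · exact absurd hlink (c2 s hs j hjt (by omega))
        · exact absurd hlink (c1 i j hi hjt (by omega))
    · exact ⟨b, .inl hb, .inl rfl⟩
    · rcases hs with hs | ⟨i, hi, rfl⟩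
      · exact absurd hlink (c4 s hs b hb)
      · rcases hlink with hlink | ⟨v, hv, hEv, hvb⟩
        · have := (hW b hb i (by omega)).2.1 hlink
          omega
        · exact absurd (.inr ⟨v, hv, hEv, (h.outer v hv u₁ hu₁ b hb).2 hvb⟩) (c3 u₁ hu₁ i hi)
    · refine ⟨s, hs, .inr ⟨hb, ?_⟩⟩
      rcases ha with rfl | ⟨haT, hEa⟩
      · exact ⟨b, hb, hab, .refl⟩
      · exact hEa.trans (.single haT hb hab)
  have hUt : u₁ ≠ f t := fun h' => Finset.disjoint_right.1 (h.disjoint_seg 0 k (by omega)).1 hu₁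
    (h' ▸ mem_seg_of (by omega) (by omega))
  have hWt : w₁ ≠ f t := fun h' => Finset.disjoint_right.1 (h.disjoint_seg 0 k (by omega)).2 hw₁
    (h' ▸ mem_seg_of (by omega) (by omega))
  have key : ∀ w, Relation.ReflTransGen (G.inducedOn {f t}ᶜ).Adj ⟨u₁, hUt⟩ w → inv w.1 := by
    intro w hw
    induction hw with
    | refl => exact ⟨u₁, .inl hu₁, .inl rfl⟩
    | @tail a b _ hab ih => exact step a.1 b.1 ih hab b.2
  obtain ⟨s, hs, hws | ⟨hwT, -⟩⟩ := key ⟨w₁, hWt⟩ (hst _ _)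
  · obtain rfl : w₁ = s := hws
    rcases hs with hs | ⟨i, hi, hs⟩
    · exact Finset.disjoint_left.1 h.disjoint hs hw₁
    · exact Finset.disjoint_right.1 (h.disjoint_seg 0 k (by omega)).2 hw₁
        (hs ▸ mem_seg_of (by omega) (by omega))
  · exact (h.notMem w₁ hwT).2.1 hw₁

theorem not_isStrong (h : G.Twins m k f T U W) (hlt : m + 2 ≤ k + U.card + W.card) :
    ∃ v, ¬ (G.inducedOn {v}ᶜ).IsStrong := by
  obtain ⟨t, ht, hU⟩ := h.exists_threshold hlt
  obtain ⟨t', ht', hW⟩ := h.symm.exists_threshold (by omega)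
  rcases le_total t t' with hle | hle
  · exact ⟨f t, h.not_isStrong_of_le ht hle hU hW⟩
  · exact ⟨f t', h.symm.not_isStrong_of_le ht' hle hW hU⟩

end Twins

variable [Fintype V]

theorem Block.twins {k : ℕ} {S : Set V} (hb : G.Block m k f A S) (h : G.LongestSeq m f A) :
    G.Twins m k f (A \ S) S.toFinset (seg f k (m - k)) where
  cyc := h.cyc
  two_le := hb.two_le
  le := hb.lt.le
  nonempty := ⟨by simpa using hb.nonempty, f k, mem_seg_of le_rfl (by have := hb.lt; omega)⟩
  complete u hu v hv huv := hb.complete u (by simpa using hu) v (by simpa using hv) huv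
  complete' := hb.complete_seg
  nonadj u hu w hw := hb.nonadj u (by simpa using hu) w hw
  disjoint := (hb.disjoint_toFinset h _ _).symm
  disjoint_seg a n hn := ⟨hb.disjoint_toFinset h _ _,
    h.cyc.disjoint_seg (by omega) (by have := hb.lt; omega)⟩
  tight u hu := hb.tight u (by simpa using hu)
  tight' := hb.tight_seg
  notMem v hv := by
    refine ⟨by simpa using hv.2, fun h' => ?_, fun h' => ?_⟩ <;>
      obtain ⟨i, -, -, rfl⟩ := mem_seg.1 h' <;> exact h.notMem i hv.1
  cover v := by
    by_cases hv : v ∈ A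
    · by_cases hvS : v ∈ S <;> simp [hv, hvS]
    · have hv' := h.cyc.mem_seg_full (a := 0).2 (h.exists_of_notMem hv)
      rw [seg_split hb.lt.le, Finset.mem_union] at hv'
      tauto
  outer v hv u hu w hw := by
    rcases hb.outer v hv.1 hv.2 with h' | h'
    · simp [h'.1 u (by simpa using hu), h'.2 w hw]
    · simp [h'.1 u (by simpa using hu), h'.2 w hw]
  long p q Z hp hq := h.card_le hp hq
  lt := by
    have : 0 < S.toFinset.card := Finset.card_pos.2 (by simpa using hb.nonempty)
    have := hb.lt
    rw [h.card_seg_sub]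
    omega

/-- In the 2-strong case the components outside a longest cycle are single vertices. -/
theorem AllBlocks.eq_of_mem_comp (h : G.LongestSeq m f A) (hall : G.AllBlocks m f A)
    (hst : G.IsKStrong 2) {z w : V} (hz : z ∈ A) (hw : w ∈ G.comp A z) : w = z := by
  by_contra hne
  obtain ⟨t, k, hb⟩ := hall z hz
  have hS : 2 ≤ (G.comp A z).toFinset.card := by
    have : ({w, z} : Finset V) ⊆ (G.comp A z).toFinset := by
      intro v hv
      simp only [Finset.mem_insert, Finset.mem_singleton] at hv
      rw [Set.mem_toFinset]
      rcases hv with rfl | rfl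
      · exact hw
      · exact mem_comp_self A v
    have := Finset.card_le_card this
    rwa [Finset.card_pair hne] at this
  obtain ⟨v, hv⟩ := (hb.twins (h.rotate t)).not_isStrong (by
    have := hb.lt
    rw [(h.rotate t).card_seg_sub]
    omega)
  exact hv (hst.2 {v} (by simp))

theorem AllBlocks.isTransitiveTournament (h : G.LongestSeq m f A) (hall : G.AllBlocks m f A)
    (hst : G.IsKStrong 2) : (G.inducedOn A).IsTransitiveTournament := by
  have hadj : ∀ u ∈ A, ∀ v ∈ A, u ≠ v → G.Adjacent u v := by
    intro u hu v hv huv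
    obtain ⟨t, k, hb⟩ := hall u hu
    exact hb.adjacent (mem_comp_self A u) hv huv
  have hasymm : ∀ u ∈ A, ∀ v ∈ A, G.Reach A u v → G.Reach A v u → u = v :=
    fun u hu v hv h1 h2 => (hall.eq_of_mem_comp h hst hu ⟨h1, h2⟩).symm
  refine ⟨fun v => h.loopless v.1, ?_, ?_⟩
  · rintro ⟨u, hu⟩ ⟨v, hv⟩ hne
    have hne' : u ≠ v := fun e => hne (Subtype.ext e)
    have hno : ¬ (G.Adj u v ∧ G.Adj v u) := fun h' =>
      hne' (hasymm u hu v hv (.single hu hv h'.1) (.single hv hu h'.2))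
    have hor := hadj u hu v hv hne'
    change Xor (G.Adj u v) (G.Adj v u)
    unfold Adjacent at hor
    unfold Xor
    tauto
  · rintro ⟨u, hu⟩ ⟨v, hv⟩ ⟨w, hw⟩ h1 h2
    change G.Adj u w
    have h1 : G.Adj u v := h1
    have h2 : G.Adj v w := h2
    have r1 : G.Reach A u w := (Reach.single hu hv h1).tail ⟨h2, hv, hw⟩
    have huw : u ≠ w := by
      rintro rfl
      have := hasymm u hu v hv (.single hu hv h1) (.single hv hu h2)
      subst this
      exact h.loopless u h1
    exact (hadj u hu w hw huw).resolve_right fun h3 =>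
      huw (hasymm u hu w hw r1 (.single hw hu h3))

end

/-! ### Periodicity of the pattern of a tight vertex -/

section

variable {m : ℕ} {f : ℕ → V} {A : Set V}

/-- `w` cannot be inserted into the cycle `f`, but has the largest possible degree under this
restriction: for any two consecutive vertices exactly one of the two arcs needed for an insertion is
present. -/
def CycTight (G : Digraph V) (f : ℕ → V) (w : V) : Prop :=
  ∀ i, G.Adj (f i) w ↔ ¬ G.Adj w (f (i + 1))

theorem CycTight.adj_succ_iff {w : V} (hw : G.CycTight f w) (i : ℕ) :
    G.Adj w (f (i + 1)) ↔ ¬ G.Adj (f i) w := by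
  rw [hw i, not_not]

/-- Either `w` closes a path of `q` consecutive vertices of the cycle to a cycle, or the pattern of
the arcs from the cycle to `w` has period `q`. -/
theorem CycTight.closes_or_periodic {n q : ℕ} (hf : G.CyclicSeq n f) {w : V}
    (hw : G.CycTight f w) (hq : 1 ≤ q) :
    (∃ j, G.Adj w (f j) ∧ G.Adj (f (j + q - 1)) w) ∨
      ∀ i, G.Adj (f (i + q)) w ↔ G.Adj (f i) w := by
  by_cases hex : ∃ j, G.Adj w (f j) ∧ G.Adj (f (j + q - 1)) w
  · exact .inl hex
  right
  push Not at hex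
  have h1 : ∀ i, ¬ G.Adj (f i) w → ¬ G.Adj (f (i + q)) w := by
    intro i hi
    have := hex (i + 1) ((hw.adj_succ_iff i).2 hi)
    rwa [show i + 1 + q - 1 = i + q by omega] at this
  have h2 : ∀ i c, ¬ G.Adj (f i) w → ¬ G.Adj (f (i + q * c)) w := by
    intro i c hi
    induction c with
    | zero => simpa using hi
    | succ c ih =>
      have := h1 _ ih
      rwa [add_assoc, ← Nat.mul_succ] at this
  refine fun i => ⟨fun h => ?_, fun h => ?_⟩
  · by_contra hi
    exact h1 i hi h
  · by_contra hi
    have hp := hf.pos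
    -- going round the cycle by steps of length `q` leads back to `f i`
    have := h2 (i + q) (n - 1) hi
    rw [add_assoc, add_comm q, ← Nat.mul_succ, Nat.succ_eq_add_one, Nat.sub_add_cancel hp,
      mul_comm q, hf.per_mul] at this
    exact this h

theorem CyclicSeq.hasCycle_of_closes {n q : ℕ} (hf : G.CyclicSeq n f) {w : V}
    (hw : ∀ i, f i ≠ w) (hq : 1 ≤ q) (hqn : q ≤ n) {j : ℕ} (h1 : G.Adj w (f j))
    (h2 : G.Adj (f (j + q - 1)) w) : G.HasCycle (q + 1) := by
  have hp := hf.pathOn_seg' (a := j) (b := j + q - 1) (l := q) (by omega) hq hqn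
  have hn : w ∉ seg f j q := fun h => by
    obtain ⟨i, -, -, hi⟩ := mem_seg.1 h
    exact hw i hi
  have hc : (insert w (seg f j q)).card = q + 1 := by
    rw [Finset.card_insert_of_notMem hn, hf.card_seg j hqn]
  rw [← hc]
  exact (PathOn.cons h1 hp hn).hasCycle h2 (by omega)

theorem CyclicSeq.hasCycle_of_closes_pair {n q : ℕ} (hf : G.CyclicSeq n f) {w w' : V}
    (hw : ∀ i, f i ≠ w) (hw' : ∀ i, f i ≠ w') (hne : w ≠ w') (hww : G.Adj w w') (hq : 1 ≤ q)
    (hqn : q ≤ n) {j : ℕ} (h1 : G.Adj w' (f j)) (h2 : G.Adj (f (j + q - 1)) w) :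
    G.HasCycle (q + 2) := by
  have hp := hf.pathOn_seg' (a := j) (b := j + q - 1) (l := q) (by omega) hq hqn
  have hn' : w' ∉ seg f j q := fun h => by
    obtain ⟨i, -, -, hi⟩ := mem_seg.1 h
    exact hw' i hi
  have hn : w ∉ insert w' (seg f j q) := fun h => by
    rcases Finset.mem_insert.1 h with h | h
    · exact hne h
    · obtain ⟨i, -, -, hi⟩ := mem_seg.1 h
      exact hw i hi
  have hc : (insert w (insert w' (seg f j q))).card = q + 2 := by
    rw [Finset.card_insert_of_notMem hn, Finset.card_insert_of_notMem hn', hf.card_seg j hqn]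
  rw [← hc]
  exact (PathOn.cons hww (PathOn.cons h1 hp hn') hn).hasCycle h2 (by omega)

/-- Replacing the vertices from `f k` on by the single vertex `s`. -/
theorem CyclicSeq.shortcut {k : ℕ} (hf : G.CyclicSeq m f) (hk : 2 ≤ k) (hkm : k ≤ m) {s : V}
    (hs : ∀ i, f i ≠ s) (h1 : G.Adj (f (k - 1)) s) (h2 : G.Adj s (f 0)) :
    G.CyclicSeq (k + 1) fun i => if i % (k + 1) = k then s else f (i % (k + 1)) where
  two_le := by omega
  per i := by simp
  inj i hi j hj h := by
    rw [Nat.mod_eq_of_lt hi, Nat.mod_eq_of_lt hj] at h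
    split_ifs at h with ha hb hb
    · omega
    · exact absurd h.symm (hs _)
    · exact absurd h (hs _)
    · exact hf.inj i (by omega) j (by omega) h
  adj i := by
    have hlt := Nat.mod_lt i (show 0 < k + 1 by omega)
    have hsucc : (i + 1) % (k + 1) = if i % (k + 1) = k then 0 else i % (k + 1) + 1 := by
      rw [Nat.add_mod, Nat.mod_eq_of_lt (show 1 < k + 1 by omega)]
      split_ifs with h
      · rw [h, Nat.mod_self]
      · exact Nat.mod_eq_of_lt (by omega)
    rw [hsucc]
    split_ifs with ha hb hb
    · omega
    · exact h2
    · rwa [show i % (k + 1) = k - 1 by omega]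
    · exact hf.adj _

/-- From tightness with respect to the cycle without one vertex to tightness with respect to the
whole cycle. -/
theorem CyclicSeq.cycTight {g : ℕ → V} (hg : G.CyclicSeq m g) (hm : 3 ≤ m) {w : V}
    (ht : G.Tight (m - 1) g w) (h1 : ¬ G.Adj (g (m - 1)) w) (h2 : ¬ G.Adj w (g (m - 1))) :
    G.CycTight g w := by
  have key : ∀ i < m, G.Adj (g i) w ↔ ¬ G.Adj w (g (i + 1)) := by
    intro i hi
    by_cases ha : i + 1 < m - 1
    · exact ht.2.2 i ha
    · by_cases hb : i = m - 1
      · subst hb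
        have := hg.per 0
        rw [zero_add] at this
        rw [Nat.sub_add_cancel (by omega), this]
        simp [h1, ht.1]
      · obtain rfl : i = m - 1 - 1 := by omega
        rw [Nat.sub_add_cancel (by omega)]
        simp [h2, ht.2.1]
  intro i
  rw [← hg.apply_mod i, ← hg.apply_mod (i + 1), ← Nat.mod_add_mod, hg.apply_mod (i % m + 1)]
  exact key _ (Nat.mod_lt _ hg.pos)

variable [Fintype V]

/-- If the segment of a block has at least two vertices, there are cycles of all lengths up to `m`:
if `f k` closes no cycle of length `r` with consecutive vertices of the path and one vertex of the
component, then it closes one of length `r - 1`, in which `f k, f (k + 1)` can take its place. -/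
theorem Block.hasCycle_of_two_le {k : ℕ} {S : Set V} (hb : G.Block m k f A S)
    (h : G.LongestSeq m f A) (hg : k + 2 ≤ m) {r : ℕ} (h2 : 2 ≤ r) (hr : r ≤ m) :
    G.HasCycle r := by
  have hk := hb.two_le
  rcases lt_or_ge k r with hkr | hkr
  · have hp := h.cyc.pathOn_seg' (a := 0) (b := r - 1) (l := r) (by omega) (by omega) hr
    have := hp.hasCycle (hb.tight_seg _ (mem_seg_of (by omega) (by omega))).1
      (by rwa [h.cyc.card_seg _ hr])
    rwa [h.cyc.card_seg _ hr] at this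
  obtain ⟨s, hs⟩ := hb.nonempty
  have hsA := hb.subset hs
  have hts := hb.tight s hs
  have hw : f k ∈ seg f k (m - k) := mem_seg_of le_rfl (by omega)
  have hw' : f (k + 1) ∈ seg f k (m - k) := mem_seg_of (by omega) (by omega)
  have htw := hb.tight_seg _ hw
  have htw' := hb.tight_seg _ hw'
  have hne : f k ≠ f (k + 1) := fun e => by
    have := h.cyc.eq_of_lt e (by omega) (by omega)
    omega
  have htwins := (hb.twins h).symm
  set F : ℕ → V := fun i => if i % (k + 1) = k then s else f (i % (k + 1)) with hF
  have hcyc : G.CyclicSeq (k + 1) F :=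
    h.cyc.shortcut hk hb.lt.le (h.notMem_of_mem hsA) hts.2.1 hts.1
  have hFne : ∀ b, k ≤ b → b < m → ∀ i, F i ≠ f b := by
    intro b hkb hbm i
    have hlt := Nat.mod_lt i (show 0 < k + 1 by omega)
    simp only [hF]
    split_ifs with hi
    · exact (h.notMem_of_mem hsA b).symm
    · intro e
      have := h.cyc.eq_of_lt e (by omega) (by omega)
      omega
  have hnon := hb.nonadj s hs _ hw
  have hct : G.CycTight F (f k) := by
    intro i
    have hlt := Nat.mod_lt i (show 0 < k + 1 by omega)
    have hsucc : (i + 1) % (k + 1) = if i % (k + 1) = k then 0 else i % (k + 1) + 1 := by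
      rw [Nat.add_mod, Nat.mod_eq_of_lt (show 1 < k + 1 by omega)]
      split_ifs with h
      · rw [h, Nat.mod_self]
      · exact Nat.mod_eq_of_lt (by omega)
    simp only [hF, hsucc]
    by_cases hik : i % (k + 1) = k
    · simp only [hik, if_true]
      rw [if_neg (by omega)]
      simp [hnon.1, htw.1]
    · simp only [hik, if_false]
      by_cases hik' : i % (k + 1) + 1 = k
      · simp only [hik', if_true]
        rw [show i % (k + 1) = k - 1 by omega]
        simp [hnon.2, htw.2.1]
      · simp only [hik', if_false]
        exact htw.2.2 _ (by omega)
  have hout : ∀ j < k, G.Adj (f k) (f j) → G.Adj (f (k + 1)) (f j) := by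
    intro j hj hadj
    rcases j with _ | j
    · exact htw'.1
    · by_contra hcon
      exact (htw.2.2 j hj).1 ((htwins.adj_iff hw' hw (by omega)).1 ((htw'.2.2 j hj).2 hcon)) hadj
  have hnonconst : ¬ ∀ i, G.Adj (F (i + 1)) (f k) ↔ G.Adj (F i) (f k) := by
    intro hcon
    have := hcon (k - 1)
    rw [Nat.sub_add_cancel (by omega)] at this
    have e1 : F k = s := by simp [hF]
    have e2 : F (k - 1) = f (k - 1) := by
      simp only [hF, Nat.mod_eq_of_lt (show k - 1 < k + 1 by omega)]
      rw [if_neg (by omega)]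
    rw [e1, e2] at this
    exact hnon.1 (this.2 htw.2.1)
  obtain ⟨q, rfl⟩ : ∃ q, r = q + 1 := ⟨r - 1, by omega⟩
  rcases hct.closes_or_periodic hcyc (q := q) (by omega) with ⟨j, h3, h4⟩ | hper
  · exact hcyc.hasCycle_of_closes (hFne k le_rfl hb.lt) (by omega) (by omega) h3 h4
  obtain ⟨q, rfl⟩ : ∃ p, q = p + 1 := ⟨q - 1, by omega⟩
  rcases Nat.eq_zero_or_pos q with rfl | hq
  · exact absurd hper hnonconst
  rcases hct.closes_or_periodic hcyc (q := q) hq with ⟨j, h3, h4⟩ | hper'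
  · -- replace one vertex of the segment by two in a cycle of length `q + 1`
    refine hcyc.hasCycle_of_closes_pair (hFne k le_rfl hb.lt) (hFne (k + 1) (by omega) (by omega))
      hne (hb.complete_seg _ hw _ hw' hne) hq (by omega) ?_ h4
    have hlt := Nat.mod_lt j (show 0 < k + 1 by omega)
    simp only [hF] at h3 ⊢
    split_ifs with hj
    · rw [if_pos hj] at h3
      exact absurd h3 hnon.2
    · rw [if_neg hj] at h3
      exact hout _ (by omega) h3
  · refine absurd (fun i => ?_) hnonconst
    rw [← hper' (i + 1), ← hper i, add_right_comm, add_assoc]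

theorem LongestSeq.periodic (h : G.LongestSeq m f A) {w : V} (hw : w ∈ A) (ht : G.CycTight f w)
    {q : ℕ} (hq : 1 ≤ q) (hqm : q ≤ m) (hno : ¬ G.HasCycle (q + 1)) (i : ℕ) :
    G.Adj (f (i + q)) w ↔ G.Adj (f i) w := by
  rcases ht.closes_or_periodic h.cyc hq with ⟨j, h1, h2⟩ | hp
  · exact absurd (h.cyc.hasCycle_of_closes (h.notMem_of_mem hw) hq hqm h1 h2) hno
  · exact hp i

/-- A vertex outside a longest cycle can take the place of a vertex of the cycle. -/
theorem LongestSeq.replace (h : G.LongestSeq m f A) {z : V} (hz : z ∈ A) {i : ℕ}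
    (h1 : G.Adj (f i) z) (h2 : G.Adj z (f (i + 2))) :
    G.LongestSeq m (fun j => if j ≡ i + 1 [MOD m] then z else f j)
      (Set.range fun j => if j ≡ i + 1 [MOD m] then z else f j)ᶜ where
  loopless := h.loopless
  cyc := by
    refine ⟨h.cyc.two_le, fun j => ?_, fun a ha b hb hab => ?_, fun j => ?_⟩
    · have : (j + m ≡ i + 1 [MOD m]) ↔ (j ≡ i + 1 [MOD m]) := by
        rw [Nat.ModEq, Nat.add_mod_right, Nat.ModEq]
      simp only [this, h.cyc.per]
    · split_ifs at hab with ha' hb' hb'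
      · have := ha'.trans hb'.symm
        rwa [Nat.ModEq, Nat.mod_eq_of_lt ha, Nat.mod_eq_of_lt hb] at this
      · exact absurd hab.symm (h.notMem_of_mem hz _)
      · exact absurd hab (h.notMem_of_mem hz _)
      · exact h.cyc.inj a ha b hb hab
    · have hm := h.cyc.two_le
      split_ifs with ha hb hb
      · have := Nat.ModEq.add_left_cancel' j ((hb.trans ha.symm).trans (by rw [add_zero]) :
          j + 1 ≡ j + 0 [MOD m])
        rw [Nat.ModEq, Nat.zero_mod, Nat.mod_eq_of_lt (by omega)] at this
        omega
      · have : f (j + 1) = f (i + 2) := by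
          rw [← h.cyc.apply_mod, ha.add_right 1, h.cyc.apply_mod]
        rwa [this]
      · have : f j = f i := by
          rw [← h.cyc.apply_mod, Nat.ModEq.add_right_cancel' 1 hb, h.cyc.apply_mod]
        rwa [this]
      · exact h.cyc.adj j
  max := h.max
  compl := rfl
  ore := h.ore

/-- A tight vertex `z` outside the cycle with `f i → z` and `¬ f (i + 1) → z` gives a block whose
segment is the single vertex `f (i + 1)`. -/
theorem LongestSeq.block_single (h : G.LongestSeq m f A) (hm : 3 ≤ m) {z : V} (hz : z ∈ A)
    (ht : G.CycTight f z) {i : ℕ} (h1 : G.Adj (f i) z) (h2 : ¬ G.Adj (f (i + 1)) z) :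
    G.Block m (m - 1) (fun j => f (j + (i + 2))) A (G.comp A z) := by
  have h3 : G.Adj z (f (i + 2)) := (ht.adj_succ_iff (i + 1)).2 h2
  have hy : ∀ y ∈ seg (fun j => f (j + (i + 2))) (m - 1) (m - (m - 1)), y = f (i + 1) := by
    intro y hy
    obtain ⟨j, h3, h4, rfl⟩ := mem_seg.1 hy
    rw [show j + (i + 2) = i + 1 + m by omega, h.cyc.per]
  refine (h.rotate (i + 2)).block_of_minimal hz (by omega) (by omega) ?_ ?_ ?_ ?_
  · rw [show m - 1 - 1 + (i + 2) = i + m by omega, h.cyc.per]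
    exact ⟨z, hz, h1, .refl⟩
  · exact ⟨z, hz, .refl, by simpa using h3⟩
  · intro y hy' hE
    rw [hy y hy'] at hE
    exact h.not_enters_leaves hE ⟨z, hz, .refl, h3⟩
  · intro y hy' hL
    rw [hy y hy'] at hL
    exact h.not_enters_leaves ⟨z, hz, h1, .refl⟩ hL

theorem LongestSeq.mem_seg_single {i : ℕ} (h : G.LongestSeq m f A) (hm : 3 ≤ m) :
    f (i + 1) ∈ seg (fun j => f (j + (i + 2))) (m - 1) (m - (m - 1)) := by
  refine mem_seg.2 ⟨m - 1, le_rfl, by omega, ?_⟩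
  rw [show m - 1 + (i + 2) = i + 1 + m by omega, h.cyc.per]

/-- In the situation of `LongestSeq.block_single`, the vertices `z` and `f (i + 1)` can be
interchanged, and afterwards the latter is tight. -/
theorem LongestSeq.exchange (h : G.LongestSeq m f A) (hm : 3 ≤ m) {z : V} (hz : z ∈ A)
    (ht : G.CycTight f z) {i : ℕ} (h1 : G.Adj (f i) z) (h2 : ¬ G.Adj (f (i + 1)) z) :
    G.CycTight f (f (i + 1)) ∧ ∃ (f' : ℕ → V) (A' : Set V), G.LongestSeq m f' A' ∧
      f (i + 1) ∈ A' ∧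
      ∀ j, (G.Adj (f' j) (f (i + 1)) ↔ G.Adj (f j) (f (i + 1))) ∧
        (G.Adj (f (i + 1)) (f' j) ↔ G.Adj (f (i + 1)) (f j)) := by
  have hb := h.block_single hm hz ht h1 h2
  have hmem := h.mem_seg_single (i := i) hm
  have h3 : G.Adj z (f (i + 2)) := (ht.adj_succ_iff (i + 1)).2 h2
  have hnon := hb.nonadj z (mem_comp_self A z) _ hmem
  have hlast : f (m - 1 + (i + 2)) = f (i + 1) := by
    rw [show m - 1 + (i + 2) = i + 1 + m by omega, h.cyc.per]
  have ht' := (h.cyc.rotate (i + 2)).cycTight hm (hb.tight_seg _ hmem)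
    (by rw [hlast]; exact h.loopless _) (by rw [hlast]; exact h.loopless _)
  refine ⟨fun j => ?_, _, _, h.replace hz h1 h3, ?_, fun j => ?_⟩
  · obtain ⟨j', h4, h5, h6⟩ := h.cyc.exists_window (i + 2) j
    have := ht' (j' - (i + 2))
    simp only at this
    rw [show j' - (i + 2) + 1 + (i + 2) = j' + 1 by omega,
      show j' - (i + 2) + (i + 2) = j' by omega] at this
    have h7 : f (j' + 1) = f (j + 1) := by
      rw [← h.cyc.apply_mod, (h.cyc.modEq_of_eq h6).add_right 1, h.cyc.apply_mod]
    rwa [h6, h7] at this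
  · rintro ⟨j, hj⟩
    simp only at hj
    split_ifs at hj with hij
    · exact h.notMem_of_mem hz _ hj.symm
    · exact hij (h.cyc.modEq_of_eq hj)
  · split_ifs with hij
    · have : f j = f (i + 1) := by rw [← h.cyc.apply_mod, hij, h.cyc.apply_mod]
      rw [this]
      simp [hnon, h.loopless (f (i + 1))]
    · simp

end

/-! ### Alternating patterns -/

section

variable {m : ℕ} {f : ℕ → V} {A : Set V} [Fintype V]

namespace LongestSeq

variable {z : V} {q : ℕ}

theorem cycTight_and_periodic (h : G.LongestSeq m f A) (hm : 3 ≤ m) (hz : z ∈ A)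
    (ht : G.CycTight f z) (hq : 1 ≤ q) (hqm : q ≤ m) (hno : ¬ G.HasCycle (q + 1)) {i : ℕ}
    (h1 : G.Adj (f i) z) (h2 : ¬ G.Adj (f (i + 1)) z) :
    G.CycTight f (f (i + 1)) ∧ ∀ j, G.Adj (f (j + q)) (f (i + 1)) ↔ G.Adj (f j) (f (i + 1)) := by
  obtain ⟨ht', f', A', h', hA', hiff⟩ := h.exchange hm hz ht h1 h2
  refine ⟨ht', fun j => ?_⟩
  have ht'' : G.CycTight f' (f (i + 1)) := fun j => by rw [(hiff j).1, (hiff (j + 1)).2, ht' j]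
  rw [← (hiff (j + q)).1, ← (hiff j).1]
  exact h'.periodic hA' ht'' hq hqm hno j

/-- A cycle that uses `z` to jump over `f (i + 1)` and `f (i + 2)` and then one of these two vertices
for a second jump. -/
theorem hasCycle_of_two_jumps (h : G.LongestSeq m f A) (hz : z ∈ A) {i n c : ℕ} (hqm : q + 1 ≤ m)
    (hn : 1 ≤ n) (hnq : n + 2 ≤ q) (hc : i < c) (hc' : c < i + 3) (h1 : G.Adj (f i) z)
    (h2 : G.Adj z (f (i + 3))) (h3 : G.Adj (f (i + 2 + n)) (f c))
    (h4 : G.Adj (f c) (f (i + 2 + n + m - q))) : G.HasCycle (q + 1) := by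
  have p1 := h.cyc.pathOn_seg' (a := i + 3) (b := i + 2 + n) (l := n) (by omega) hn (by omega)
  have p2 := h.cyc.pathOn_seg' (a := i + 2 + n + m - q) (b := i + m) (l := q - 1 - n) (by omega)
    (by omega) (by omega)
  have d2 : f c ∉ seg f (i + 2 + n + m - q) (q - 1 - n) := h.cyc.notMem_seg (by omega) (by omega)
  have d1 : f c ∉ seg f (i + 3) n := h.cyc.notMem_seg (by omega) (by omega)
  have d12 : Disjoint (seg f (i + 3) n) (seg f (i + 2 + n + m - q) (q - 1 - n)) :=
    h.cyc.disjoint_seg (by omega) (by omega)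
  have e := Finset.disjoint_insert_right.2 ⟨d1, d12⟩
  have p := p1.append h3 (PathOn.cons h4 p2 d2) e
  have hzn : z ∉ seg f (i + 3) n ∪ insert (f c) (seg f (i + 2 + n + m - q) (q - 1 - n)) := by
    have hzs : ∀ a l, z ∉ seg f a l := fun a l hzs => by
      obtain ⟨j, -, -, hj⟩ := mem_seg.1 hzs
      exact h.notMem_of_mem hz j hj
    simp [hzs, (h.notMem_of_mem hz c).symm]
  have hcard : (insert z (seg f (i + 3) n ∪
      insert (f c) (seg f (i + 2 + n + m - q) (q - 1 - n)))).card = q + 1 := by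
    rw [Finset.card_insert_of_notMem hzn, Finset.card_union_of_disjoint e,
      Finset.card_insert_of_notMem d2, h.cyc.card_seg _ (by omega), h.cyc.card_seg _ (by omega)]
    omega
  rw [← hcard]
  exact (PathOn.cons h2 p hzn).hasCycle (by rwa [h.cyc.per]) (by omega)

/-- If there is no cycle of length `q + 1`, the second jump of `hasCycle_of_two_jumps` is
impossible. -/
theorem not_second_jump (h : G.LongestSeq m f A) (hz : z ∈ A) (ht : G.CycTight f z)
    (hqm : q + 1 ≤ m) (hno : ¬ G.HasCycle (q + 1)) {i n c : ℕ} (hn : 1 ≤ n) (hnq : n + 2 ≤ q)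
    (hc : i < c) (hc' : c < i + 3) (h1 : G.Adj (f i) z) (h2 : ¬ G.Adj (f (i + 2)) z)
    (hct : G.CycTight f (f c)) (hper : ∀ j, G.Adj (f (j + q)) (f c) ↔ G.Adj (f j) (f c))
    (h3 : G.Adj (f (i + 2 + n)) (f c)) : G.Adj (f (i + 1 + n)) (f c) := by
  by_contra h4
  refine hno (h.hasCycle_of_two_jumps hz hqm hn hnq hc hc' h1 ((ht.adj_succ_iff (i + 2)).2 h2)
    h3 ?_)
  rw [show i + 2 + n + m - q = (i + 1 + n + m - q) + 1 by omega, hct.adj_succ_iff, ← hper,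
    show i + 1 + n + m - q + q = i + 1 + n + m by omega, h.cyc.per]
  exact h4

/-- The pattern yes, yes, no does not occur among the arcs from consecutive vertices of the cycle to
`z`. It would rule out second jumps to such an extent that `f (i + 2)` is dominated only by every
`q`-th vertex of the cycle, starting from `f (i + 1)`; the same holds for `f (i + q + 2)`, and there
is a cycle of length `q + 1` through these two vertices. -/
theorem adj_of_adj_of_adj (h : G.LongestSeq m f A) (hm : 3 ≤ m) (hz : z ∈ A)
    (ht : G.CycTight f z) (hq : 1 ≤ q) (hqm : q + 1 ≤ m) (hno : ¬ G.HasCycle (q + 1)) {i : ℕ}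
    (h0 : G.Adj (f i) z) (h1 : G.Adj (f (i + 1)) z) : G.Adj (f (i + 2)) z := by
  by_contra h2
  have hperz := h.periodic hz ht hq (by omega) hno
  have hq3 : 3 ≤ q := by
    by_contra hq3
    obtain rfl | rfl : q = 1 ∨ q = 2 := by omega
    · exact h2 ((hperz (i + 1)).2 h1)
    · exact h2 ((hperz i).2 h0)
  -- the pattern of the vertex `f (j + 2)` wherever `z` has the pattern yes, yes, no
  have hpat : ∀ j, G.Adj (f j) z → G.Adj (f (j + 1)) z → ¬ G.Adj (f (j + 2)) z →
      G.CycTight f (f (j + 2)) ∧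
      (∀ l, G.Adj (f (l + q)) (f (j + 2)) ↔ G.Adj (f l) (f (j + 2))) ∧
      ∀ n, n + 2 ≤ q → ¬ G.Adj (f (j + 2 + n)) (f (j + 2)) := by
    intro j hj0 hj1 hj2
    obtain ⟨hct, hper⟩ := h.cycTight_and_periodic hm hz ht hq (by omega) hno hj1 hj2
    refine ⟨hct, hper, fun n => ?_⟩
    induction n with
    | zero => exact fun _ => h.loopless _
    | succ n ih =>
      intro hn h3
      have := h.not_second_jump hz ht hqm hno (n := n + 1) (by omega) hn (by omega) (by omega)
        hj0 hj2 hct hper h3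
      rw [show j + 1 + (n + 1) = j + 2 + n by omega] at this
      exact ih (by omega) this
  obtain ⟨hct, hper, hzero⟩ := hpat i h0 h1 h2
  obtain ⟨hct', -, hzero'⟩ := hpat (i + q) ((hperz i).2 h0)
    (by rw [show i + q + 1 = i + 1 + q by omega]; exact (hperz _).2 h1)
    (by rw [show i + q + 2 = i + 2 + q by omega]; exact fun h' => h2 ((hperz _).1 h'))
  have hone : G.Adj (f (i + 1)) (f (i + 2)) := h.cyc.adj (i + 1)
  have h2q : 2 * q ≤ m := by
    by_contra hlt
    have e1 : G.Adj (f (i + 2 + (m - q - 1) + q)) (f (i + 2)) := by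
      rw [show i + 2 + (m - q - 1) + q = i + 1 + m by omega, h.cyc.per]
      exact hone
    exact hzero _ (by omega) ((hper _).1 e1)
  have a1 : G.Adj (f (i + 2)) (f (i + q + 1)) := by
    rw [hct.adj_succ_iff]
    have := hzero (q - 2) (by omega)
    rwa [show i + 2 + (q - 2) = i + q by omega] at this
  have a2 : G.Adj (f (i + q + 2)) (f (i + q + 4)) := by
    rw [show i + q + 4 = i + q + 3 + 1 by omega, hct'.adj_succ_iff]
    exact hzero' 1 (by omega)
  have a3 : G.Adj (f (i + 2 * q + 1)) (f (i + 2)) := by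
    rw [show i + 2 * q + 1 = i + 1 + q + q by omega]
    exact (hper _).2 ((hper _).2 hone)
  have p1 := h.cyc.pathOn_seg' (a := i + q + 1) (b := i + q + 2) (l := 2) (by omega) (by omega)
    (by omega)
  have p2 := h.cyc.pathOn_seg' (a := i + q + 4) (b := i + 2 * q + 1) (l := q - 2) (by omega)
    (by omega) (by omega)
  have d : Disjoint (seg f (i + q + 1) 2) (seg f (i + q + 4) (q - 2)) :=
    h.cyc.disjoint_seg (by omega) (by omega)
  have hn : f (i + 2) ∉ seg f (i + q + 1) 2 ∪ seg f (i + q + 4) (q - 2) := by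
    rw [Finset.mem_union, not_or]
    exact ⟨h.cyc.notMem_seg (by omega) (by omega), h.cyc.notMem_seg (by omega) (by omega)⟩
  have hcard : (insert (f (i + 2)) (seg f (i + q + 1) 2 ∪ seg f (i + q + 4) (q - 2))).card
      = q + 1 := by
    rw [Finset.card_insert_of_notMem hn, Finset.card_union_of_disjoint d,
      h.cyc.card_seg _ (by omega), h.cyc.card_seg _ (by omega)]
    omega
  refine hno ?_
  rw [← hcard]
  exact (PathOn.cons a1 (p1.append a2 p2 d) hn).hasCycle a3 (by omega)

/-- The pattern yes, no, no does not occur either: `f (i + 1)` would be dominated by all the vertices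
of the cycle except every `q`-th one, and so would `f (i + q + 1)`. -/
theorem adj_of_adj_of_not_adj (h : G.LongestSeq m f A) (hm : 3 ≤ m) (hz : z ∈ A)
    (ht : G.CycTight f z) (hq : 1 ≤ q) (hqm : q + 1 ≤ m) (hno : ¬ G.HasCycle (q + 1)) {i : ℕ}
    (h0 : G.Adj (f i) z) (h1 : ¬ G.Adj (f (i + 1)) z) : G.Adj (f (i + 2)) z := by
  by_contra h2
  have hperz := h.periodic hz ht hq (by omega) hno
  have hq3 : 3 ≤ q := by
    by_contra hq3
    obtain rfl | rfl : q = 1 ∨ q = 2 := by omega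
    · exact h1 ((hperz i).2 h0)
    · exact h2 ((hperz i).2 h0)
  have hpat : ∀ j, G.Adj (f j) z → ¬ G.Adj (f (j + 1)) z → ¬ G.Adj (f (j + 2)) z →
      (∀ l, G.Adj (f (l + q)) (f (j + 1)) ↔ G.Adj (f l) (f (j + 1))) ∧
      G.CycTight f (f (j + 1)) ∧
      ∀ n, n + 2 ≤ q → G.Adj (f (j + q - n)) (f (j + 1)) := by
    intro j hj0 hj1 hj2
    obtain ⟨hct, hper⟩ := h.cycTight_and_periodic hm hz ht hq (by omega) hno hj0 hj1
    refine ⟨hper, hct, fun n => ?_⟩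
    induction n with
    | zero => exact fun _ => (hper j).2 (h.cyc.adj j)
    | succ n ih =>
      intro hn
      have := h.not_second_jump hz ht hqm hno (n := q - 2 - n) (c := j + 1) (by omega) (by omega)
        (by omega) (by omega) hj0 hj2 hct hper
        (by rw [show j + 2 + (q - 2 - n) = j + q - n by omega]; exact ih (by omega))
      rwa [show j + 1 + (q - 2 - n) = j + q - (n + 1) by omega] at this
  obtain ⟨hper, hct, hone⟩ := hpat i h0 h1 h2
  obtain ⟨hper', hct', hone'⟩ := hpat (i + q) ((hperz i).2 h0)
    (by rw [show i + q + 1 = i + 1 + q by omega]; exact fun h' => h1 ((hperz _).1 h'))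
    (by rw [show i + q + 2 = i + 2 + q by omega]; exact fun h' => h2 ((hperz _).1 h'))
  have h2q : 2 * q ≤ m := by
    by_contra hlt
    have e1 : G.Adj (f (i + q - (q - (m - q) - 1) + q)) (f (i + 1)) :=
      (hper _).2 (hone _ (by omega))
    rw [show i + q - (q - (m - q) - 1) + q = i + 1 + m by omega, h.cyc.per] at e1
    exact h.loopless _ e1
  have a1 : G.Adj (f (i + 2)) (f (i + q + 1)) := by
    rw [← hper']
    have := hone' (q - 2) (by omega)
    rwa [show i + q + q - (q - 2) = i + 2 + q by omega] at this
  have a2 : G.Adj (f (i + 2 * q - 1)) (f (i + 1)) := by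
    have := (hper _).2 (hone 1 (by omega))
    rwa [show i + q - 1 + q = i + 2 * q - 1 by omega] at this
  have p1 := h.cyc.pathOn_seg' (a := i + 1) (b := i + 2) (l := 2) (by omega) (by omega) (by omega)
  have p2 := h.cyc.pathOn_seg' (a := i + q + 1) (b := i + 2 * q - 1) (l := q - 1) (by omega)
    (by omega) (by omega)
  have d : Disjoint (seg f (i + 1) 2) (seg f (i + q + 1) (q - 1)) :=
    h.cyc.disjoint_seg (by omega) (by omega)
  have hcard : (seg f (i + 1) 2 ∪ seg f (i + q + 1) (q - 1)).card = q + 1 := by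
    rw [Finset.card_union_of_disjoint d, h.cyc.card_seg _ (by omega), h.cyc.card_seg _ (by omega)]
    omega
  refine hno ?_
  rw [← hcard]
  exact (p1.append a1 p2 d).hasCycle a2 (by omega)

/-- If there is no cycle of length `q + 1`, every second vertex of the cycle dominates `z`. -/
theorem alternating (h : G.LongestSeq m f A) (hm : 3 ≤ m) (hz : z ∈ A) (ht : G.CycTight f z)
    (hq : 1 ≤ q) (hqm : q + 1 ≤ m) (hno : ¬ G.HasCycle (q + 1)) {i : ℕ}
    (h0 : G.Adj (f i) z) (h1 : ¬ G.Adj (f (i + 1)) z) (n : ℕ) :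
    G.Adj (f (i + 2 * n)) z ∧ ¬ G.Adj (f (i + 2 * n + 1)) z := by
  have hrun : ∀ j, ¬ (G.Adj (f j) z ∧ G.Adj (f (j + 1)) z) := by
    rintro j ⟨h2, h3⟩
    have hall : ∀ n, G.Adj (f (j + n)) z ∧ G.Adj (f (j + n + 1)) z := by
      intro n
      induction n with
      | zero => exact ⟨h2, h3⟩
      | succ n ih => exact ⟨ih.2, h.adj_of_adj_of_adj hm hz ht hq hqm hno ih.1 ih.2⟩
    obtain ⟨l, h4, -, h5⟩ := h.cyc.exists_window j (i + 1)
    have := (hall (l - j)).1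
    rw [Nat.add_sub_cancel' h4, h5] at this
    exact h1 this
  induction n with
  | zero => exact ⟨h0, h1⟩
  | succ n ih =>
    have h2 := h.adj_of_adj_of_not_adj hm hz ht hq hqm hno ih.1 ih.2
    exact ⟨h2, fun h3 => hrun _ ⟨h2, h3⟩⟩

/-- If some cycle length is missing, then `z` and the odd vertices of the cycle have the even ones as
in- and out-neighbours on the cycle, up to a rotation. -/
theorem bipartite_pattern (h : G.LongestSeq m f A) (hm : 3 ≤ m) (hz : z ∈ A)
    (ht : G.CycTight f z) (hq : 1 ≤ q) (hqm : q + 1 ≤ m) (hno : ¬ G.HasCycle (q + 1))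
    (h0 : G.Adj (f 0) z) (h1 : ¬ G.Adj (f 1) z) :
    Even m ∧ Even q ∧ ∀ w, w = z ∨ (∃ n, w = f (2 * n + 1)) → ∀ j,
      (G.Adj (f j) w ↔ Even j) ∧ (G.Adj w (f j) ↔ Even j) := by
  have halt := h.alternating hm hz ht hq hqm hno (i := 0) h0 h1
  simp only [zero_add] at halt
  have hiff : ∀ j, G.Adj (f j) z ↔ Even j := by
    intro j
    rcases Nat.even_or_odd' j with ⟨n, rfl | rfl⟩
    · simp [(halt n).1]
    · simp [(halt n).2]
  have hme : Even m := by
    rw [← hiff, ← zero_add m, h.cyc.per]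
    exact h0
  have hqe : Even q := by
    rw [← hiff, ← zero_add q, h.periodic hz ht hq (by omega) hno]
    exact h0
  refine ⟨hme, hqe, ?_⟩
  have hback : ∀ w, G.CycTight f w → (∀ j, G.Adj (f j) w ↔ Even j) → ∀ j,
      (G.Adj (f j) w ↔ Even j) ∧ (G.Adj w (f j) ↔ Even j) := by
    intro w hw hin j
    refine ⟨hin j, ?_⟩
    rw [← h.cyc.per, show j + m = j + (m - 1) + 1 by omega, hw.adj_succ_iff, hin]
    have : Odd (m - 1) := Nat.Even.sub_odd (by omega) hme odd_one
    rw [Nat.even_add, ← Nat.not_odd_iff_even (n := m - 1)]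
    tauto
  rintro w (rfl | ⟨n, rfl⟩)
  · exact hback w ht hiff
  have hn0 := (halt n).1
  have hn1 := (halt n).2
  obtain ⟨hct, f', A', h', hA', hiff'⟩ := h.exchange hm hz ht hn0 hn1
  refine hback _ hct fun j => ?_
  have ht' : G.CycTight f' (f (2 * n + 1)) := fun j => by
    rw [(hiff' j).1, (hiff' (j + 1)).2, hct j]
  have halt' := h'.alternating hm hA' ht' hq hqm hno (i := 2 * n)
    ((hiff' _).1.2 (h.cyc.adj _)) (fun h'' => h.loopless _ ((hiff' _).1.1 h''))
  -- shift `j` beyond `2 * n` by a multiple of the even number `m`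
  obtain ⟨j', hj1, -, hj2⟩ := h.cyc.exists_window (2 * n) j
  have hpar : Even j' ↔ Even j := by
    have h3 := (h.cyc.modEq_of_eq hj2).of_dvd hme.two_dvd
    rw [Nat.even_iff, Nat.even_iff, h3]
  rw [← hj2, ← hpar]
  obtain ⟨c, rfl⟩ := Nat.exists_eq_add_of_le hj1
  rcases Nat.even_or_odd' c with ⟨d, rfl | rfl⟩
  · simp [← (hiff' _).1, (halt' d).1, Nat.even_add]
  · have := (halt' d).2
    rw [(hiff' _).1, add_assoc] at this
    simp [this, Nat.even_add, parity_simps]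

end LongestSeq

end

/-! ### The exceptional bipartite digraph -/

section

variable {m : ℕ} {f : ℕ → V} {A : Set V}

/-- In the situation of `LongestSeq.bipartite_pattern` two even vertices of the cycle are not
joined by an arc, as it would close a cycle of the missing length. -/
theorem CyclicSeq.not_adj_even {q : ℕ} (hf : G.CyclicSeq m f) (hm : Even m) (hq : Even q)
    (hqm : q + 1 < m) (hq2 : 2 ≤ q) (hno : ¬ G.HasCycle (q + 1))
    (hpat : ∀ n j, (G.Adj (f j) (f (2 * n + 1)) ↔ Even j) ∧
      (G.Adj (f (2 * n + 1)) (f j) ↔ Even j))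
    {i j : ℕ} (hi : Even i) (hj : Even j) (hij : f i ≠ f j) : ¬ G.Adj (f i) (f j) := by
  intro hadj
  obtain ⟨i', h1, h2, h3⟩ := hf.exists_window j i
  have hi' : Even i' := by
    have h4 := (hf.modEq_of_eq h3).of_dvd hm.two_dvd
    rw [Nat.even_iff] at hi ⊢
    rw [h4, hi]
  rw [← h3] at hij hadj
  clear h3 hi i
  have hne : i' ≠ j := fun e => hij (by rw [e])
  obtain ⟨a, rfl⟩ := hj.exists_two_nsmul
  obtain ⟨b, rfl⟩ := hi'.exists_two_nsmul
  obtain ⟨s, rfl⟩ := hq.exists_two_nsmul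
  obtain ⟨c, rfl⟩ := hm.exists_two_nsmul
  simp only [smul_eq_mul] at *
  refine hno ?_
  by_cases hδ : 2 * a + 2 * s ≤ 2 * b
  · have p := hf.pathOn_seg' (a := 2 * a) (b := 2 * (a + s - 1) + 1) (l := 2 * s) (by omega)
      (by omega) (by omega)
    have hn : f (2 * b) ∉ seg f (2 * a) (2 * s) := hf.notMem_seg' (by omega) (by omega)
    have hcard : (insert (f (2 * b)) (seg f (2 * a) (2 * s))).card = 2 * s + 1 := by
      rw [Finset.card_insert_of_notMem hn, hf.card_seg _ (by omega)]
    rw [← hcard]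
    exact (PathOn.cons hadj p hn).hasCycle ((hpat _ _).2.2 (by simp)) (by omega)
  · have p1 := hf.pathOn_seg' (a := 2 * a) (b := 2 * (b - 1) + 1) (l := 2 * b - 2 * a) (by omega)
      (by omega) (by omega)
    have p2 := hf.pathOn_seg' (a := 2 * (b + 1)) (b := 2 * (a + s) + 1)
      (l := 2 * a + 2 * s - 2 * b) (by omega) (by omega) (by omega)
    have d : Disjoint (seg f (2 * a) (2 * b - 2 * a))
        (seg f (2 * (b + 1)) (2 * a + 2 * s - 2 * b)) := hf.disjoint_seg (by omega) (by omega)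
    have hn : f (2 * b) ∉ seg f (2 * a) (2 * b - 2 * a) ∪
        seg f (2 * (b + 1)) (2 * a + 2 * s - 2 * b) := by
      rw [Finset.mem_union, not_or]
      exact ⟨hf.notMem_seg' (by omega) (by omega), hf.notMem_seg (by omega) (by omega)⟩
    have hcard : (insert (f (2 * b)) (seg f (2 * a) (2 * b - 2 * a) ∪
        seg f (2 * (b + 1)) (2 * a + 2 * s - 2 * b))).card = 2 * s + 1 := by
      rw [Finset.card_insert_of_notMem hn, Finset.card_union_of_disjoint d,
        hf.card_seg _ (by omega), hf.card_seg _ (by omega)]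
      omega
    rw [← hcard]
    exact (PathOn.cons hadj (p1.append ((hpat _ _).2.2 (by simp)) p2 d) hn).hasCycle
      ((hpat _ _).2.2 (by simp)) (by omega)

variable [Fintype V]

theorem isomorphic_completeBipartite {E : Finset V} {s t : ℕ} (hs : E.card = s)
    (ht : s + t = Fintype.card V) (hG : ∀ u v, G.Adj u v ↔ (u ∈ E ↔ v ∉ E)) :
    G.Isomorphic (completeBipartite s t) := by
  let κ : V → Fin 2 := fun v => if v ∈ E then 0 else 1
  let κ' : Fin s ⊕ Fin t → Fin 2 := Sum.elim (fun _ => 0) (fun _ => 1)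
  have hκ : ∀ u v, κ u ≠ κ v ↔ (u ∈ E ↔ v ∉ E) := by
    intro u v
    simp only [κ]
    split_ifs <;> simp_all
  refine isomorphic_of_coloring κ κ' ?_ (fun a b => a ≠ b) ?_ ?_
  · have e0 : Fintype.card {v // κ v = 0} = s := by
      rw [Fintype.card_subtype, show (Finset.univ.filter fun v => κ v = 0) = E by
        ext v; simp [κ], hs]
    have e1 : Fintype.card {v // κ v = 1} = t := by
      rw [Fintype.card_subtype, show (Finset.univ.filter fun v => κ v = 1) = Eᶜ by
        ext v; simp [κ], Finset.card_compl]
      omega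
    have e' : ∀ d, Fintype.card {w // κ' w = d} = ∑ w, if κ' w = d then 1 else 0 := by
      intro d; rw [Fintype.card_subtype, Finset.card_filter]
    intro d
    fin_cases d
    · exact e0.trans ((e' 0).trans
        (by simp only [Fintype.sum_sum_type, κ', Sum.elim_inl, Sum.elim_inr]; simp)).symm
    · exact e1.trans ((e' 1).trans
        (by simp only [Fintype.sum_sum_type, κ', Sum.elim_inl, Sum.elim_inr]; simp)).symm
  · intro u v
    rw [hκ, hG]
    refine ⟨fun h => ⟨?_, h⟩, fun h => h.2⟩
    rintro rfl
    tauto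
  · rintro (a | a) (b | b) <;> simp [κ', completeBipartite, ofSimpleGraph]

/-- A further outer vertex `w` would have the same relation to `z` and to all the odd vertices of the
cycle, so that an arc between `w` and an even vertex would allow an insertion. -/
theorem LongestSeq.eq_of_bipartite_pattern (h : G.LongestSeq m f A) (hm : 3 ≤ m)
    (hall : G.AllBlocks m f A) {z : V} (hz : z ∈ A) (ht : G.CycTight f z)
    (hpat : ∀ w, w = z ∨ (∃ n, w = f (2 * n + 1)) → ∀ j,
      (G.Adj (f j) w ↔ Even j) ∧ (G.Adj w (f j) ↔ Even j)) {w : V} (hw : w ∈ A) : w = z := by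
  have hblock : ∀ n, G.Block m (m - 1) (fun j => f (j + (2 * n + 2))) A (G.comp A z) :=
    fun n => h.block_single hm hz ht ((hpat z (.inl rfl) (2 * n)).1.2 (by simp))
      (fun h' => by simpa [parity_simps] using (hpat z (.inl rfl) _).1.1 h')
  have hz1 := mem_comp_self (G := G) A z
  by_cases hwS : w ∈ G.comp A z
  · have hcard := (hblock 0).card_le (h.rotate _)
    exact Finset.card_le_one.1 (hcard.trans (by omega)) w (by simpa using hwS) z (by simpa using hz1)
  obtain ⟨t, k, hb⟩ := hall w hw
  have htw := hb.tight w (mem_comp_self A w)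
  -- the relation between `w` and the odd vertices is the one between `w` and `z`
  have hodd : ∀ n, (G.Adj w z ∧ ¬ G.Adj z w ∧ G.Adj w (f (2 * n + 1)) ∧
      ¬ G.Adj (f (2 * n + 1)) w) ∨ (G.Adj z w ∧ ¬ G.Adj w z ∧ G.Adj (f (2 * n + 1)) w ∧
      ¬ G.Adj w (f (2 * n + 1))) := by
    intro n
    have hy := h.mem_seg_single (i := 2 * n) hm
    rcases (hblock n).outer w hw hwS with h' | h'
    · exact .inl ⟨(h'.1 z hz1).1, (h'.1 z hz1).2, (h'.2 _ hy).1, (h'.2 _ hy).2⟩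
    · exact .inr ⟨(h'.1 z hz1).1, (h'.1 z hz1).2, (h'.2 _ hy).1, (h'.2 _ hy).2⟩
  exfalso
  have hin : G.Adj (f (k - 1 + t)) w := htw.2.1
  have hout : G.Adj w (f (0 + t)) := htw.1
  by_cases hwz : G.Adj w z
  · have hodd' : ∀ n, G.Adj w (f (2 * n + 1)) ∧ ¬ G.Adj (f (2 * n + 1)) w := fun n => by
      rcases hodd n with h' | h'
      · exact h'.2.2
      · exact absurd hwz h'.2.1
    rcases Nat.even_or_odd' (k - 1 + t) with ⟨n, hn | hn⟩
    · rw [hn] at hin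
      exact h.not_insert hw _ ⟨hin, (hodd' n).1⟩
    · rw [hn] at hin
      exact (hodd' n).2 hin
  · have hodd' : ∀ n, G.Adj (f (2 * n + 1)) w ∧ ¬ G.Adj w (f (2 * n + 1)) := fun n => by
      rcases hodd n with h' | h'
      · exact absurd h'.1 hwz
      · exact h'.2.2
    rw [← h.cyc.per] at hout
    rcases Nat.even_or_odd' (0 + t + m) with ⟨n, hn | hn⟩
    · rw [show 0 + t + m = 2 * (n - 1) + 1 + 1 by omega] at hout
      exact h.not_insert hw _ ⟨(hodd' _).1, hout⟩
    · rw [hn] at hout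
      exact (hodd' n).2 hout

/-- If a cycle length is missing and the vertices of the cycle dominate `z` alternatingly, then the
digraph is a complete bipartite digraph. -/
theorem LongestSeq.isomorphic_of_alternating (h : G.LongestSeq m f A) (hall : G.AllBlocks m f A)
    (hm : 3 ≤ m) {z : V} (hz : z ∈ A) (ht : G.CycTight f z) {q : ℕ} (hq : 1 ≤ q)
    (hqm : q + 1 < m) (hno : ¬ G.HasCycle (q + 1)) (h0 : G.Adj (f 0) z) (h1 : ¬ G.Adj (f 1) z) :
    Odd (Fintype.card V) ∧
      G.Isomorphic (completeBipartite (Fintype.card V / 2) (Fintype.card V / 2 + 1)) := by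
  obtain ⟨hme, hqe, hpat⟩ := h.bipartite_pattern hm hz ht hq hqm.le hno h0 h1
  have hA : ∀ w ∈ A, w = z := fun w hw => h.eq_of_bipartite_pattern hm hall hz ht hpat hw
  have hcard : m + 1 = Fintype.card V := by
    rw [← h.card_add, show A.toFinset = {z} by
      ext w
      simp only [Set.mem_toFinset, Finset.mem_singleton]
      exact ⟨hA w, fun e => e ▸ hz⟩, Finset.card_singleton]
  obtain ⟨c, hc⟩ := hme.exists_two_nsmul
  simp only [smul_eq_mul] at hc
  have hdiv : Fintype.card V / 2 = c := by omega
  refine ⟨⟨c, by omega⟩, ?_⟩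
  set E : Finset V := (Finset.range c).image fun n => f (2 * n) with hE
  have hmem : ∀ j, f j ∈ E ↔ Even j := by
    intro j
    simp only [hE, Finset.mem_image, Finset.mem_range]
    constructor
    · rintro ⟨n, -, hn⟩
      have h4 := (h.cyc.modEq_of_eq hn).of_dvd hme.two_dvd
      rw [Nat.even_iff, ← h4, Nat.mul_mod_right]
    · intro hj
      have hlt := Nat.mod_lt j h.cyc.pos
      have hj' : Even (j % m) := (Nat.even_iff.2 (by
        rw [Nat.mod_mod_of_dvd _ hme.two_dvd]; exact Nat.even_iff.1 hj))
      obtain ⟨n, hn⟩ := hj'.exists_two_nsmul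
      simp only [smul_eq_mul] at hn
      exact ⟨n, by omega, by rw [← hn, h.cyc.apply_mod]⟩
  have hzE : z ∉ E := by
    simp only [hE, Finset.mem_image, not_exists, not_and]
    exact fun n _ => h.notMem_of_mem hz _
  have hcases : ∀ v, v = z ∨ ∃ j, v = f j := fun v => by
    by_cases hv : v ∈ A
    · exact .inl (hA v hv)
    · obtain ⟨j, hj⟩ := h.exists_of_notMem hv
      exact .inr ⟨j, hj.symm⟩
  have hpatz := hpat z (.inl rfl)
  have hpatf : ∀ n j, (G.Adj (f j) (f (2 * n + 1)) ↔ Even j) ∧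
      (G.Adj (f (2 * n + 1)) (f j) ↔ Even j) := fun n => hpat _ (.inr ⟨n, rfl⟩)
  have hq2 : 2 ≤ q := by
    rcases hqe.exists_two_nsmul with ⟨s, rfl⟩
    simp only [smul_eq_mul] at hq ⊢
    omega
  rw [hdiv]
  refine isomorphic_completeBipartite (E := E) ?_ (by omega) fun u v => ?_
  · rw [hE, Finset.card_image_of_injOn, Finset.card_range]
    intro a ha b hb hab
    simp only [Finset.coe_range, Set.mem_Iio] at ha hb
    have := h.cyc.inj _ (by omega) _ (by omega) hab
    omega
  · rcases hcases u with rfl | ⟨i, rfl⟩ <;> rcases hcases v with rfl | ⟨j, rfl⟩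
    · simp [hzE, h.loopless v]
    · simp [hzE, hmem, (hpatz j).2]
    · simp [hzE, hmem, (hpatz i).1]
    · rw [hmem, hmem]
      rcases Nat.even_or_odd i with hi | hi
      · rcases Nat.even_or_odd j with hj | hj
        · by_cases hij : f i = f j
          · rw [hij]
            simp [h.loopless (f j), hi, hj]
          · simp [h.cyc.not_adj_even hme hqe hqm hq2 hno hpatf hi hj hij, hi, hj]
        · obtain ⟨n, rfl⟩ := hj
          simp [(hpatf n i).1, hi]
      · obtain ⟨n, rfl⟩ := hi
        simp [(hpatf n j).2]

/-- Without the two complete digraphs that share a vertex, the only obstruction to cycles of all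
lengths is the complete bipartite digraph. -/
theorem LongestSeq.isomorphic_of_not_hasCycle (h : G.LongestSeq m f A) (hall : G.AllBlocks m f A)
    {z : V} (hz : z ∈ A) {q : ℕ} (hq : 1 ≤ q) (hqm : q + 1 ≤ m) (hno : ¬ G.HasCycle (q + 1)) :
    Odd (Fintype.card V) ∧
      G.Isomorphic (completeBipartite (Fintype.card V / 2) (Fintype.card V / 2 + 1)) := by
  have hmne : q + 1 ≠ m := by
    rintro rfl
    have hp := h.cyc.pathOn_seg' (a := 0) (b := q) (l := q + 1) (by omega) (by omega) le_rfl
    have hc := h.cyc.adj q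
    rw [← zero_add (q + 1), h.cyc.per] at hc
    have := hp.hasCycle hc (by rw [h.cyc.card_seg _ le_rfl]; omega)
    rw [h.cyc.card_seg _ le_rfl] at this
    exact hno this
  have hm : 3 ≤ m := by omega
  obtain ⟨t, k, hb⟩ := hall z hz
  have hk : k = m - 1 := by
    have := hb.lt
    by_contra hk
    exact hno (hb.hasCycle_of_two_le (h.rotate t) (by omega) (by omega) hqm)
  subst hk
  have hz1 := mem_comp_self (G := G) A z
  have hnon := hb.nonadj z hz1 (f (m - 1 + t))
    (mem_seg_of (f := fun i => f (i + t)) le_rfl (by omega))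
  have htz := hb.tight z hz1
  have hct := (h.rotate t).cyc.cycTight hm htz hnon.2 hnon.1
  -- rotate the cycle such that `f 0` dominates `z` and `f 1` does not
  have h' := h.rotate (m - 2 + t)
  have hall' : G.AllBlocks m (fun i => f (i + (m - 2 + t))) A := by
    intro w hw
    obtain ⟨t', k, hb⟩ := hall w hw
    obtain ⟨t'', h1, -, h3⟩ := h.cyc.exists_window (m - 2 + t) t'
    refine ⟨t'' - (m - 2 + t), k, ?_⟩
    have : (fun i => f (i + (t'' - (m - 2 + t)) + (m - 2 + t))) = fun i => f (i + t') := by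
      funext i
      rw [add_assoc, Nat.sub_add_cancel h1, ← h.cyc.apply_mod,
        (h.cyc.modEq_of_eq h3).add_left i, h.cyc.apply_mod]
    rwa [this]
  have hct' : G.CycTight (fun i => f (i + (m - 2 + t))) z := by
    intro i
    have := hct (i + (m - 2))
    simp only at this
    rwa [show i + (m - 2) + t = i + (m - 2 + t) by omega,
      show i + (m - 2) + 1 + t = i + 1 + (m - 2 + t) by omega] at this
  have h0 : G.Adj (f (0 + (m - 2 + t))) z := by
    have : G.Adj (f (m - 1 - 1 + t)) z := htz.2.1
    rwa [show m - 1 - 1 + t = 0 + (m - 2 + t) by omega] at this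
  have h1 : ¬ G.Adj (f (1 + (m - 2 + t))) z := by
    have := hnon.2
    rwa [show m - 1 + t = 1 + (m - 2 + t) by omega] at this
  exact h'.isomorphic_of_alternating hall' hm hz hct' hq (by omega) hno h0 h1

end

end Digraph

theorem theoremD {V : Type*} [Fintype V] (G : Digraph V) (hloop : G.Loopless)
    (hcard : 3 ≤ Fintype.card V) (hstrong : G.IsStrong) (hham : ¬ G.IsHamiltonian)
    (hM : G.ConditionM 0)
    (m : ℕ) (x : ZMod m → V) (hx : G.IsLongestCycle x)
    (A : Set V) (hA : A = (Set.range x)ᶜ) :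
    -- I
    ((∀ u ∈ A, ∀ v ∈ A, u ≠ v → G.Adjacent u v) ∧
      (∀ v ∈ A, G.deg v ≤ Fintype.card V - 1) ∧
      (∀ S, G.IsStrongComponentOn A S → (G.inducedOn S).IsComplete)) ∧
    -- II
    (¬ G.Isomorphic (Digraph.twoCliques (Fintype.card V - m) (m - 1)) →
      ∀ (h : ℕ) (D : Fin h → Set V), G.IsComponentLabelling A D → ∀ l : Fin h,
        ∃ (a b : ZMod m) (B : Set V), a ≠ b ∧ B = Digraph.between x a b ∧ B.Nonempty ∧
          (∃ u ∈ D l, ∃ v ∈ D l, G.Adj (x a) u ∧ G.Adj v (x b)) ∧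
          G.NoArcs B (⋃ i ≤ l, D i) ∧
          G.NoArcs (⋃ i ≥ l, D i) B ∧
          G.NoArcs (D l) B ∧ G.NoArcs B (D l) ∧
          (G.inducedOn B).IsComplete ∧
          G.Dominates (⋃ i < l, D i) (B ∪ D l) ∧
          G.Dominates (B ∪ D l) (⋃ i > l, D i) ∧
          (∀ z ∈ D l, (G.degOn z (Set.range x) : ℤ) = m - B.ncard + 1) ∧
          (∀ y ∈ B, (G.degOn y (Set.range x) : ℤ) = m + B.ncard - 1) ∧
          (D l).ncard ≤ B.ncard ∧
          (∀ w ∈ D l ∪ B, ¬ G.CanInsert x b a w) ∧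
          G.Dominates {x a} (B ∪ D l) ∧ G.Dominates (B ∪ D l) {x b}) ∧
    -- III
    (G.IsKStrong 2 → (G.inducedOn A).IsTransitiveTournament) ∧
    -- IV
    (¬ (Odd (Fintype.card V) ∧
        G.Isomorphic (Digraph.completeBipartite
          (Fintype.card V / 2) (Fintype.card V / 2 + 1))) →
      ∀ r, 2 ≤ r → r ≤ m → G.HasCycle r) := by
  have hm2 := hx.1.1
  have : NeZero m := ⟨by omega⟩
  set f : ℕ → V := fun i => x (i : ZMod m)
  have h : G.LongestSeq m f A := by
    refine ⟨hloop, hx.1.cyclicSeq, hx.2, by rw [hA, Digraph.range_natCast], ?_⟩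
    intro u v huv h1 h2
    have := hM u v huv (fun h' => h'.elim h1 h2)
    rw [Digraph.deg_eq, Digraph.deg_eq] at this
    omega
  have hne : A.Nonempty := by
    by_contra hne
    rw [Set.not_nonempty_iff_eq_empty, hA, Set.compl_empty_iff, Set.range_eq_univ] at hne
    exact hham ⟨m, x, hx.1, hne⟩
  rcases h.allBlocks_or_twoComplete hstrong hne with hall | ⟨c, hG⟩
  · refine ⟨⟨?_, ?_, ?_⟩, ?_, ?_, ?_⟩
    · intro u hu v hv huv
      obtain ⟨t, k, hb⟩ := hall u hu
      exact hb.adjacent (Digraph.mem_comp_self A u) hv huv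
    · intro v hv
      obtain ⟨t, k, hb⟩ := hall v hv
      have := hb.deg_le (h.rotate t) (Digraph.mem_comp_self A v)
      omega
    · rintro S hS ⟨u, hu⟩ ⟨v, hv⟩ huv
      obtain ⟨t, k, hb⟩ := hall u (hS.prop.1 hu)
      rw [← hS.eq_comp hu] at hb
      exact hb.complete u hu v hv fun e => huv (Subtype.ext e)
    · intro _ n D hD l
      have hl : G.IsStrongComponentOn A (D l) := by
        have : D l ∈ {S | G.IsStrongComponentOn A S} := hD.range_eq ▸ ⟨l, rfl⟩
        exact this
      obtain ⟨z, hz⟩ := hl.prop.2.1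
      obtain ⟨t, k, hb⟩ := hall z (hl.prop.1 hz)
      rw [← hl.eq_comp hz] at hb
      exact hb.segment_properties h hD l
    · exact hall.isTransitiveTournament h
    · intro hexc r h2 hr
      by_contra hno
      obtain ⟨z, hz⟩ := hne
      obtain ⟨q, rfl⟩ : ∃ q, r = q + 1 := ⟨r - 1, by omega⟩
      exact hexc (h.isomorphic_of_not_hasCycle hall hz (by omega) hr hno)
  · refine ⟨⟨fun u hu v hv huv => .inl (hG.outer u hu v hv huv), fun v hv => ?_, ?_⟩,
      fun hiso => absurd (hG.isomorphic h) hiso, fun hst => absurd hst (hG.not_isKStrong h hne),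
      fun _ r h2 hr => hG.hasCycle h h2 hr⟩
    · have := hG.deg_le h hv
      omega
    · rintro S hS ⟨u, hu⟩ ⟨v, hv⟩ huv
      exact hG.outer u (hS.prop.1 hu) v (hS.prop.1 hv) fun e => huv (Subtype.ext e)
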